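/- **Setting.** Let $G$ be a connected Lie group with Lie algebra $\mathfrak g$, equipped with a right-invariant Riemannian structure and the corresponding distance. Let $\Gamma\subset G$ be a lattice and $X=G/\Gamma$, with the induced distance and the $G$-invariant probability measure $\mu$. Write $B(r)$ for the open ball of radius $r$ in $G$ centered at $e$. For $x\in X$ put $r_0(x)=\sup\{r>0: g\mapsto gx \text{ is injective on } B(r)\}$, and for $K\subset X$ put $r_0(K)=\inf_{x\in K}r_0(x)$. For $r>0$, $S\subset X$ and open $O\subset X$ put $\partial_rS=\{x:\operatorname{dist}(x,S)<r\}$ and $\sigma_rO=\{x:\operatorname{dist}(x,O^c)>r\}$. Let $F=\{g_t:t\ge0\}$, where $t\mapsto g_t$ ($t\in\mathbb R$) is a continuous one-parameter subgroup of $G$ such that the $\operatorname{Ad}(g_t)$ are simultaneously diagonalizable over $\mathbb R$. Let $\operatorname{ad}_{g_1}$ be the operator with $\operatorname{Ad}(g_t)=e^{t\operatorname{ad}_{g_1}}$, and let $H=\{h\in G: g_thg_{-t}\to e \text{ as } t\to-\infty\}$. Let $P$ be a nontrivial connected Lie subgroup of $G$ which is contained in $H$ and normalized by $F$, with the induced Riemannian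 structure and its distance, a Haar measure $\nu$, Lie algebra $\mathfrak p$ and $p=\dim P$. Write $B^P(r)$ for the open ball of radius $r$ in $P$ centered at $e$. Let $\lambda_{\min}$ be the smallest eigenvalue and $\delta$ the trace of $\operatorname{ad}_{g_1}|_{\mathfrak p}$. **Property (EEP).** Fix bases of $\mathfrak g$ and $\mathfrak p$. For $Y$ in the Lie algebra of a Lie group acting on a space write $(Y\psi)(x)=\frac{d}{ds}\big|_{s=0}\psi(\exp(sY)x)$, and let $D^\alpha$ denote the ordered monomials $Y_1^{\alpha_1}Y_2^{\alpha_2}\cdots$ in the basis elements. On $X$ (acted upon by $G$) and on $P$ (acting on itself by left translations) put $\|f\|_{C^\ell}=\sup_{x,\,|\alpha|\le\ell}|D^\alpha f(x)|$, and on $X$ put $\|\psi\|_{\ell,2}=\sum_{|\alpha|\le \ell}\|D^\alpha\psi\|_{L^2(\mu)}$. Let $C_2^\infty(X)$ be the space of $\psi\in C^\infty(X)$ with $\|\psi\|_{\ell,2}<\infty$ for all $\ell$. The subgroup $P$ has (EEP) with respect to $(X,F)$ if there are $a,b,\lambda_0,C>0$ and an integer $\ell\ge0$ such that $$\Big|\int_Pf(h)\psi(g_thx)\,d\nu(h)-\int_Pf\,d\nu\int_X\psi\,d\mu\Big|\le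 C\max\big(\|\psi\|_{C^1},\|\psi\|_{\ell,2}\big)\,\|f\|_{C^\ell}\,e^{-\lambda_0t}$$ for all $x\in X$, all $t>0$ with $t\ge a+b\log\frac1{r_0(x)}$, all $f\in C^\infty(P)$ with $\operatorname{supp}f\subset B^P(1)$, and all $\psi\in C^\infty_2(X)$. **Boxes.** An open set $V\subset P$ is a tessellation domain relative to a countable set $\Lambda\subset P$ if $\nu(\partial V)=0$, the sets $V\gamma$ $(\gamma\in\Lambda)$ are pairwise disjoint, and $P=\bigcup_{\gamma\in\Lambda}\overline V\gamma$. For an orthonormal basis of $\mathfrak p$ let $I_{\mathfrak p}$ be the open cube of side length $1$ centered at $0$ with sides parallel to the basis vectors. Call the basis *tessellating* if for every $s>0$ the set $\exp(sI_{\mathfrak p})$ is a tessellation domain relative to some countable set. Given such a basis put $V_r=\exp\big(\frac r{4\sqrt p}I_{\mathfrak p}\big)$. A Bowen $(t,r)$-box, $t\ge0$, is a set of the form $g_{-t}\overline{V_r}\gamma g_t$ with $\gamma\in P$. Call $r_*\in(0,\frac14)$ *admissible* if $\exp:\mathfrak p\to P$ is $2$-bi-Lipschitz on the open ball of radius $r_*$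 centered at $0$. **Theorem.** Suppose that $P$ has (EEP) with respect to $(X,F)$. Tessellating orthonormal bases of $\mathfrak p$ and admissible $r_*$ exist, and for every choice of a tessellating orthonormal basis and of an admissible $r_*$ there are constants $a',b',C_2,\lambda>0$ with $a',b'\ge\frac{\log(8\sqrt p)}{\lambda_{\min}}$ such that the following holds. For every open $O\subset X$, every $r$ with $$0<r<\tfrac12\min\big(r_0(\partial_{1/2}(O^c)),\,r_*\big),$$ every $x\in\partial_r(O^c)$, every $t\ge a'+b'\log\frac1r$ and every $N\in\mathbb N$, the set $$\{h\in\overline{V_r}:\ g_{\ell t}hx\notin O\ \text{ for all } \ell\in\{1,\dots,N\}\}$$ can be covered by at most $$e^{\delta Nt}\Big(1-\mu(\sigma_rO)+\frac{C_2}{r^p}e^{-\lambda t}\Big)^N$$ Bowen $(Nt,r)$-boxes in $P$. -/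

import Mathlib

open scoped Manifold ContDiff Topology Bundle

namespace HomDyn

noncomputable section

open MeasureTheory Set Filter

/-! ### Lie groups: exponential map, adjoint action, Riemannian structures -/

section Lie

variable (E : Type*) [NormedAddCommGroup E] [NormedSpace ℝ E]
  {G : Type*} [Group G] [TopologicalSpace G] [ChartedSpace E G]

/-- The exponential map of a Lie group: `lieExp E v = γ 1`, where `γ` is the integral curve through
the identity of the left-invariant vector field with value `v` at the identity (this curve exists
on all of `ℝ`, is unique, and is the one-parameter subgroup with initial velocity `v`). -/
def lieExp (v : TangentSpace 𝓘(ℝ, E) (1 : G)) : G :=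
  open Classical in
  if h : ∃ γ : ℝ → G, γ 0 = 1 ∧
      IsMIntegralCurve (I := 𝓘(ℝ, E)) γ (mulInvariantVectorField v) then h.choose 1 else 1

/-- The adjoint action `Ad g` on the Lie algebra: the derivative at `1` of `x ↦ g x g⁻¹`.
(The tangent spaces at `g * 1 * g⁻¹` and at `1` are the same since the two points are equal.) -/
def Ad (g : G) : TangentSpace 𝓘(ℝ, E) (1 : G) →L[ℝ] TangentSpace 𝓘(ℝ, E) (1 : G) :=
  mfderiv 𝓘(ℝ, E) 𝓘(ℝ, E) (fun x : G => g * x * g⁻¹) (1 : G)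

/-- A continuous one-parameter subgroup `t ↦ g t`; the semigroup `F` is `{g t : t ≥ 0}`. -/
structure IsOneParameter (g : ℝ → G) : Prop where
  map_add : ∀ s t, g (s + t) = g s * g t
  continuous : Continuous g

/-- `F` is `Ad`-diagonalizable (over `ℝ`): the Lie algebra has a basis of common eigenvectors of all
`Ad (g t)`, with `Ad (g t)` acting on the `i`-th one by `exp (t * c i)`. -/
def IsAdDiagonalizable (g : ℝ → G) : Prop :=
  ∃ (n : ℕ) (B : Module.Basis (Fin n) ℝ (TangentSpace 𝓘(ℝ, E) (1 : G))) (c : Fin n → ℝ),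
    ∀ t i, Ad E (g t) (B i) = Real.exp (t * c i) • B i

/-- The infinitesimal generator `ad_{g_1}` of `t ↦ Ad (g t)`, so that `Ad (g t) = exp (t ad_{g_1})`. -/
def adGen (g : ℝ → G) : TangentSpace 𝓘(ℝ, E) (1 : G) →L[ℝ] TangentSpace 𝓘(ℝ, E) (1 : G) :=
  deriv (fun t => Ad E (g t)) 0

/-- The unstable horospherical subgroup `H = {h : g_t h g_{-t} → e as t → -∞}`, as a set. -/
def unstableHorospherical (g : ℝ → G) : Set G :=
  {h | Tendsto (fun t => g t * h * g (-t)) atBot (𝓝 1)}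

/-- The derivative of a function `ψ` on a space acted upon by a Lie group, along the
element `Y` of the Lie algebra: `(Y ψ)(x) = d/ds ψ (exp (s Y) x)` at `s = 0`. -/
def lieDeriv {X : Type*} [SMul G X] (Y : TangentSpace 𝓘(ℝ, E) (1 : G)) (ψ : X → ℝ) : X → ℝ :=
  fun x => deriv (fun s : ℝ => ψ (lieExp E (s • Y) • x)) 0

/-- `D^α = Y_1^{α_1} ⋯ Y_n^{α_n}`. -/
def multiDeriv {X : Type*} [SMul G X] {n : ℕ} (Y : Fin n → TangentSpace 𝓘(ℝ, E) (1 : G))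
    (α : Fin n → ℕ) (ψ : X → ℝ) : X → ℝ :=
  (List.finRange n).foldr (fun i φ => (lieDeriv E (Y i))^[α i] φ) ψ

variable (G)

/-- A fixed basis of the Lie algebra, used to define the norms below (another choice changes them
by bounded factors only). -/
def lieBasis [FiniteDimensional ℝ E] :
    Module.Basis (Fin (Module.finrank ℝ (TangentSpace 𝓘(ℝ, E) (1 : G)))) ℝ
      (TangentSpace 𝓘(ℝ, E) (1 : G)) :=
  haveI : FiniteDimensional ℝ (TangentSpace 𝓘(ℝ, E) (1 : G)) := inferInstanceAs (FiniteDimensional ℝ E)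
  Module.finBasis ℝ (TangentSpace 𝓘(ℝ, E) (1 : G))

variable [FiniteDimensional ℝ E] {X : Type*} [SMul G X]

/-- The `C^ℓ` norm: the supremum of `|D^α ψ (x)|` over all `x` and all `|α| ≤ ℓ` (possibly `∞`). -/
def cNorm (ℓ : ℕ) (ψ : X → ℝ) : ENNReal :=
  ⨆ (x : X) (α : Fin (Module.finrank ℝ (TangentSpace 𝓘(ℝ, E) (1 : G))) → ℕ) (_ : ∑ i, α i ≤ ℓ),
    ‖multiDeriv E (lieBasis E G) α ψ x‖ₑ

/-- The `L²`, order `ℓ` Sobolev norm: the sum of the `L²` norms of `D^α ψ` over all `|α| ≤ ℓ`. -/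
def sobolevNorm [MeasurableSpace X] (μ : Measure X) (ℓ : ℕ) (ψ : X → ℝ) : ENNReal :=
  ∑' α : {α : Fin (Module.finrank ℝ (TangentSpace 𝓘(ℝ, E) (1 : G))) → ℕ // ∑ i, α i ≤ ℓ},
    eLpNorm (multiDeriv E (lieBasis E G) α.1 ψ) 2 μ

end Lie

section Riemann

variable (E : Type*) [NormedAddCommGroup E] [NormedSpace ℝ E]
  (E' : Type*) [NormedAddCommGroup E'] [NormedSpace ℝ E']
  {G : Type*} [Group G] [TopologicalSpace G] [ChartedSpace E G]
  [Bundle.RiemannianBundle (fun x : G => TangentSpace 𝓘(ℝ, E) x)]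
  {P : Type*} [Group P] [TopologicalSpace P] [ChartedSpace E' P]
  [Bundle.RiemannianBundle (fun x : P => TangentSpace 𝓘(ℝ, E') x)]

variable (G) in
/-- The Riemannian structure on `G` is invariant under right translations. -/
def IsRightInvariant : Prop :=
  ∀ (g h : G) (v : TangentSpace 𝓘(ℝ, E) g),
    ‖mfderiv 𝓘(ℝ, E) 𝓘(ℝ, E) (fun x : G => x * h) g v‖ = ‖v‖

/-- `ι : P → G` exhibits `P` as a Lie subgroup of `G` (an injective smooth homomorphism which is
an immersion), with the Riemannian structure of `P` induced from that of `G`. -/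
structure IsRiemannianLieSubgroup (ι : P →* G) : Prop where
  injective : Function.Injective ι
  contMDiff : ContMDiff 𝓘(ℝ, E') 𝓘(ℝ, E) ∞ ι
  norm_mfderiv : ∀ (h : P) (v : TangentSpace 𝓘(ℝ, E') h),
    ‖mfderiv 𝓘(ℝ, E') 𝓘(ℝ, E) ι h v‖ = ‖v‖

end Riemann

section Subgroup

variable (E : Type*) [NormedAddCommGroup E] [NormedSpace ℝ E]
  (E' : Type*) [NormedAddCommGroup E'] [NormedSpace ℝ E']
  {G : Type*} [Group G] [TopologicalSpace G] [ChartedSpace E G]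
  {P : Type*} [Group P] [TopologicalSpace P] [ChartedSpace E' P]

/-- The inclusion of Lie algebras `𝔭 → 𝔤` induced by `ι : P → G`. -/
def lieIncl (ι : P →* G) : TangentSpace 𝓘(ℝ, E') (1 : P) →L[ℝ] TangentSpace 𝓘(ℝ, E) (1 : G) :=
  mfderiv 𝓘(ℝ, E') 𝓘(ℝ, E) ι (1 : P)

/-- The restriction of `ad_{g_1}` to `𝔭`, as an endomorphism of `𝔭`. It satisfies
`lieIncl (adOn v) = adGen (lieIncl v)` when `P` is normalized by `F`. -/
def adOn (ι : P →* G) (g : ℝ → G) :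
    TangentSpace 𝓘(ℝ, E') (1 : P) →ₗ[ℝ] TangentSpace 𝓘(ℝ, E') (1 : P) :=
  (lieIncl E E' ι : TangentSpace 𝓘(ℝ, E') (1 : P) →ₗ[ℝ] TangentSpace 𝓘(ℝ, E) (1 : G)).leftInverse ∘ₗ
    (adGen E g : TangentSpace 𝓘(ℝ, E) (1 : G) →ₗ[ℝ] TangentSpace 𝓘(ℝ, E) (1 : G)) ∘ₗ
    (lieIncl E E' ι : TangentSpace 𝓘(ℝ, E') (1 : P) →ₗ[ℝ] TangentSpace 𝓘(ℝ, E) (1 : G))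

/-- The smallest eigenvalue of `ad_{g_1}` on `𝔭`. -/
def lambdaMin (ι : P →* G) (g : ℝ → G) : ℝ :=
  sInf {c : ℝ | Module.End.HasEigenvalue (adOn E E' ι g) c}

/-- `δ`, the trace of `ad_{g_1}` on `𝔭`. -/
def deltaTr (ι : P →* G) (g : ℝ → G) : ℝ :=
  LinearMap.trace ℝ _ (adOn E E' ι g)

end Subgroup

/-! ### Geometry of the homogeneous space `X = G/Γ` -/

section Quotient

variable {G : Type*} [Group G] [MetricSpace G] (Γ : Subgroup G)

/-- The distance on `G/Γ` induced from `G`. -/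
def quotEDist (x y : G ⧸ Γ) : ENNReal :=
  ⨅ (g : G) (h : G) (_ : (g : G ⧸ Γ) = x) (_ : (h : G ⧸ Γ) = y), edist g h

/-- The distance from a point of `G/Γ` to a subset (`∞` when the subset is empty). -/
def quotInfEDist (x : G ⧸ Γ) (S : Set (G ⧸ Γ)) : ENNReal := ⨅ y ∈ S, quotEDist Γ x y

/-- The inner `r`-core `σ_r O = {x : dist (x, Oᶜ) > r}`. -/
def innerCore (r : ℝ) (O : Set (G ⧸ Γ)) : Set (G ⧸ Γ) :=
  {x | ENNReal.ofReal r < quotInfEDist Γ x Oᶜ}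

/-- The `r`-neighborhood `∂_r S = {x : dist (x, S) < r}`. -/
def nbhd (r : ℝ) (S : Set (G ⧸ Γ)) : Set (G ⧸ Γ) :=
  {x | quotInfEDist Γ x S < ENNReal.ofReal r}

/-- The injectivity radius `r_0(x)`: the supremum of the `r > 0` such that `g ↦ g x` is injective
on the open ball of radius `r` centered at the identity. -/
def injRadius (x : G ⧸ Γ) : ℝ :=
  sSup {r : ℝ | 0 < r ∧ InjOn (fun g : G => g • x) (Metric.ball 1 r)}

/-- The injectivity radius `r_0(K)`: the infimum of `r_0(x)` over `x ∈ K`. -/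
def injRadiusOn (K : Set (G ⧸ Γ)) : ℝ := sInf (injRadius Γ '' K)

end Quotient

/-! ### Effective equidistribution -/

section EEP

variable (E : Type*) [NormedAddCommGroup E] [NormedSpace ℝ E] [FiniteDimensional ℝ E]
  (E' : Type*) [NormedAddCommGroup E'] [NormedSpace ℝ E'] [FiniteDimensional ℝ E']
  {G : Type*} [Group G] [MetricSpace G] [ChartedSpace E G]
  (Γ : Subgroup G) [MeasurableSpace (G ⧸ Γ)] (μ : Measure (G ⧸ Γ))
  {P : Type*} [Group P] [MetricSpace P] [ChartedSpace E' P]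
  [MeasurableSpace P] (ν : Measure P)

/-- The space `C^∞_2(X)`: smooth functions on `G/Γ` (i.e. whose lifts to `G` are
smooth) all of whose `L²` Sobolev norms are finite. -/
def IsC2Smooth (ψ : G ⧸ Γ → ℝ) : Prop :=
  ContMDiff 𝓘(ℝ, E) 𝓘(ℝ, ℝ) ∞ (fun g : G => ψ (g : G ⧸ Γ)) ∧
    ∀ ℓ : ℕ, sobolevNorm E G μ ℓ ψ < ⊤

/-- The Effective Equidistribution Property of `P` with respect to the flow `(X, F)`. -/
def EEP (ι : P →* G) (g : ℝ → G) : Prop :=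
  ∃ (a b lam C : ℝ) (ℓ : ℕ), 0 < a ∧ 0 < b ∧ 0 < lam ∧ 0 < C ∧
    ∀ (x : G ⧸ Γ) (t : ℝ), 0 < t → a + b * Real.log (1 / injRadius Γ x) ≤ t →
    ∀ f : P → ℝ, ContMDiff 𝓘(ℝ, E') 𝓘(ℝ, ℝ) ∞ f → tsupport f ⊆ Metric.ball 1 1 →
    ∀ ψ : G ⧸ Γ → ℝ, IsC2Smooth E Γ μ ψ →
      ENNReal.ofReal |(∫ h, f h * ψ (g t • ι h • x) ∂ν) - (∫ h, f h ∂ν) * ∫ y, ψ y ∂μ| ≤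
        ENNReal.ofReal C * max (cNorm E G 1 ψ) (sobolevNorm E G μ ℓ ψ) * cNorm E' P ℓ f *
          ENNReal.ofReal (Real.exp (-lam * t))

end EEP

/-! ### Tessellations and Bowen boxes -/

section Tessellation

variable (E' : Type*) [NormedAddCommGroup E'] [NormedSpace ℝ E'] [FiniteDimensional ℝ E']
  {P : Type*} [Group P] [MetricSpace P] [ChartedSpace E' P]
  [Bundle.RiemannianBundle (fun x : P => TangentSpace 𝓘(ℝ, E') x)]

/-- `V` is a tessellation domain of `P` relative to the countable set `Λ`. -/
structure IsTessellationDomain [MeasurableSpace P] (ν : Measure P) (V Λ : Set P) : Prop where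
  isOpen : IsOpen V
  countable : Λ.Countable
  measure_frontier : ν (frontier V) = 0
  disjoint : ∀ γ₁ ∈ Λ, ∀ γ₂ ∈ Λ, γ₁ ≠ γ₂ →
    Disjoint ((fun v => v * γ₁) '' V) ((fun v => v * γ₂) '' V)
  cover : (⋃ γ ∈ Λ, (fun v => v * γ) '' closure V) = univ

/-- `exp (s I)`, where `I` is the open cube with side length `1` centered at `0`, with sides
parallel to the orthonormal basis `B` of the Lie algebra. -/
def expCube {n : ℕ} (B : OrthonormalBasis (Fin n) ℝ (TangentSpace 𝓘(ℝ, E') (1 : P))) (s : ℝ) :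
    Set P :=
  lieExp E' '' {v : TangentSpace 𝓘(ℝ, E') (1 : P) | ∀ i, |B.repr v i| < s / 2}

/-- `exp (s I)` is a tessellation domain for all `s > 0` (relative to some countable set). -/
def IsTessellationBasis [MeasurableSpace P] (ν : Measure P) {n : ℕ}
    (B : OrthonormalBasis (Fin n) ℝ (TangentSpace 𝓘(ℝ, E') (1 : P))) : Prop :=
  ∀ s : ℝ, 0 < s → ∃ Λ : Set P, IsTessellationDomain ν (expCube E' B s) Λ

variable (P) in
/-- `0 < r_* < 1/4` and the exponential map of `P` is `2`-bi-Lipschitz on the ball of radius `r_*`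
centered at `0`. -/
def IsExpRadius (rs : ℝ) : Prop :=
  0 < rs ∧ rs < 1 / 4 ∧
    ∀ v w : TangentSpace 𝓘(ℝ, E') (1 : P), ‖v‖ < rs → ‖w‖ < rs →
      ‖v - w‖ / 2 ≤ dist (lieExp E' v) (lieExp E' w) ∧
        dist (lieExp E' v) (lieExp E' w) ≤ 2 * ‖v - w‖

/-- `V_r = exp (r / (4 √p) I)` with `p = dim P`. -/
def boxV {p : ℕ} (B : OrthonormalBasis (Fin p) ℝ (TangentSpace 𝓘(ℝ, E') (1 : P))) (r : ℝ) : Set P :=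
  expCube E' B (r / (4 * √(p : ℝ)))

variable {G : Type*} [Group G]

/-- Bowen `(t, r)`-boxes in `P`: sets of the form `g_{-t} V̄_r γ g_t` with `γ ∈ P` and `t ≥ 0`. -/
def IsBowenBox (ι : P →* G) (g : ℝ → G) {p : ℕ}
    (B : OrthonormalBasis (Fin p) ℝ (TangentSpace 𝓘(ℝ, E') (1 : P))) (t r : ℝ) (R : Set P) : Prop :=
  0 ≤ t ∧ ∃ γ : P, R = {h : P | ∃ v ∈ closure (boxV E' B r), ι h = g (-t) * ι (v * γ) * g t}

/-- `A^N_x(t, r, S) = {h ∈ V̄_r : g_{ℓ t} h x ∈ S for all ℓ ∈ {1, …, N}}`. -/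
def escapeSet (Γ : Subgroup G) (ι : P →* G) (g : ℝ → G) {p : ℕ}
    (B : OrthonormalBasis (Fin p) ℝ (TangentSpace 𝓘(ℝ, E') (1 : P)))
    (x : G ⧸ Γ) (N : ℕ) (t r : ℝ) (S : Set (G ⧸ Γ)) : Set P :=
  {h | h ∈ closure (boxV E' B r) ∧ ∀ ℓ ∈ Finset.Icc 1 N, g ((ℓ : ℝ) * t) • ι h • x ∈ S}

end Tessellation

end

end HomDyn

/-! The one-step count is a comparison of volumes. Conjugation by `g t` induces automorphisms `c t`
of `P` that multiply Haar measure by e^{δt}. Hence the cells c_{-t}(V_r γ), with γ in the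
tessellating set, are disjoint of measure e^{-δt} ν(V_r), and their closed versions cover `P`. If a
closed cell contains a point h of the closed box with g_t h x outside O, then the whole open cell
lies in a tiny thickening of the box, since c_{-t} contracts. Moreover g_t sends it into the
5r/8-neighbourhood of Oᶜ, since the g_t-images of two points of one cell differ by an element of
V̄_r V̄_r⁻¹. So the number of cells needed is at most e^{δt}/ν(V_r) times the measure of the set W
of all points with these two properties.

To bound ν(W), (EEP) is tested on a smooth majorant f of the indicator of the thickened box and a
smooth majorant ψ of the indicator of the neighbourhood of Oᶜ. The main term is at most ν(V_r)(1 −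
μ(σ_r O)) plus the volume of a thin shell. The smoothing scale of f decays exponentially in t,
slowly enough for its C^ℓ norm to be beaten by e^{-λ₀t}. That of ψ is proportional to r, so its
norms are polynomial in 1/r and are absorbed by the condition t ≥ a' + b' log(1/r). Dividing by
ν(V_r), which is at least a constant times r^p, produces the error (C₂/r^p) e^{-λt}. This is
`exists_cover_one_step`.

The steps compose because of the identity g_{Nt} h x = v · (γ g_{Nt} x) whenever c_{Nt}(h) = vγ. If
the left side is outside O and v is in the closed box, the new base point γ g_{Nt} x lies in the
r-neighbourhood of Oᶜ, where the same one-step bound holds. This is `exists_cover_iterate`.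

The facts needed about `P` all come from one principle: establish them near the identity and
transport them by the contraction c_{-t}. Near 0 the exponential map is strictly differentiable with
derivative the identity, hence 2-bi-Lipschitz (`exists_gexp_biLipschitz`), and it compares Haar with
Lebesgue measure. The contraction then shows that exp is a homeomorphism, that `P` is unimodular,
and that `c t` scales measure exactly by e^{δt} (`measure_image_map`). It also shows that the group
law in logarithmic coordinates is triangular along the flag of eigenvalues
(`repr_logMul_sub_eq_zero`). Triangularity lets cubes be tiled by points with coordinates in sℤ, one
coordinate at a time. -/

namespace HomDyn

set_option linter.unusedSectionVars false
set_option linter.style.haveILetI false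

open MeasureTheory Set Filter

/-! ### The exponential map of a Lie group: one-parameter subgroups and naturality. -/

section LieExp

variable {E : Type*} [NormedAddCommGroup E] [NormedSpace ℝ E] [CompleteSpace E]
  {G : Type*} [Group G] [TopologicalSpace G] [ChartedSpace E G] [LieGroup 𝓘(ℝ, E) ∞ G]

variable (E G) in
lemma lieGroup_minSmoothness : LieGroup 𝓘(ℝ, E) (minSmoothness ℝ 3) G :=
  LieGroup.of_le (n := ∞) (by simpa using (WithTop.coe_le_coe.2 le_top : ((3 : ℕ∞) : ℕ∞ω) ≤ ∞))

lemma mdifferentiable_mul_left (g : G) : MDifferentiable 𝓘(ℝ, E) 𝓘(ℝ, E) (fun x : G => g * x) :=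
  (contMDiff_mul_left (I := 𝓘(ℝ, E)) (n := ∞)).mdifferentiable (by simp)

lemma mdifferentiable_mul_right (g : G) : MDifferentiable 𝓘(ℝ, E) 𝓘(ℝ, E) (fun x : G => x * g) :=
  (contMDiff_mul_right (I := 𝓘(ℝ, E)) (n := ∞)).mdifferentiable (by simp)

/-- Chain rule for y ↦ g(xy). The points `x * 1` and `x` are equal only propositionally, so
derivatives are compared as maps of the model space `E`, with which every tangent space is
identified by definition. -/
lemma mfderiv_mul_left_mulInvariantVectorField (g x : G) (v : TangentSpace 𝓘(ℝ, E) (1 : G)) :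
    mfderiv 𝓘(ℝ, E) 𝓘(ℝ, E) (fun y : G => g * y) x (mulInvariantVectorField v x) =
      mulInvariantVectorField v (g * x) := by
  have h : (fun y : G => g * x * y) = (fun y : G => g * y) ∘ (fun y : G => x * y) := by
    ext y; simp [mul_assoc]
  have h2 := mfderiv_comp (I := 𝓘(ℝ, E)) (I' := 𝓘(ℝ, E)) (I'' := 𝓘(ℝ, E)) (1 : G)
    (f := fun y : G => x * y) (g := fun y : G => g * y)
    (mdifferentiable_mul_left g _) (mdifferentiable_mul_left x _)
  rw [← h] at h2
  have h3 : ∀ y : G, y = x → (mfderiv 𝓘(ℝ, E) 𝓘(ℝ, E) (fun y : G => g * y) y : E →L[ℝ] E) =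
      mfderiv 𝓘(ℝ, E) 𝓘(ℝ, E) (fun y : G => g * y) x := by rintro y rfl; rfl
  have h4 := congrArg (fun L : E →L[ℝ] E => L v) h2
  have h5 := congrArg (fun L : E →L[ℝ] E => L (mulInvariantVectorField v x)) (h3 _ (mul_one x))
  exact h5.symm.trans h4.symm

lemma isMIntegralCurveOn_mul_left {γ : ℝ → G} {v : TangentSpace 𝓘(ℝ, E) (1 : G)} {s : Set ℝ}
    (hγ : IsMIntegralCurveOn (I := 𝓘(ℝ, E)) γ (mulInvariantVectorField v) s) (g : G) :
    IsMIntegralCurveOn (I := 𝓘(ℝ, E)) (fun t => g * γ t) (mulInvariantVectorField v) s := by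
  intro t ht
  have h := (mdifferentiable_mul_left (E := E) g (γ t)).hasMFDerivAt.comp_hasMFDerivWithinAt t (hγ t ht)
  refine h.congr_mfderiv (ContinuousLinearMap.ext fun c => ?_)
  have h2 : ∀ (A : E →L[ℝ] E) (c : ℝ) (v w : E), A v = w → A (c • v) = c • w := by
    rintro A c v _ rfl; exact map_smul A c v
  exact h2 _ c _ _ (mfderiv_mul_left_mulInvariantVectorField g (γ t) v)

/-- Left translates of one local solution through the identity give solutions through every point on
a time interval of fixed length; this uniformity makes the field complete. -/
lemma exists_isMIntegralCurve_mulInvariantVectorField [T2Space G]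
    (v : TangentSpace 𝓘(ℝ, E) (1 : G)) :
    ∃ γ : ℝ → G, γ 0 = 1 ∧ IsMIntegralCurve (I := 𝓘(ℝ, E)) γ (mulInvariantVectorField v) := by
  have := lieGroup_minSmoothness E G
  have hv : ContMDiff 𝓘(ℝ, E) 𝓘(ℝ, E).tangent 1
      (fun x => (⟨x, mulInvariantVectorField v x⟩ : TangentBundle 𝓘(ℝ, E) G)) :=
    (contMDiff_mulInvariantVectorField v).of_le (by simp)
  obtain ⟨γ, h0, hγ⟩ := exists_isMIntegralCurveAt_of_contMDiffAt_boundaryless (I := 𝓘(ℝ, E))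
    (t₀ := 0) (x₀ := (1 : G)) hv.contMDiffAt
  rw [isMIntegralCurveAt_iff'] at hγ
  obtain ⟨ε, hε, hγ⟩ := hγ
  refine exists_isMIntegralCurve_of_isMIntegralCurveOn hv hε (fun x => ⟨fun t => x * γ t, ?_, ?_⟩) 1
  · simp [h0]
  · have := isMIntegralCurveOn_mul_left hγ x
    rwa [Real.ball_eq_Ioo, zero_sub, zero_add] at this

lemma isMIntegralCurve_mulInvariantVectorField_unique [T2Space G]
    {v : TangentSpace 𝓘(ℝ, E) (1 : G)} {γ γ' : ℝ → G}
    (h : IsMIntegralCurve (I := 𝓘(ℝ, E)) γ (mulInvariantVectorField v))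
    (h' : IsMIntegralCurve (I := 𝓘(ℝ, E)) γ' (mulInvariantVectorField v)) {t : ℝ}
    (ht : γ t = γ' t) : γ = γ' := by
  have := lieGroup_minSmoothness E G
  have hv : ContMDiff 𝓘(ℝ, E) 𝓘(ℝ, E).tangent 1
      (fun x => (⟨x, mulInvariantVectorField v x⟩ : TangentBundle 𝓘(ℝ, E) G)) :=
    (contMDiff_mulInvariantVectorField v).of_le (by simp)
  exact isMIntegralCurve_Ioo_eq_of_contMDiff_boundaryless hv h h' ht

lemma lieExp_smul_eq [T2Space G] {v : TangentSpace 𝓘(ℝ, E) (1 : G)} {γ : ℝ → G}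
    (h : IsMIntegralCurve (I := 𝓘(ℝ, E)) γ (mulInvariantVectorField v)) (h0 : γ 0 = 1) (s : ℝ) :
    lieExp E (s • v) = γ s := by
  have := lieGroup_minSmoothness E G
  have h1 : ∃ γ : ℝ → G, γ 0 = 1 ∧
    IsMIntegralCurve (I := 𝓘(ℝ, E)) γ (mulInvariantVectorField (s • v)) :=
    exists_isMIntegralCurve_mulInvariantVectorField _
  rw [lieExp, dif_pos h1]
  have h2 := h.comp_mul s
  have h3 : s • mulInvariantVectorField v = mulInvariantVectorField (s • v) :=
    (mulInvariantVectorField_smul s v).symm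
  rw [h3] at h2
  have := isMIntegralCurve_mulInvariantVectorField_unique h1.choose_spec.2 h2 (t := 0)
    (by simp [h0, h1.choose_spec.1])
  rw [this]; simp

lemma isMIntegralCurve_lieExp [T2Space G] (v : TangentSpace 𝓘(ℝ, E) (1 : G)) :
    IsMIntegralCurve (I := 𝓘(ℝ, E)) (fun s : ℝ => lieExp E (s • v)) (mulInvariantVectorField v) := by
  obtain ⟨γ, h0, h⟩ := exists_isMIntegralCurve_mulInvariantVectorField v
  have : (fun s : ℝ => lieExp E (s • v)) = γ := by
    ext s; exact lieExp_smul_eq h h0 s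
  rw [this]; exact h

lemma lieExp_zero [T2Space G] : lieExp E (0 : TangentSpace 𝓘(ℝ, E) (1 : G)) = (1 : G) := by
  obtain ⟨γ, h0, h⟩ := exists_isMIntegralCurve_mulInvariantVectorField
    (0 : TangentSpace 𝓘(ℝ, E) (1 : G))
  have := lieExp_smul_eq h h0 0
  rwa [smul_zero, h0] at this

/-- As functions of t, both sides are integral curves of the same left-invariant field that agree at
t = 0. -/
lemma lieExp_add_smul [T2Space G] (v : TangentSpace 𝓘(ℝ, E) (1 : G)) (s t : ℝ) :
    lieExp E ((s + t) • v) = (lieExp E (s • v) * lieExp E (t • v) : G) := by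
  have h := isMIntegralCurve_lieExp v
  have h1 := IsMIntegralCurve.comp_add h s
  have h2 : IsMIntegralCurve (I := 𝓘(ℝ, E)) (fun t : ℝ => lieExp E (s • v) * lieExp E (t • v))
    (mulInvariantVectorField v) := by
    rw [isMIntegralCurve_iff_isMIntegralCurveOn] at h ⊢
    exact isMIntegralCurveOn_mul_left h _
  have := isMIntegralCurve_mulInvariantVectorField_unique h1 h2 (t := 0)
    (by simp [lieExp_zero])
  have := congrFun this t
  simpa [add_comm] using this

lemma lieExp_neg [T2Space G] (v : TangentSpace 𝓘(ℝ, E) (1 : G)) :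
    lieExp E (-v) = (lieExp E v : G)⁻¹ := by
  have := lieExp_add_smul (G := G) v (-1) 1
  rw [neg_add_cancel, zero_smul, lieExp_zero, one_smul, neg_one_smul] at this
  exact eq_inv_of_mul_eq_one_left this.symm

/-- The chart at the identity. -/
noncomputable abbrev chart1 (E : Type*) [NormedAddCommGroup E] [NormedSpace ℝ E] (G : Type*) [Group G]
    [TopologicalSpace G] [ChartedSpace E G] : PartialEquiv G E := extChartAt 𝓘(ℝ, E) (1 : G)

lemma hasFDerivAt_of_hasMFDerivAt_one {E' P : Type*} [NormedAddCommGroup E'] [NormedSpace ℝ E']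
    [Group P] [TopologicalSpace P] [ChartedSpace E' P] {f : P → G} (hf : f 1 = 1) {L : E' →L[ℝ] E}
    (h : HasMFDerivAt 𝓘(ℝ, E') 𝓘(ℝ, E) f 1 L) :
    HasFDerivAt (chart1 E G ∘ f ∘ (chart1 E' P).symm) L (chart1 E' P 1) := by
  have h2 := h.2
  rw [writtenInExtChartAt, hf] at h2
  rw [ModelWithCorners.range_eq_univ] at h2
  exact hasFDerivWithinAt_univ.1 h2

lemma hasMFDerivAt_one_of_hasFDerivAt {E' P : Type*} [NormedAddCommGroup E'] [NormedSpace ℝ E']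
    [Group P] [TopologicalSpace P] [ChartedSpace E' P] {f : P → G} (hf : f 1 = 1) {L : E' →L[ℝ] E}
    (hc : ContinuousAt f 1)
    (h : HasFDerivAt (chart1 E G ∘ f ∘ (chart1 E' P).symm) L (chart1 E' P 1)) :
    HasMFDerivAt 𝓘(ℝ, E') 𝓘(ℝ, E) f 1 L := by
  refine ⟨hc, ?_⟩
  rw [writtenInExtChartAt, hf]
  rw [ModelWithCorners.range_eq_univ]
  exact hasFDerivWithinAt_univ.2 h

lemma hasDerivAt_chart1_of_hasMFDerivAt {γ : ℝ → G} (hf : γ 0 = 1) {v : E}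
    (h : HasMFDerivAt 𝓘(ℝ, ℝ) 𝓘(ℝ, E) γ 0 (ContinuousLinearMap.toSpanSingleton ℝ v)) :
    HasDerivAt (fun s => chart1 E G (γ s)) v 0 := by
  have h2 := h.2
  rw [writtenInExtChartAt, hf] at h2
  rw [ModelWithCorners.range_eq_univ] at h2
  exact hasFDerivWithinAt_univ.1 h2

lemma hasMFDerivAt_lieExp_smul [T2Space G] (v : TangentSpace 𝓘(ℝ, E) (1 : G)) :
    HasMFDerivAt 𝓘(ℝ, ℝ) 𝓘(ℝ, E) (fun s : ℝ => (lieExp E (s • v) : G)) 0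
      (ContinuousLinearMap.toSpanSingleton ℝ (show E from v)) := by
  have h := isMIntegralCurve_lieExp v 0
  have h3 : ∀ y : G, y = 1 → (mulInvariantVectorField v y : E) = v := by
    rintro y rfl
    have : (fun y : G => 1 * y) = id := by ext; simp
    rw [mulInvariantVectorField, this]
    exact congrArg (fun A : E →L[ℝ] E => A v) (mfderiv_id (I := 𝓘(ℝ, E)) (x := (1 : G)))
  have h4 : ∀ (a : ℝ) (b c : E), b = c → a • b = a • c := by rintro a b _ rfl; rfl
  refine h.congr_mfderiv (ContinuousLinearMap.ext fun c => ?_)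
  exact h4 c _ _ (h3 _ (by simp [lieExp_zero]))

lemma hasDerivAt_chart1_lieExp [T2Space G] (v : TangentSpace 𝓘(ℝ, E) (1 : G)) :
    HasDerivAt (fun s : ℝ => chart1 E G (lieExp E (s • v))) (show E from v) 0 :=
  hasDerivAt_chart1_of_hasMFDerivAt (by simp [lieExp_zero]) (hasMFDerivAt_lieExp_smul v)

/-- A one-parameter subgroup is given by the exponential map. -/
lemma eq_lieExp_of_hasMFDerivAt [T2Space G] {γ : ℝ → G} (hadd : ∀ s t, γ (s + t) = γ s * γ t)
    {v : TangentSpace 𝓘(ℝ, E) (1 : G)}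
    (hd : HasMFDerivAt 𝓘(ℝ, ℝ) 𝓘(ℝ, E) γ 0
      (ContinuousLinearMap.toSpanSingleton ℝ (show E from v))) (s : ℝ) :
    γ s = lieExp E (s • v) := by
  have h0 : γ 0 = 1 := by simpa using hadd 0 0
  refine (lieExp_smul_eq (fun t => ?_) h0 s).symm
  -- Left translation by `γ t` reduces the derivative at time t to the one at time 0.
  have h1 : γ = (fun x => γ t * x) ∘ γ ∘ (fun s => s - t) := by
    ext s; simp [← hadd]
  have hd' : HasMFDerivAt 𝓘(ℝ, ℝ) 𝓘(ℝ, E) γ (t - t)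
      (ContinuousLinearMap.toSpanSingleton ℝ (show E from v)) := by rw [sub_self]; exact hd
  have h2 : HasMFDerivAt 𝓘(ℝ, ℝ) 𝓘(ℝ, ℝ) (fun s => s - t) t (ContinuousLinearMap.id ℝ ℝ) :=
    ((hasFDerivAt_id t).sub_const t).hasMFDerivAt
  have h3 := (mdifferentiable_mul_left (E := E) (γ t) (γ (t - t))).hasMFDerivAt.comp t (HasMFDerivAt.comp (f := fun s => s - t) t hd' h2)
  rw [← h1] at h3
  refine h3.congr_mfderiv (ContinuousLinearMap.ext fun c => ?_)
  have h2 : ∀ (A : E →L[ℝ] E) (c : ℝ) (v w : E), A v = w → A (c • v) = c • w := by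
    rintro A c v _ rfl; exact map_smul A c v
  have h4 : ∀ y : G, y = 1 → (mfderiv 𝓘(ℝ, E) 𝓘(ℝ, E) (fun x : G => γ t * x) y : E →L[ℝ] E) v
      = mulInvariantVectorField v (γ t) := by rintro y rfl; rfl
  exact h2 _ c _ _ (h4 _ (by simp [h0]))

/-- A homomorphism carries the one-parameter subgroup of v to a one-parameter subgroup with initial
velocity L v. Only differentiability at the identity is needed. -/
lemma map_lieExp [T2Space G] {E' P : Type*} [NormedAddCommGroup E'] [NormedSpace ℝ E'] [CompleteSpace E']
    [Group P] [TopologicalSpace P] [ChartedSpace E' P] [LieGroup 𝓘(ℝ, E') ∞ P] [T2Space P] (f : P →* G)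
    {L : TangentSpace 𝓘(ℝ, E') (1 : P) →L[ℝ] TangentSpace 𝓘(ℝ, E) (1 : G)}
    (h : HasMFDerivAt 𝓘(ℝ, E') 𝓘(ℝ, E) f 1 (show E' →L[ℝ] E from L))
    (v : TangentSpace 𝓘(ℝ, E') (1 : P)) : f (lieExp E' v) = lieExp E (L v) := by
  have key := eq_lieExp_of_hasMFDerivAt (γ := fun s : ℝ => f (lieExp E' (s • v))) (v := L v)
    (fun s t => by rw [lieExp_add_smul, map_mul]) ?_ 1
  · simpa using key
  have h' : HasMFDerivAt 𝓘(ℝ, E') 𝓘(ℝ, E) f (lieExp E' ((0 : ℝ) • v)) (show E' →L[ℝ] E from L) := by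
    rw [zero_smul, lieExp_zero]; exact h
  have h3 := h'.comp (0 : ℝ) (hasMFDerivAt_lieExp_smul v)
  refine h3.congr_mfderiv (ContinuousLinearMap.ext fun c => ?_)
  have h2 : ∀ (A : E' →L[ℝ] E) (c : ℝ) (v : E') (w : E), A v = w → A (c • v) = c • w := by
    rintro A c v _ rfl; exact map_smul A c v
  exact h2 _ c _ _ rfl

end LieExp

/-! ### The group law in a chart at the identity. -/

section LieChart

variable {E : Type*} [NormedAddCommGroup E] [NormedSpace ℝ E] [FiniteDimensional ℝ E]
  {G : Type*} [Group G] [TopologicalSpace G] [ChartedSpace E G] [LieGroup 𝓘(ℝ, E) ∞ G]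
  [Bundle.RiemannianBundle (fun x : G => TangentSpace 𝓘(ℝ, E) x)]

variable (E G) in
/-- The Lie algebra of a Lie group with a Riemannian structure, as an inner product space. -/
def LieAlg : Type _ := TangentSpace 𝓘(ℝ, E) (1 : G)

noncomputable instance : NormedAddCommGroup (LieAlg E G) :=
  inferInstanceAs (NormedAddCommGroup (TangentSpace 𝓘(ℝ, E) (1 : G)))

noncomputable instance : InnerProductSpace ℝ (LieAlg E G) :=
  inferInstanceAs (InnerProductSpace ℝ (TangentSpace 𝓘(ℝ, E) (1 : G)))

instance : FiniteDimensional ℝ (LieAlg E G) := inferInstanceAs (FiniteDimensional ℝ E)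

/-- The exponential map, on the Lie algebra with its norm. -/
noncomputable def gexp (v : LieAlg E G) : G := lieExp E (show TangentSpace 𝓘(ℝ, E) (1 : G) from v)

variable (E G) in
/-- The identification of the model space with the Lie algebra. -/
noncomputable def toLie : E ≃L[ℝ] LieAlg E G := ContinuousLinearEquiv.refl ℝ E

variable (E G) in
/-- The chart at the identity, as a map to the Lie algebra centered at `0`. -/
noncomputable def lieChart (g : G) : LieAlg E G :=
  toLie E G (chart1 E G g - chart1 E G 1)

/-- The inverse of `lieChart`. -/
noncomputable def lieChartInv (v : LieAlg E G) : G :=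
  (chart1 E G).symm ((toLie E G).symm v + chart1 E G 1)

@[simp] lemma lieChart_one : lieChart E G 1 = 0 := by simp [lieChart]

@[simp] lemma lieChartInv_zero : lieChartInv (0 : LieAlg E G) = (1 : G) := by
  simp [lieChartInv]

lemma eventually_lieChartInv_lieChart : ∀ᶠ g in 𝓝 (1 : G), lieChartInv (lieChart E G g) = g := by
  filter_upwards [extChartAt_source_mem_nhds (I := 𝓘(ℝ, E)) (1 : G)] with g hg
  rw [lieChartInv, lieChart, ContinuousLinearEquiv.symm_apply_apply, sub_add_cancel]
  exact (chart1 E G).left_inv hg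

lemma tendsto_symm_add : Tendsto (fun v => (toLie E G).symm v + chart1 E G 1) (𝓝 0)
    (𝓝 (chart1 E G 1)) := by
  have : Continuous (fun v => (toLie E G).symm v + chart1 E G 1) := by fun_prop
  simpa using this.tendsto 0

lemma eventually_lieChart_lieChartInv :
    ∀ᶠ v in 𝓝 (0 : LieAlg E G), lieChart E G (lieChartInv v) = v := by
  filter_upwards [tendsto_symm_add.eventually (extChartAt_target_mem_nhds (I := 𝓘(ℝ, E)) (1 : G))]
    with v hv
  rw [lieChartInv, lieChart, (chart1 E G).right_inv hv]
  simp

lemma eventually_contMDiffAt_lieChart : ∀ᶠ g in 𝓝 (1 : G),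
    ContMDiffAt 𝓘(ℝ, E) 𝓘(ℝ, LieAlg E G) ∞ (lieChart E G) g := by
  filter_upwards [extChartAt_source_mem_nhds (I := 𝓘(ℝ, E)) (1 : G)] with g hg
  have h1 : ContMDiffAt 𝓘(ℝ, E) 𝓘(ℝ, E) ∞ (chart1 E G) g :=
    contMDiffAt_extChartAt' (by simpa using hg)
  have h2 : ContDiff ℝ ∞ (fun z => toLie E G (z - chart1 E G 1)) := by fun_prop
  exact h2.contMDiff.contMDiffAt.comp g h1

lemma contMDiffAt_lieChart_one :
    ContMDiffAt 𝓘(ℝ, E) 𝓘(ℝ, LieAlg E G) ∞ (lieChart E G) 1 :=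
  eventually_contMDiffAt_lieChart.self_of_nhds

lemma eventually_contMDiffAt_lieChartInv : ∀ᶠ v in 𝓝 (0 : LieAlg E G),
    ContMDiffAt 𝓘(ℝ, LieAlg E G) 𝓘(ℝ, E) ∞ (lieChartInv (G := G)) v := by
  filter_upwards [tendsto_symm_add.eventually (extChartAt_target_mem_nhds (I := 𝓘(ℝ, E)) (1 : G))]
    with v hv
  have h1 : ContMDiffAt 𝓘(ℝ, E) 𝓘(ℝ, E) ∞ (chart1 E G).symm ((toLie E G).symm v + chart1 E G 1) :=
    (contMDiffOn_extChartAt_symm (1 : G)).contMDiffAt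
      ((isOpen_extChartAt_target (1 : G)).mem_nhds hv)
  have h2 : ContDiff ℝ ∞ (fun v => (toLie E G).symm v + chart1 E G 1) := by fun_prop
  exact h1.comp v h2.contMDiff.contMDiffAt

lemma contMDiffAt_lieChartInv_zero :
    ContMDiffAt 𝓘(ℝ, LieAlg E G) 𝓘(ℝ, E) ∞ (lieChartInv (E := E) (G := G)) 0 :=
  eventually_contMDiffAt_lieChartInv.self_of_nhds

lemma hasDerivAt_lieChart_lieExp [T2Space G] (v : LieAlg E G) :
    HasDerivAt (fun s : ℝ => lieChart E G (gexp (s • v))) v 0 := by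
  have h1 := (hasDerivAt_chart1_lieExp v).sub_const (chart1 E G 1)
  exact (toLie E G).hasFDerivAt.comp_hasDerivAt (0 : ℝ) h1

variable (E G) in
/-- The multiplication read in the chart at the identity. -/
noncomputable def mulChart (q : LieAlg E G × LieAlg E G) :
    LieAlg E G := lieChart E G (lieChartInv q.1 * lieChartInv q.2)

lemma contDiffAt_mulChart : ContDiffAt ℝ ∞ (mulChart E G) 0 := by
  rw [← contMDiffAt_iff_contDiffAt]
  have h1 : ContMDiffAt 𝓘(ℝ, LieAlg E G × LieAlg E G) 𝓘(ℝ, E) ∞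
      (fun q : LieAlg E G × LieAlg E G => lieChartInv (G := G) q.1) 0 :=
    ContMDiffAt.comp (g := lieChartInv (G := G)) 0 contMDiffAt_lieChartInv_zero
      contDiff_fst.contMDiff.contMDiffAt
  have h2 : ContMDiffAt 𝓘(ℝ, LieAlg E G × LieAlg E G) 𝓘(ℝ, E) ∞
      (fun q : LieAlg E G × LieAlg E G => lieChartInv (G := G) q.2) 0 :=
    ContMDiffAt.comp (g := lieChartInv (G := G)) 0 contMDiffAt_lieChartInv_zero
      contDiff_snd.contMDiff.contMDiffAt
  exact ContMDiffAt.comp_of_eq (g := lieChart E G) contMDiffAt_lieChart_one (h1.mul h2) (by simp)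

/-- Both partial derivatives at the origin are the identity because 1 is a unit; smoothness upgrades
the derivative to a strict one. -/
lemma hasStrictFDerivAt_mulChart : HasStrictFDerivAt (mulChart E G)
    (ContinuousLinearMap.fst ℝ (LieAlg E G) (LieAlg E G) +
      ContinuousLinearMap.snd ℝ _ _) 0 := by
  have h := (contDiffAt_mulChart (E := E) (G := G)).hasStrictFDerivAt (by simp)
  have hl : (fderiv ℝ (mulChart E G) 0).comp (ContinuousLinearMap.inl ℝ _ _) =
      ContinuousLinearMap.id ℝ _ := by
    refine ((h.hasFDerivAt.comp (x := (0 : LieAlg E G)) (f := fun x => (x, 0))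
      (hasFDerivAt_prodMk_left _ _))).unique ((hasFDerivAt_id _).congr_of_eventuallyEq ?_)
    filter_upwards [eventually_lieChart_lieChartInv] with v hv
    simp [mulChart, hv]
  have hr : (fderiv ℝ (mulChart E G) 0).comp (ContinuousLinearMap.inr ℝ _ _) =
      ContinuousLinearMap.id ℝ _ := by
    refine ((h.hasFDerivAt.comp (x := (0 : LieAlg E G)) (f := fun x => (0, x))
      (hasFDerivAt_prodMk_right _ _))).unique ((hasFDerivAt_id _).congr_of_eventuallyEq ?_)
    filter_upwards [eventually_lieChart_lieChartInv] with v hv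
    simp [mulChart, hv]
  have key : fderiv ℝ (mulChart E G) 0 = ContinuousLinearMap.fst ℝ (LieAlg E G) (LieAlg E G) +
      ContinuousLinearMap.snd ℝ _ _ := by
    refine ContinuousLinearMap.ext fun q => ?_
    have h1 := congrArg (fun A : LieAlg E G →L[ℝ] LieAlg E G => A q.1) hl
    have h2 := congrArg (fun A : LieAlg E G →L[ℝ] LieAlg E G => A q.2) hr
    simp only [ContinuousLinearMap.comp_apply, ContinuousLinearMap.inl_apply,
      ContinuousLinearMap.inr_apply, ContinuousLinearMap.id_apply] at h1 h2
    have h3 : q = (q.1, 0) + (0, q.2) := by simp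
    rw [h3, map_add, h1, h2]
    simp
  rwa [key] at h

section GexpHom

variable [T2Space G]

@[simp] lemma gexp_zero : gexp (0 : LieAlg E G) = (1 : G) := lieExp_zero

lemma gexp_add_smul (v : LieAlg E G) (s t : ℝ) :
    gexp ((s + t) • v) = (gexp (s • v) * gexp (t • v) : G) :=
  lieExp_add_smul (show TangentSpace 𝓘(ℝ, E) (1 : G) from v) s t

lemma gexp_neg (v : LieAlg E G) : gexp (-v) = (gexp v : G)⁻¹ :=
  lieExp_neg (show TangentSpace 𝓘(ℝ, E) (1 : G) from v)

lemma continuous_gexp_smul (v : LieAlg E G) : Continuous (fun s : ℝ => (gexp (s • v) : G)) :=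
  (isMIntegralCurve_lieExp (show TangentSpace 𝓘(ℝ, E) (1 : G) from v)).continuous

end GexpHom

end LieChart

/-! ### Lipschitz bounds from bounds on derivatives. -/

section RiemannianMap

variable {E : Type*} [NormedAddCommGroup E] [NormedSpace ℝ E]
  {M : Type*} [PseudoEMetricSpace M] [ChartedSpace E M]
  [Bundle.RiemannianBundle (fun x : M => TangentSpace 𝓘(ℝ, E) x)]
  [IsRiemannianManifold 𝓘(ℝ, E) M]
  {F : Type*} [NormedAddCommGroup F] [NormedSpace ℝ F]
  {N : Type*} [PseudoEMetricSpace N] [ChartedSpace F N]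
  [Bundle.RiemannianBundle (fun x : N => TangentSpace 𝓘(ℝ, F) x)]
  [IsRiemannianManifold 𝓘(ℝ, F) N]

open Manifold in
/-- A `C¹` map whose derivative does not increase norms is `1`-Lipschitz. -/
lemma edist_map_le_of_norm_mfderiv_le {f : M → N} (hf : ContMDiff 𝓘(ℝ, E) 𝓘(ℝ, F) 1 f)
    (h : ∀ (x : M) (v : TangentSpace 𝓘(ℝ, E) x), ‖mfderiv 𝓘(ℝ, E) 𝓘(ℝ, F) f x v‖ ≤ ‖v‖) (x y : M) :
    edist (f x) (f y) ≤ edist x y := by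
  refine le_of_forall_gt fun r hr => ?_
  rw [IsRiemannianManifold.out (I := 𝓘(ℝ, E)) x y] at hr
  obtain ⟨γ, h0, h1, hγ, hl⟩ := exists_lt_of_riemannianEDist_lt hr
  rw [IsRiemannianManifold.out (I := 𝓘(ℝ, F))]
  refine (riemannianEDist_le_pathELength (γ := f ∘ γ) (a := 0) (b := 1) (hf.comp_contMDiffOn hγ)
    (by simp [h0]) (by simp [h1]) zero_le_one).trans_lt (lt_of_le_of_lt ?_ hl)
  rw [pathELength_eq_lintegral_mfderivWithin_Icc, pathELength_eq_lintegral_mfderivWithin_Icc]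
  refine setLIntegral_mono' measurableSet_Icc fun t ht => ?_
  have h3 := mfderivWithin_comp (I := 𝓘(ℝ, ℝ)) (I' := 𝓘(ℝ, E)) (I'' := 𝓘(ℝ, F)) (s := Icc (0:ℝ) 1)
    (u := univ) t (f := γ) (g := f)
    ((hf.mdifferentiable one_ne_zero _).mdifferentiableWithinAt)
    (hγ.mdifferentiableOn one_ne_zero t ht) (subset_univ _)
    (uniqueMDiffWithinAt_iff_uniqueDiffWithinAt.2 (uniqueDiffOn_Icc zero_lt_one t ht))
  rw [h3, mfderivWithin_univ]
  rw [← ofReal_norm, ← ofReal_norm]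
  exact ENNReal.ofReal_le_ofReal (h _ _)

end RiemannianMap

/-! ### The right-invariant distance and the speed of exponential curves. -/

section LieMetric

variable {E : Type*} [NormedAddCommGroup E] [NormedSpace ℝ E] [FiniteDimensional ℝ E]
  {G : Type*} [Group G] [MetricSpace G] [ChartedSpace E G] [LieGroup 𝓘(ℝ, E) ∞ G]
  [Bundle.RiemannianBundle (fun x : G => TangentSpace 𝓘(ℝ, E) x)]
  [IsRiemannianManifold 𝓘(ℝ, E) G]

/-- Right translations do not lengthen paths, and their inverses are right translations too. -/
lemma dist_mul_right_of_isRightInvariant (hG : IsRightInvariant E G) (x y h : G) :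
    dist (x * h) (y * h) = dist x y := by
  have key : ∀ x y h : G, edist (x * h) (y * h) ≤ edist x y := fun x y h =>
    edist_map_le_of_norm_mfderiv_le (f := fun x : G => x * h) (E := E) (F := E)
      (contMDiff_mul_right.of_le (n := ∞) (by exact_mod_cast le_top)) (fun x v => (hG x h v).le) x y
  have h1 : edist (x * h) (y * h) = edist x y := by
    refine le_antisymm (key x y h) ?_
    simpa using key (x * h) (y * h) h⁻¹
  rw [dist_edist, dist_edist, h1]

/-- The derivative of the exponential curves in the chart. -/
lemma eventually_hasDerivAt_lieChart_gexp : ∀ᶠ g in 𝓝 (1 : G), ∀ (v : LieAlg E G) (t : ℝ),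
    gexp (t • v) = g → HasDerivAt (fun s : ℝ => lieChart E G (gexp (s • v)))
      (fderiv ℝ (mulChart E G) (lieChart E G g, 0) (0, v)) t := by
  have h1 : ∀ᶠ q in 𝓝 (0 : LieAlg E G × LieAlg E G), DifferentiableAt ℝ (mulChart E G) q := by
    have := ((contDiffAt_mulChart (E := E) (G := G)).of_le (m := 2)
      (WithTop.coe_le_coe.2 le_top : ((2 : ℕ∞) : ℕ∞ω) ≤ ∞)).eventually (by simp)
    filter_upwards [this] with q hq using hq.differentiableAt (by simp)
  have h2 : Tendsto (fun g : G => (lieChart E G g, (0 : LieAlg E G))) (𝓝 1) (𝓝 0) := by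
    have : ContinuousAt (lieChart E G) 1 := contMDiffAt_lieChart_one.continuousAt
    have := this.tendsto
    rw [lieChart_one] at this
    exact this.prodMk_nhds tendsto_const_nhds
  filter_upwards [h2.eventually h1, eventually_lieChartInv_lieChart (E := E) (G := G)] with g hg hg2 v t ht
  have h3 : HasDerivAt (fun s : ℝ => (lieChart E G g, lieChart E G (gexp (s • v)))) (0, v) 0 :=
    (hasDerivAt_const _ _).prodMk (hasDerivAt_lieChart_lieExp v)
  have h4 : HasDerivAt (fun s : ℝ => mulChart E G (lieChart E G g, lieChart E G (gexp (s • v))))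
      (fderiv ℝ (mulChart E G) (lieChart E G g, 0) (0, v)) 0 := by
    refine HasFDerivAt.comp_hasDerivAt_of_eq (0 : ℝ) (y := (lieChart E G g, 0)) hg.hasFDerivAt h3 (by simp)
  -- Near time t the curve is g · exp((s − t)v), so it satisfies an ODE whose right-hand side is a
  -- partial derivative of the group law in the chart.
  have h5 : HasDerivAt (fun s : ℝ => mulChart E G (lieChart E G g, lieChart E G (gexp ((s - t) • v))))
      (fderiv ℝ (mulChart E G) (lieChart E G g, 0) (0, v)) t := by
    have h4' : HasDerivAt (fun s : ℝ => mulChart E G (lieChart E G g, lieChart E G (gexp (s • v))))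
      (fderiv ℝ (mulChart E G) (lieChart E G g, 0) (0, v)) (t - t) := by rwa [sub_self]
    exact h4'.comp_sub_const t t
  refine h5.congr_of_eventuallyEq ?_
  have h6 : Tendsto (fun s : ℝ => (gexp ((s - t) • v) : G)) (𝓝 t) (𝓝 1) := by
    have h := (continuous_gexp_smul (G := G) v).comp (continuous_sub_right t)
    have h' := h.tendsto t
    simpa [Function.comp_def] using h'
  filter_upwards [h6.eventually (eventually_lieChartInv_lieChart (E := E) (G := G))] with s hs
  rw [mulChart, hg2, hs, ← ht, ← gexp_add_smul]
  simp

/-- Bootstrapping: by the ODE the derivative is a smooth function of the curve itself, so each order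
of regularity gives the next. -/
lemma contDiffAt_lieChart_gexp_smul (v : LieAlg E G) (k : ℕ) :
    ContDiffAt ℝ k (fun s : ℝ => lieChart E G (gexp (s • v))) 0 := by
  have h0 : Tendsto (fun s : ℝ => (gexp (s • v) : G)) (𝓝 0) (𝓝 1) := by
    simpa using (continuous_gexp_smul (G := G) v).tendsto 0
  have hd : ∀ᶠ t in 𝓝 (0 : ℝ), HasDerivAt (fun s : ℝ => lieChart E G (gexp (s • v)))
      (fderiv ℝ (mulChart E G) (lieChart E G (gexp (t • v)), 0) (0, v)) t := by
    filter_upwards [h0.eventually (eventually_hasDerivAt_lieChart_gexp (E := E) (G := G))] with t ht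
    exact ht v t rfl
  induction k with
  | zero =>
    exact contDiffAt_zero.2 ⟨_, hd, fun t ht => (HasDerivAt.continuousAt ht).continuousWithinAt⟩
  | succ k ih =>
    rw [Nat.cast_succ, contDiffAt_succ_iff_hasFDerivAt]
    refine ⟨fun t => ContinuousLinearMap.toSpanSingleton ℝ
      (fderiv ℝ (mulChart E G) (lieChart E G (gexp (t • v)), 0) (0, v)),
      ⟨_, hd, fun t ht => HasDerivAt.hasFDerivAt ht⟩, ?_⟩
    have h1 : ContDiffAt ℝ k (fderiv ℝ (mulChart E G))
        (lieChart E G (gexp ((0 : ℝ) • v)), (0 : LieAlg E G)) := by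
      have : (lieChart E G (gexp ((0 : ℝ) • v)), (0 : LieAlg E G)) = 0 := by simp
      rw [this]
      refine (contDiffAt_mulChart (E := E) (G := G)).fderiv_right (m := k) ?_
      exact (WithTop.coe_le_coe.2 le_top : ((k + 1 : ℕ∞) : ℕ∞ω) ≤ ∞)
    have h2 : ContDiffAt ℝ k (fun t : ℝ => (lieChart E G (gexp (t • v)), (0 : LieAlg E G))) 0 :=
      ih.prodMk contDiffAt_const
    have h3 := ContDiffAt.comp (0 : ℝ) h1 h2
    have h4 := h3.clm_apply (contDiffAt_const (c := ((0 : LieAlg E G), v)))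
    exact (ContinuousLinearMap.toSpanSingletonCLE (𝕜 := ℝ) (E := LieAlg E G)).contDiff.contDiffAt.comp (0 : ℝ) h4

lemma contMDiff_gexp_smul (v : LieAlg E G) :
    ContMDiff 𝓘(ℝ, ℝ) 𝓘(ℝ, E) ∞ (fun s : ℝ => (gexp (s • v) : G)) := by
  have h0 : Tendsto (fun s : ℝ => (gexp (s • v) : G)) (𝓝 0) (𝓝 1) := by
    simpa using (continuous_gexp_smul (G := G) v).tendsto 0
  have h3 : ContDiffAt ℝ ∞ (fun s : ℝ => lieChart E G (gexp (s • v))) 0 :=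
    contDiffAt_infty.2 (contDiffAt_lieChart_gexp_smul v)
  have h4 : ContMDiffAt 𝓘(ℝ, ℝ) 𝓘(ℝ, E) ∞ (fun s : ℝ => (gexp (s • v) : G)) 0 := by
    have h5 : ContMDiffAt 𝓘(ℝ, ℝ) 𝓘(ℝ, E) ∞
        (fun s : ℝ => (lieChartInv (lieChart E G (gexp (s • v))) : G)) 0 :=
      ContMDiffAt.comp_of_eq (g := lieChartInv (E := E) (G := G))
        contMDiffAt_lieChartInv_zero h3.contMDiffAt (by simp)
    refine h5.congr_of_eventuallyEq ?_
    filter_upwards [h0.eventually (eventually_lieChartInv_lieChart (E := E) (G := G))] with s hs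
    exact hs.symm
  intro t
  have h5 : (fun s : ℝ => (gexp (s • v) : G)) = (fun g => gexp (t • v) * g) ∘
      (fun s : ℝ => (gexp (s • v) : G)) ∘ (fun s => s - t) := by
    ext s
    simp [← gexp_add_smul]
  rw [h5]
  have h6 : ContMDiffAt 𝓘(ℝ, ℝ) 𝓘(ℝ, ℝ) ∞ (fun s : ℝ => s - t) t :=
    (contDiff_id.sub contDiff_const).contMDiff.contMDiffAt
  have h7 : ContMDiff 𝓘(ℝ, E) 𝓘(ℝ, E) ∞ (fun g : G => gexp (t • v) * g) :=
    contMDiff_mul_left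
  exact h7.contMDiffAt.comp t (h4.comp_of_eq h6 (by simp))

lemma norm_eq_of_eq_mfderiv_mul_right (hG : IsRightInvariant E G) {k y z : G} (hy : y = 1)
    (hz : y * k = z) {u : TangentSpace 𝓘(ℝ, E) z} {v : LieAlg E G}
    (h : (show E from u) = (mfderiv 𝓘(ℝ, E) 𝓘(ℝ, E) (fun g : G => g * k) y : E →L[ℝ] E) (show E from v)) :
    ‖u‖ = ‖v‖ := by
  subst hy hz
  have h' : u = mfderiv 𝓘(ℝ, E) 𝓘(ℝ, E) (fun g : G => g * k) 1 v := h
  rw [h']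
  exact hG 1 k v

/-- Writing exp(sv) = exp((s − t)v) exp(tv), the velocity at t is the right translate of the
velocity at 0, so the curve has constant speed. -/
lemma norm_mfderiv_gexp_smul (hG : IsRightInvariant E G) (v : LieAlg E G) (t : ℝ) :
    ‖mfderiv 𝓘(ℝ, ℝ) 𝓘(ℝ, E) (fun s : ℝ => (gexp (s • v) : G)) t (1 : ℝ)‖ = ‖v‖ := by
  have h5 : (fun s : ℝ => (gexp (s • v) : G)) = (fun g => g * gexp (t • v)) ∘
      (fun s : ℝ => (gexp (s • v) : G)) ∘ (fun s => s - t) := by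
    ext s
    simp [← gexp_add_smul]
  have h0 := hasMFDerivAt_lieExp_smul (G := G) (show TangentSpace 𝓘(ℝ, E) (1 : G) from v)
  have hd' : HasMFDerivAt 𝓘(ℝ, ℝ) 𝓘(ℝ, E) (fun s : ℝ => (gexp (s • v) : G)) (t - t)
      (ContinuousLinearMap.toSpanSingleton ℝ (show E from v)) := by rw [sub_self]; exact h0
  have h2 : HasMFDerivAt 𝓘(ℝ, ℝ) 𝓘(ℝ, ℝ) (fun s => s - t) t (ContinuousLinearMap.id ℝ ℝ) :=
    ((hasFDerivAt_id t).sub_const t).hasMFDerivAt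
  have h3 := (mdifferentiable_mul_right (E := E) (gexp (t • v) : G) (gexp ((t - t) • v))).hasMFDerivAt.comp t
    (HasMFDerivAt.comp (f := fun s => s - t) t hd' h2)
  rw [← h5] at h3
  have h4 := h3.mfderiv
  have h5 := (congrArg (fun L : ℝ →L[ℝ] E => L 1) h4).trans (congrArg
    (mfderiv 𝓘(ℝ, E) 𝓘(ℝ, E) (fun g : G => g * gexp (t • v)) (gexp ((t - t) • v)) : E →L[ℝ] E)
    (one_smul ℝ (show E from v)))
  exact norm_eq_of_eq_mfderiv_mul_right hG (by simp) (by simp) h5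

open Manifold in
lemma dist_gexp_one_le (hG : IsRightInvariant E G) (v : LieAlg E G) : dist (gexp v : G) 1 ≤ ‖v‖ := by
  have h1 : edist (1 : G) (gexp v) ≤ ENNReal.ofReal ‖v‖ := by
    rw [IsRiemannianManifold.out (I := 𝓘(ℝ, E))]
    refine (riemannianEDist_le_pathELength (γ := fun s : ℝ => (gexp (s • v) : G)) (a := 0) (b := 1)
      ((contMDiff_gexp_smul v).of_le (by exact_mod_cast le_top)).contMDiffOn (by simp) (by simp) zero_le_one).trans ?_
    rw [pathELength_eq_lintegral_mfderiv_Icc]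
    have : ∀ t : ℝ, ‖mfderiv 𝓘(ℝ, ℝ) 𝓘(ℝ, E) (fun s : ℝ => (gexp (s • v) : G)) t (1 : ℝ)‖ₑ =
        ENNReal.ofReal ‖v‖ := fun t => by rw [← ofReal_norm, norm_mfderiv_gexp_smul hG]
    calc _ = ∫⁻ t in Icc (0 : ℝ) 1, ENNReal.ofReal ‖v‖ := lintegral_congr fun t => this t
      _ ≤ _ := by simp
  rw [edist_comm, edist_dist] at h1
  exact (ENNReal.ofReal_le_ofReal_iff (norm_nonneg _)).1 h1

end LieMetric

section RiemannianMapLocal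

variable {E : Type*} [NormedAddCommGroup E] [NormedSpace ℝ E]
  {M : Type*} [PseudoEMetricSpace M] [ChartedSpace E M]
  [Bundle.RiemannianBundle (fun x : M => TangentSpace 𝓘(ℝ, E) x)]
  [IsRiemannianManifold 𝓘(ℝ, E) M]
  {F : Type*} [NormedAddCommGroup F] [NormedSpace ℝ F]
  {N : Type*} [PseudoEMetricSpace N] [ChartedSpace F N]
  [Bundle.RiemannianBundle (fun x : N => TangentSpace 𝓘(ℝ, F) x)]
  [IsRiemannianManifold 𝓘(ℝ, F) N]

-- A path from x of length less than ρ stays in the ball of radius ρ about x, so control of f on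
-- that ball suffices. The centre is an endpoint of the path, which is why no part of the radius is
-- lost.
open Manifold in
lemma edist_map_le_of_enorm_mfderiv_le_of_edist_lt {f : M → N} {x : M} {ρ : ENNReal} {C : NNReal}
    (hf : ∀ z, edist x z < ρ → ContMDiffAt 𝓘(ℝ, E) 𝓘(ℝ, F) 1 f z)
    (h : ∀ z, edist x z < ρ → ∀ (v : TangentSpace 𝓘(ℝ, E) z),
      ‖mfderiv 𝓘(ℝ, E) 𝓘(ℝ, F) f z v‖ₑ ≤ C * ‖v‖ₑ) {y : M} (hy : edist x y < ρ) :
    edist (f x) (f y) ≤ C * edist x y := by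
  have key : ∀ r, edist x y < r → r ≤ ρ → edist (f x) (f y) ≤ C * r := by
    intro r hr hrρ
    rw [IsRiemannianManifold.out (I := 𝓘(ℝ, E)) x y] at hr
    obtain ⟨γ, h0, h1, hγ, hl⟩ := exists_lt_of_riemannianEDist_lt hr
    have hm : ∀ t ∈ Icc (0 : ℝ) 1, edist x (γ t) < ρ := by
      intro t ht
      rw [IsRiemannianManifold.out (I := 𝓘(ℝ, E))]
      refine (riemannianEDist_le_pathELength (γ := γ) (a := 0) (b := t)
        (hγ.mono (Icc_subset_Icc_right ht.2)) h0 rfl ht.1).trans_lt (lt_of_le_of_lt ?_ (hl.trans_le hrρ))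
      exact pathELength_mono le_rfl ht.2
    rw [IsRiemannianManifold.out (I := 𝓘(ℝ, F))]
    refine (riemannianEDist_le_pathELength (γ := f ∘ γ) (a := 0) (b := 1)
      (fun t ht => (hf _ (hm t ht)).comp_contMDiffWithinAt t (hγ t ht))
      (by simp [h0]) (by simp [h1]) zero_le_one).trans (le_trans ?_ (mul_le_mul_right hl.le _))
    rw [pathELength_eq_lintegral_mfderivWithin_Icc, pathELength_eq_lintegral_mfderivWithin_Icc,
      ← lintegral_const_mul' _ _ ENNReal.coe_ne_top]
    refine setLIntegral_mono' measurableSet_Icc fun t ht => ?_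
    have h3 := mfderivWithin_comp (I := 𝓘(ℝ, ℝ)) (I' := 𝓘(ℝ, E)) (I'' := 𝓘(ℝ, F)) (s := Icc (0:ℝ) 1)
      (u := univ) t (f := γ) (g := f)
      (((hf _ (hm t ht)).mdifferentiableAt one_ne_zero).mdifferentiableWithinAt)
      (hγ.mdifferentiableOn one_ne_zero t ht) (subset_univ _)
      (uniqueMDiffWithinAt_iff_uniqueDiffWithinAt.2 (uniqueDiffOn_Icc zero_lt_one t ht))
    rw [h3, mfderivWithin_univ]
    exact h _ (hm t ht) _
  refine ENNReal.le_of_forall_pos_le_add fun ε hε hlt => ?_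
  by_cases hC : C = 0
  · have := key ρ hy le_rfl
    simp only [hC, ENNReal.coe_zero, zero_mul] at this ⊢
    exact this.trans zero_le
  have hfin : edist x y ≠ ⊤ := (hy.trans_le le_top).ne
  have h1 := key (min ρ (edist x y + ε / C)) (lt_min hy (ENNReal.lt_add_right hfin
    (by simp [hε.ne']))) (min_le_left _ _)
  refine h1.trans ((mul_le_mul_right (min_le_right _ _) _).trans ?_)
  rw [mul_add, ENNReal.mul_div_cancel (by simpa using hC) ENNReal.coe_ne_top]

end RiemannianMapLocal

/-! ### Strict differentiability and the local bi-Lipschitz property of exp. -/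

section LieMetric

variable {E : Type*} [NormedAddCommGroup E] [NormedSpace ℝ E] [FiniteDimensional ℝ E]
  {G : Type*} [Group G] [MetricSpace G] [ChartedSpace E G] [LieGroup 𝓘(ℝ, E) ∞ G]
  [Bundle.RiemannianBundle (fun x : G => TangentSpace 𝓘(ℝ, E) x)]
  [IsRiemannianManifold 𝓘(ℝ, E) G]

/-- Right translations trivialize the tangent bundle isometrically; derivatives at k can then be
tested on curves exp(sξ)k. -/
lemma exists_eq_mfderiv_mul_right (hG : IsRightInvariant E G) (k : G) (w : TangentSpace 𝓘(ℝ, E) k) :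
    ∃ ξ : LieAlg E G, ‖ξ‖ = ‖w‖ ∧ (show E from w) =
      (mfderiv 𝓘(ℝ, E) 𝓘(ℝ, E) (fun g : G => g * k) 1 : E →L[ℝ] E) (show E from ξ) := by
  have h1 := (mdifferentiable_mul_right (E := E) (k⁻¹) k).hasMFDerivAt
  have h2 : HasMFDerivAt 𝓘(ℝ, E) 𝓘(ℝ, E) (fun g : G => g * k) (k * k⁻¹)
      (mfderiv 𝓘(ℝ, E) 𝓘(ℝ, E) (fun g : G => g * k) 1 : E →L[ℝ] E) := by
    rw [mul_inv_cancel]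
    exact (mdifferentiable_mul_right (E := E) k 1).hasMFDerivAt
  have h3 := h2.comp k h1
  have h4 : (fun g : G => g * k) ∘ (fun g : G => g * k⁻¹) = id := by ext; simp
  rw [h4] at h3
  have h5 := hasMFDerivAt_unique h3 (hasMFDerivAt_id k)
  have h6 := congrArg (fun L : E →L[ℝ] E => L w) h5
  refine ⟨(show E from mfderiv 𝓘(ℝ, E) 𝓘(ℝ, E) (fun g : G => g * k⁻¹) k w), ?_, h6.symm⟩
  have key : ∀ z : G, k * k⁻¹ = z → ∀ ξ : TangentSpace 𝓘(ℝ, E) z,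
      (show E from ξ) = mfderiv 𝓘(ℝ, E) 𝓘(ℝ, E) (fun g : G => g * k⁻¹) k w → ‖ξ‖ = ‖w‖ := by
    rintro z rfl ξ hξ
    have h' : ξ = mfderiv 𝓘(ℝ, E) 𝓘(ℝ, E) (fun g : G => g * k⁻¹) k w := hξ
    rw [h']; exact hG _ _ _
  exact key 1 (mul_inv_cancel k) _ rfl

lemma tendsto_lieChart_one : Tendsto (lieChart E G) (𝓝 1) (𝓝 0) := by
  have : ContinuousAt (lieChart E G) 1 := contMDiffAt_lieChart_one.continuousAt
  simpa using this.tendsto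

lemma eventually_contDiffAt_mulChart (n : ℕ) :
    ∀ᶠ q in 𝓝 (0 : LieAlg E G × LieAlg E G), ContDiffAt ℝ n (mulChart E G) q :=
  ((contDiffAt_mulChart (E := E) (G := G)).of_le (m := n)
    (WithTop.coe_le_coe.2 le_top : ((n : ℕ∞) : ℕ∞ω) ≤ ∞)).eventually (by simp)

lemma fderiv_mulChart_zero : fderiv ℝ (mulChart E G) 0 =
    ContinuousLinearMap.fst ℝ (LieAlg E G) (LieAlg E G) + ContinuousLinearMap.snd ℝ _ _ :=
  (hasStrictFDerivAt_mulChart (E := E) (G := G)).hasFDerivAt.fderiv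

lemma mfderiv_lieChart_apply_mul_right {k : G}
    (hk : DifferentiableAt ℝ (mulChart E G) (0, lieChart E G k))
    (hk' : lieChartInv (lieChart E G k) = k)
    (hd : MDifferentiableAt 𝓘(ℝ, E) 𝓘(ℝ, LieAlg E G) (lieChart E G) k) (ξ : LieAlg E G) :
    (mfderiv 𝓘(ℝ, E) 𝓘(ℝ, LieAlg E G) (lieChart E G) k : E →L[ℝ] LieAlg E G)
      ((mfderiv 𝓘(ℝ, E) 𝓘(ℝ, E) (fun g : G => g * k) 1 : E →L[ℝ] E) (show E from ξ)) =
    fderiv ℝ (mulChart E G) (0, lieChart E G k) (ξ, 0) := by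
  have h1 : HasDerivAt (fun s : ℝ => lieChart E G (gexp (s • ξ) * k))
      (fderiv ℝ (mulChart E G) (0, lieChart E G k) (ξ, 0)) 0 := by
    have h3 : HasDerivAt (fun s : ℝ => (lieChart E G (gexp (s • ξ)), lieChart E G k)) (ξ, 0) 0 :=
      (hasDerivAt_lieChart_lieExp ξ).prodMk (hasDerivAt_const _ _)
    refine (HasFDerivAt.comp_hasDerivAt_of_eq (0 : ℝ) hk.hasFDerivAt h3 (by simp)).congr_of_eventuallyEq ?_
    have h0 : Tendsto (fun s : ℝ => (gexp (s • ξ) : G)) (𝓝 0) (𝓝 1) := by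
      simpa using (continuous_gexp_smul (G := G) ξ).tendsto 0
    filter_upwards [h0.eventually (eventually_lieChartInv_lieChart (E := E) (G := G))] with s hs
    simp [mulChart, hk', hs]
  have h0 := hasMFDerivAt_lieExp_smul (G := G) (show TangentSpace 𝓘(ℝ, E) (1 : G) from ξ)
  have h2 : HasMFDerivAt 𝓘(ℝ, E) 𝓘(ℝ, E) (fun g : G => g * k) (gexp ((0 : ℝ) • ξ))
      (mfderiv 𝓘(ℝ, E) 𝓘(ℝ, E) (fun g : G => g * k) 1 : E →L[ℝ] E) := by
    rw [zero_smul, gexp_zero]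
    exact (mdifferentiable_mul_right (E := E) k 1).hasMFDerivAt
  have h3 := HasMFDerivAt.comp (0 : ℝ) (f := fun s : ℝ => gexp (s • ξ)) h2 h0
  have h4 : HasMFDerivAt 𝓘(ℝ, E) 𝓘(ℝ, LieAlg E G) (lieChart E G) (((fun g : G => g * k) ∘ fun s : ℝ => gexp (s • ξ)) 0)
      (mfderiv 𝓘(ℝ, E) 𝓘(ℝ, LieAlg E G) (lieChart E G) k : E →L[ℝ] LieAlg E G) := by
    have : ((fun g : G => g * k) ∘ fun s : ℝ => gexp (s • ξ)) 0 = k := by simp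
    rw [this]
    exact hd.hasMFDerivAt
  have h5 := h4.comp (0 : ℝ) h3
  have h6 := hasMFDerivAt_unique h5 h1.hasFDerivAt.hasMFDerivAt
  have h7 := congrArg (fun L : ℝ →L[ℝ] LieAlg E G => L 1) h6
  have h8 : ∀ (A : E →L[ℝ] LieAlg E G) (B : E →L[ℝ] E) (v : E) (w : LieAlg E G),
      (A.comp (B.comp (ContinuousLinearMap.toSpanSingleton ℝ v))) 1 =
        (ContinuousLinearMap.toSpanSingleton ℝ w) 1 → A (B v) = w := by
    intro A B v w h; simpa using h
  exact h8 _ _ _ _ h7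

/-- In the right trivialization, the derivative of the chart at k is the partial derivative of the
group law in its first variable at (0, chart of k). By continuity its norm is close to that of the
identity, so the chart is (1 + η)-Lipschitz from 1. -/
lemma eventually_norm_lieChart_le (hG : IsRightInvariant E G) {η : ℝ} (hη : 0 < η) :
    ∀ᶠ g in 𝓝 (1 : G), ‖lieChart E G g‖ ≤ (1 + η) * dist g 1 := by
  have hB : ContinuousAt (fun x : LieAlg E G =>
      (fderiv ℝ (mulChart E G) (0, x)).comp (ContinuousLinearMap.inl ℝ _ _)) 0 := by
    have h1 : ContinuousAt (fderiv ℝ (mulChart E G)) (0, 0) :=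
      ((contDiffAt_mulChart (E := E) (G := G)).continuousAt_fderiv (by simp))
    have h2 : ContinuousAt (fun x : LieAlg E G => fderiv ℝ (mulChart E G) (0, x)) 0 :=
      ContinuousAt.comp (g := fderiv ℝ (mulChart E G)) (f := fun x : LieAlg E G => (0, x)) h1
        (by fun_prop)
    exact h2.clm_comp continuousAt_const
  have hB0 : ∀ᶠ x in 𝓝 (0 : LieAlg E G), ‖(fderiv ℝ (mulChart E G) (0, x)).comp
      (ContinuousLinearMap.inl ℝ (LieAlg E G) (LieAlg E G))‖ < 1 + η := by
    refine hB.norm.eventually_lt_const ?_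
    have : fderiv ℝ (mulChart E G) (0, 0) = _ := fderiv_mulChart_zero (E := E) (G := G)
    beta_reduce
    rw [this]
    have : (ContinuousLinearMap.fst ℝ (LieAlg E G) (LieAlg E G) + ContinuousLinearMap.snd ℝ _ _).comp
        (ContinuousLinearMap.inl ℝ (LieAlg E G) (LieAlg E G)) = ContinuousLinearMap.id ℝ _ := by
      ext; simp
    rw [this]
    exact ContinuousLinearMap.norm_id_le.trans_lt (by linarith)
  have hD : ∀ᶠ x in 𝓝 (0 : LieAlg E G), DifferentiableAt ℝ (mulChart E G) (0, x) := by
    have h2 : Tendsto (fun x : LieAlg E G => ((0 : LieAlg E G), x)) (𝓝 0) (𝓝 0) :=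
      tendsto_const_nhds.prodMk_nhds tendsto_id
    filter_upwards [h2.eventually (eventually_contDiffAt_mulChart (E := E) (G := G) 1)] with x hx
    exact hx.differentiableAt (by simp)
  have hall := (tendsto_lieChart_one (E := E) (G := G)).eventually (hB0.and hD)
  obtain ⟨ρ, hρ, hball⟩ := Metric.eventually_nhds_iff.1 (hall.and
    ((eventually_lieChartInv_lieChart (E := E) (G := G)).and (eventually_contMDiffAt_lieChart (E := E) (G := G))))
  filter_upwards [Metric.ball_mem_nhds (1 : G) hρ] with g hg
  have hconv : ∀ z : G, edist 1 z < ENNReal.ofReal ρ → dist z 1 < ρ := by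
    intro z hz
    rw [edist_comm, edist_dist] at hz
    exact (ENNReal.ofReal_lt_ofReal_iff hρ).1 hz
  have key := edist_map_le_of_enorm_mfderiv_le_of_edist_lt (E := E) (F := LieAlg E G)
    (f := lieChart E G) (x := 1) (ρ := ENNReal.ofReal ρ)
    (C := (1 + η).toNNReal) (y := g)
    (fun z hz => ((hball (hconv z hz)).2.2).of_le (by exact_mod_cast le_top)) ?_ ?_
  · rw [lieChart_one, edist_dist, edist_comm, edist_dist, dist_zero_left] at key
    have h1 : (((1 + η).toNNReal : NNReal) : ENNReal) = ENNReal.ofReal (1 + η) := rfl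
    rw [h1, ← ENNReal.ofReal_mul (by positivity)] at key
    exact (ENNReal.ofReal_le_ofReal_iff (by positivity)).1 key
  · intro z hz v
    obtain ⟨⟨h1, h2⟩, h3, h4⟩ := hball (hconv z hz)
    obtain ⟨ξ, hξ, hv⟩ := exists_eq_mfderiv_mul_right hG z v
    have h5 := mfderiv_lieChart_apply_mul_right h2 h3 (h4.mdifferentiableAt (by simp)) ξ
    rw [← hv] at h5
    have h6 : ‖fderiv ℝ (mulChart E G) (0, lieChart E G z) (ξ, 0)‖ ≤ (1 + η) * ‖v‖ := by
      rw [← hξ]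
      exact (((fderiv ℝ (mulChart E G) (0, lieChart E G z)).comp
        (ContinuousLinearMap.inl ℝ (LieAlg E G) (LieAlg E G))).le_opNorm ξ).trans
        (mul_le_mul_of_nonneg_right h1.le (norm_nonneg _))
    rw [← h5] at h6
    rw [← ofReal_norm, ← ofReal_norm]
    have h7 : (((1 + η).toNNReal : NNReal) : ENNReal) = ENNReal.ofReal (1 + η) := rfl
    rw [h7, ← ENNReal.ofReal_mul (by positivity)]
    refine ENNReal.ofReal_le_ofReal ?_
    rw [norm_tangentSpace_vectorSpace]
    exact h6
  · rw [edist_comm, edist_dist]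
    exact (ENNReal.ofReal_lt_ofReal_iff hρ).2 hg

lemma eventually_hasDerivAt_lieChart_gexp_nhds_zero (hG : IsRightInvariant E G) {p : LieAlg E G → Prop}
    (hp : ∀ᶠ x in 𝓝 (0 : LieAlg E G), p x) :
    ∃ δ > 0, ∀ v : LieAlg E G, ‖v‖ < δ → ∀ s ∈ Icc (0 : ℝ) 1,
      p (lieChart E G (gexp (s • v))) ∧ HasDerivAt (fun s : ℝ => lieChart E G (gexp (s • v)))
      (fderiv ℝ (mulChart E G) (lieChart E G (gexp (s • v)), 0) (0, v)) s := by
  obtain ⟨ρ, hρ, hball⟩ := Metric.eventually_nhds_iff.1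
    (((tendsto_lieChart_one (E := E) (G := G)).eventually hp).and (eventually_hasDerivAt_lieChart_gexp (E := E) (G := G)))
  refine ⟨ρ, hρ, fun v hv s hs => ?_⟩
  have h1 : dist (gexp (s • v) : G) 1 < ρ := by
    refine (dist_gexp_one_le hG _).trans_lt (lt_of_le_of_lt ?_ hv)
    rw [norm_smul, Real.norm_of_nonneg hs.1]
    exact mul_le_of_le_one_left (norm_nonneg _) hs.2
  exact ⟨(hball h1).1, (hball h1).2 v s rfl⟩

/-- The exponential map, read in the chart, is strictly differentiable at `0`. -/
lemma hasStrictFDerivAt_lieChart_gexp (hG : IsRightInvariant E G) :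
    HasStrictFDerivAt (fun v : LieAlg E G => lieChart E G (gexp v))
      (ContinuousLinearMap.id ℝ (LieAlg E G)) 0 := by
  -- In the chart, x(s) = exp(sv) solves x' = A(x)v with A(0) = id and A Lipschitz near 0.
  -- Regularity in v is read off from this ODE by comparing two solutions.
  set A : LieAlg E G → (LieAlg E G →L[ℝ] LieAlg E G) := fun x =>
    (fderiv ℝ (mulChart E G) (x, 0)).comp (ContinuousLinearMap.inr ℝ _ _) with hA
  have hAc : ContDiffAt ℝ 1 A 0 := by
    have h1 : ContDiffAt ℝ 1 (fderiv ℝ (mulChart E G)) (0, 0) :=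
      (contDiffAt_mulChart (E := E) (G := G)).fderiv_right (by
        exact (WithTop.coe_le_coe.2 le_top : ((2 : ℕ∞) : ℕ∞ω) ≤ ∞))
    have h2 : ContDiffAt ℝ 1 (fun x : LieAlg E G => fderiv ℝ (mulChart E G) (x, 0)) 0 :=
      ContDiffAt.comp (g := fderiv ℝ (mulChart E G)) (f := fun x : LieAlg E G => (x, 0)) 0 h1
        (by fun_prop)
    exact h2.clm_comp contDiffAt_const
  have hA0 : A 0 = ContinuousLinearMap.id ℝ _ := by
    have : fderiv ℝ (mulChart E G) (0, 0) = _ := fderiv_mulChart_zero (E := E) (G := G)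
    simp only [hA]
    rw [this]
    ext; simp
  obtain ⟨K, t, ht, hK⟩ := hAc.exists_lipschitzOnWith
  rw [hasStrictFDerivAt_iff_isLittleO, Asymptotics.isLittleO_iff]
  intro ε hε
  have hAε : ∀ᶠ x in 𝓝 (0 : LieAlg E G), ‖A x - ContinuousLinearMap.id ℝ _‖ < min (ε / 2) 1 := by
    have h1 : Tendsto (fun x => ‖A x - ContinuousLinearMap.id ℝ _‖) (𝓝 0) (𝓝 0) := by
      have h2 : ContinuousAt (fun x => A x - ContinuousLinearMap.id ℝ (LieAlg E G)) 0 :=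
        hAc.continuousAt.sub continuousAt_const
      have h3 := h2.norm.tendsto
      simpa [hA0] using h3
    exact h1.eventually_lt_const (by positivity)
  obtain ⟨δ, hδ, hmain⟩ := eventually_hasDerivAt_lieChart_gexp_nhds_zero hG (hAε.and ht)
  -- The first bound gives K‖w‖ ≤ 1/2, which lets the maximal distance D of the two solutions be
  -- absorbed, giving D ≤ 4‖v − w‖. The second gives K‖w‖ ≤ ε/8, so that K D ‖w‖ ≤ (ε/2)‖v − w‖.
  set δ' := min δ (min (1 / (2 * (K + 1))) (ε / (8 * (K + 1)))) with hδ'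
  have hδ'0 : 0 < δ' := by positivity
  have hnhds : ∀ᶠ q in 𝓝 ((0 : LieAlg E G), (0 : LieAlg E G)), ‖q.1‖ < δ' ∧ ‖q.2‖ < δ' := by
    filter_upwards [Metric.ball_mem_nhds ((0 : LieAlg E G), (0 : LieAlg E G)) hδ'0] with q hq
    rw [Metric.mem_ball, Prod.dist_eq, max_lt_iff] at hq
    simpa using hq
  filter_upwards [hnhds] with q hq
  obtain ⟨v, w⟩ := q
  obtain ⟨hv, hw⟩ := hq
  simp only at hv hw ⊢
  have hvδ : ‖v‖ < δ := hv.trans_le (min_le_left _ _)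
  have hwδ : ‖w‖ < δ := hw.trans_le (min_le_left _ _)
  have hKw : K * ‖w‖ ≤ 1 / 2 := by
    have h1 : ‖w‖ ≤ 1 / (2 * (K + 1)) := hw.le.trans ((min_le_right _ _).trans (min_le_left _ _))
    calc K * ‖w‖ ≤ K * (1 / (2 * (K + 1))) := by gcongr
      _ ≤ (K + 1) * (1 / (2 * (K + 1))) := by gcongr; linarith
      _ = 1 / 2 := by field_simp
  have hKw2 : K * ‖w‖ ≤ ε / 8 := by
    have h1 : ‖w‖ ≤ ε / (8 * (K + 1)) := hw.le.trans ((min_le_right _ _).trans (min_le_right _ _))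
    calc K * ‖w‖ ≤ K * (ε / (8 * (K + 1))) := by gcongr
      _ ≤ (K + 1) * (ε / (8 * (K + 1))) := by gcongr; linarith
      _ = ε / 8 := by field_simp
  set d : ℝ → LieAlg E G := fun s => lieChart E G (gexp (s • v)) - lieChart E G (gexp (s • w)) with hd
  have hderiv : ∀ s ∈ Icc (0 : ℝ) 1, HasDerivAt d (A (lieChart E G (gexp (s • v))) v -
      A (lieChart E G (gexp (s • w))) w) s := fun s hs =>
    ((hmain v hvδ s hs).2).sub ((hmain w hwδ s hs).2)
  obtain ⟨s₀, hs₀, hmax⟩ := isCompact_Icc.exists_isMaxOn (nonempty_Icc.2 zero_le_one)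
    (f := fun s => ‖d s‖) (fun s hs => ((hderiv s hs).continuousAt.norm).continuousWithinAt)
  set D := ‖d s₀‖ with hD
  have hbound : ∀ s ∈ Icc (0 : ℝ) 1, ‖A (lieChart E G (gexp (s • v))) v -
      A (lieChart E G (gexp (s • w))) w - (v - w)‖ ≤ min (ε / 2) 1 * ‖v - w‖ + K * D * ‖w‖ := by
    intro s hs
    obtain ⟨⟨h1, h2⟩, -⟩ := hmain v hvδ s hs
    obtain ⟨⟨-, h4⟩, -⟩ := hmain w hwδ s hs
    set x := lieChart E G (gexp (s • v))
    set y := lieChart E G (gexp (s • w))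
    -- The first term is small because A is near the identity, the second because A is Lipschitz and
    -- w is small; both are controlled by ‖v − w‖ and D.
    have e : A x v - A y w - (v - w) = (A x - ContinuousLinearMap.id ℝ (LieAlg E G)) (v - w) + (A x - A y) w := by
      simp only [_root_.sub_apply, ContinuousLinearMap.id_apply, map_sub]
      abel
    rw [e]
    refine (norm_add_le _ _).trans (add_le_add ?_ ?_)
    · exact ((A x - ContinuousLinearMap.id ℝ (LieAlg E G)).le_opNorm _).trans (by gcongr)
    · refine ((A x - A y).le_opNorm _).trans (mul_le_mul_of_nonneg_right ?_ (norm_nonneg _))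
      refine (hK.norm_sub_le h2 h4).trans ?_
      gcongr
      exact hmax hs
  have hseg : ∀ s ∈ Icc (0 : ℝ) 1, ‖d s - s • (v - w)‖ ≤ min (ε / 2) 1 * ‖v - w‖ + K * D * ‖w‖ := by
    intro s hs
    have h1 := norm_image_sub_le_of_norm_deriv_le_segment' (f := fun s => d s - s • (v - w)) (a := 0) (b := 1)
      (f' := fun s => A (lieChart E G (gexp (s • v))) v - A (lieChart E G (gexp (s • w))) w - (v - w))
      (C := min (ε / 2) 1 * ‖v - w‖ + K * D * ‖w‖)
      (fun s hs => by
        have h := (hderiv s hs).sub ((hasDerivAt_id s).smul_const (v - w))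
        rw [one_smul] at h
        exact h.hasDerivWithinAt)
      (fun s hs => hbound s ⟨hs.1, hs.2.le⟩) s hs
    have h2 : d 0 = 0 := by simp [hd]
    rw [h2, zero_smul, sub_zero, sub_zero, sub_zero] at h1
    refine h1.trans (mul_le_of_le_one_right ?_ hs.2)
    positivity
  have hDle : D ≤ 4 * ‖v - w‖ := by
    have h1 := hseg s₀ hs₀
    have h2 : D ≤ ‖d s₀ - s₀ • (v - w)‖ + ‖s₀ • (v - w)‖ := by
      have := norm_add_le (d s₀ - s₀ • (v - w)) (s₀ • (v - w))
      simpa using this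
    have h3 : ‖s₀ • (v - w)‖ ≤ ‖v - w‖ := by
      rw [norm_smul, Real.norm_of_nonneg hs₀.1]
      exact mul_le_of_le_one_left (norm_nonneg _) hs₀.2
    have h4 : min (ε / 2) 1 * ‖v - w‖ ≤ 1 * ‖v - w‖ := by gcongr; exact min_le_right _ _
    have h5 : K * D * ‖w‖ ≤ 1 / 2 * D := by
      calc K * D * ‖w‖ = K * ‖w‖ * D := by ring
        _ ≤ 1 / 2 * D := by gcongr
    linarith
  have h1 := hseg 1 ⟨zero_le_one, le_rfl⟩
  simp only [hd, one_smul] at h1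
  rw [ContinuousLinearMap.id_apply]
  refine h1.trans ?_
  have h4 : min (ε / 2) 1 * ‖v - w‖ ≤ ε / 2 * ‖v - w‖ := by gcongr; exact min_le_left _ _
  have h5 : K * D * ‖w‖ ≤ ε / 2 * ‖v - w‖ := by
    calc K * D * ‖w‖ = K * ‖w‖ * D := by ring
      _ ≤ ε / 8 * (4 * ‖v - w‖) := by gcongr
      _ = ε / 2 * ‖v - w‖ := by ring
  linarith

lemma tendsto_gexp_zero (hG : IsRightInvariant E G) :
    Tendsto (gexp : LieAlg E G → G) (𝓝 0) (𝓝 1) := by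
  rw [tendsto_iff_dist_tendsto_zero]
  exact squeeze_zero (fun _ => dist_nonneg) (fun v => dist_gexp_one_le hG v)
    (by simpa using (continuous_norm (E := LieAlg E G)).tendsto 0)

/-- The inverse function theorem applies to exp read in the chart, which has strict derivative the
identity at 0. -/
lemma map_gexp_nhds_zero (hG : IsRightInvariant E G) : map (gexp : LieAlg E G → G) (𝓝 0) = 𝓝 1 := by
  have h1 : map (fun v : LieAlg E G => lieChart E G (gexp v)) (𝓝 0) = 𝓝 0 := by
    have := HasStrictFDerivAt.map_nhds_eq_of_equiv (f' := ContinuousLinearEquiv.refl ℝ (LieAlg E G))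
      (hasStrictFDerivAt_lieChart_gexp hG)
    simpa using this
  have h2 : map (lieChartInv : LieAlg E G → G) (𝓝 0) = 𝓝 1 := by
    refine le_antisymm ?_ ?_
    · have := (contMDiffAt_lieChartInv_zero (E := E) (G := G)).continuousAt.tendsto
      rwa [lieChartInv_zero] at this
    · calc 𝓝 1 = map (fun g => lieChartInv (lieChart E G g)) (𝓝 (1 : G)) := by
            rw [map_congr (eventually_lieChartInv_lieChart (E := E) (G := G))]; exact map_id.symm
        _ = map lieChartInv (map (lieChart E G) (𝓝 1)) := map_map.symm
        _ ≤ _ := map_mono tendsto_lieChart_one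
  rw [← h2]
  conv_rhs => rw [← h1, map_map]
  refine map_congr ?_
  filter_upwards [(tendsto_gexp_zero hG).eventually (eventually_lieChartInv_lieChart (E := E) (G := G))] with v hv
  simp [hv]

lemma hasStrictFDerivAt_mulChart_gexp_neg (hG : IsRightInvariant E G) :
    HasStrictFDerivAt (fun q : LieAlg E G × LieAlg E G =>
      mulChart E G (lieChart E G (gexp q.1), lieChart E G (gexp (-q.2))))
      (ContinuousLinearMap.fst ℝ (LieAlg E G) (LieAlg E G) - ContinuousLinearMap.snd ℝ _ _) 0 := by
  have hL := hasStrictFDerivAt_lieChart_gexp (E := E) (G := G) hG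
  have hL' : HasStrictFDerivAt (fun v : LieAlg E G => lieChart E G (gexp v))
      (ContinuousLinearMap.id ℝ (LieAlg E G)) (-(0 : LieAlg E G)) := by rwa [neg_zero]
  have h1 : HasStrictFDerivAt (fun q : LieAlg E G × LieAlg E G => lieChart E G (gexp q.1))
      ((ContinuousLinearMap.id ℝ (LieAlg E G)).comp (ContinuousLinearMap.fst ℝ _ _)) 0 :=
    HasStrictFDerivAt.comp (g := fun v => lieChart E G (gexp v)) 0 hL hasStrictFDerivAt_fst
  have h2 : HasStrictFDerivAt (fun q : LieAlg E G × LieAlg E G => lieChart E G (gexp (-q.2)))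
      ((ContinuousLinearMap.id ℝ (LieAlg E G)).comp (-ContinuousLinearMap.snd ℝ _ _)) 0 :=
    HasStrictFDerivAt.comp (g := fun v => lieChart E G (gexp v)) 0 hL' hasStrictFDerivAt_snd.fun_neg
  have h3 := h1.prodMk h2
  have h5 : ∀ q : LieAlg E G × LieAlg E G, q = 0 → HasStrictFDerivAt (mulChart E G)
      (ContinuousLinearMap.fst ℝ (LieAlg E G) (LieAlg E G) + ContinuousLinearMap.snd ℝ _ _) q := by
    rintro q rfl; exact hasStrictFDerivAt_mulChart
  have h4 := (h5 (lieChart E G (gexp (0 : LieAlg E G × LieAlg E G).1),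
    lieChart E G (gexp (-(0 : LieAlg E G × LieAlg E G).2))) (by simp)).comp
    (0 : LieAlg E G × LieAlg E G) h3
  refine h4.congr_fderiv (ContinuousLinearMap.ext fun q => ?_)
  simp [sub_eq_add_neg]

/-- Local bi-Lipschitz property of the exponential map. -/
lemma exists_gexp_biLipschitz (hG : IsRightInvariant E G) : ∃ ρ > 0, ∀ v w : LieAlg E G,
    ‖v‖ < ρ → ‖w‖ < ρ → ‖v - w‖ / 2 ≤ dist (gexp v : G) (gexp w) ∧
      dist (gexp v : G) (gexp w) ≤ 2 * ‖v - w‖ := by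
  have hL := hasStrictFDerivAt_lieChart_gexp (E := E) (G := G) hG
  have hPhi := hasStrictFDerivAt_mulChart_gexp_neg (E := E) (G := G) hG
  -- Strict differentiability is applied to the pair (v, w) and (w, w): the function vanishes on the
  -- diagonal, so the error is relative to ‖v − w‖ rather than to the norms of v and w.
  have h1 : ∀ᶠ q in 𝓝 ((0 : LieAlg E G), (0 : LieAlg E G)),
      ‖mulChart E G (lieChart E G (gexp q.1), lieChart E G (gexp (-q.2))) - (q.1 - q.2)‖ ≤
        1 / 4 * ‖q.1 - q.2‖ := by
    have h2 := (Asymptotics.isLittleO_iff.1 (hasStrictFDerivAt_iff_isLittleO.1 hPhi))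
      (by norm_num : (0 : ℝ) < 1 / 4)
    have h3 : Tendsto (fun q : LieAlg E G × LieAlg E G => (q, (q.2, q.2))) (𝓝 0) (𝓝 (0, 0)) := by
      have : Continuous (fun q : LieAlg E G × LieAlg E G => (q, (q.2, q.2))) := by fun_prop
      exact this.tendsto 0
    have h5 : ∀ᶠ v in 𝓝 (0 : LieAlg E G), mulChart E G (lieChart E G (gexp v), lieChart E G (gexp (-v))) = 0 := by
      have h6 := (tendsto_gexp_zero (G := G) hG).eventually (eventually_lieChartInv_lieChart (E := E) (G := G))
      have h7 : Tendsto (fun v : LieAlg E G => -v) (𝓝 0) (𝓝 0) := by simpa using (continuous_neg (G := LieAlg E G)).tendsto 0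
      filter_upwards [h6, h7.eventually h6] with v hv hv'
      rw [mulChart, hv, hv', gexp_neg]
      simp
    have h8 : Tendsto (fun q : LieAlg E G × LieAlg E G => q.2) (𝓝 0) (𝓝 0) :=
      continuous_snd.tendsto (0 : LieAlg E G × LieAlg E G)
    filter_upwards [h3.eventually h2, h8.eventually h5] with q hq hq2
    simp only [hq2] at hq
    have h9 : ‖q - (q.2, q.2)‖ = ‖q.1 - q.2‖ := by
      rw [Prod.norm_def]; simp
    rw [h9] at hq
    simpa using hq
  have htn : Tendsto (fun q : LieAlg E G × LieAlg E G => -q.2) (𝓝 0) (𝓝 0) := by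
    have : Continuous (fun q : LieAlg E G × LieAlg E G => -q.2) := by fun_prop
    simpa using this.tendsto 0
  have hmul : Tendsto (fun q : LieAlg E G × LieAlg E G => (gexp q.1 * gexp (-q.2) : G)) (𝓝 (0, 0)) (𝓝 1) := by
    have : ContinuousMul G := continuousMul_of_contMDiffMul 𝓘(ℝ, E) ∞
    have h1 := (tendsto_gexp_zero (G := G) hG).comp
      (continuous_fst.tendsto (0 : LieAlg E G × LieAlg E G))
    have h2 := (tendsto_gexp_zero (G := G) hG).comp
      htn
    have h3 := h1.mul h2
    rwa [mul_one] at h3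
  have hlog : ∀ᶠ g in 𝓝 (1 : G), ∃ u : LieAlg E G, gexp u = g ∧
      ‖lieChart E G (gexp u) - u‖ ≤ 1 / 4 * ‖u‖ := by
    have h2 := (Asymptotics.isLittleO_iff.1 hL.hasFDerivAt.isLittleO) (by norm_num : (0 : ℝ) < 1 / 4)
    simp only [gexp_zero, lieChart_one, sub_zero, ContinuousLinearMap.id_apply] at h2
    rw [← map_gexp_nhds_zero (G := G) hG]
    exact eventually_map.2 (h2.mono fun v hv => ⟨v, rfl, hv⟩)
  have hlow := eventually_norm_lieChart_le (G := G) hG (by norm_num : (0 : ℝ) < 1 / 4)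
  have hinv := eventually_lieChartInv_lieChart (E := E) (G := G)
  have htg1 := (tendsto_gexp_zero (G := G) hG).comp (continuous_fst.tendsto (0 : LieAlg E G × LieAlg E G))
  have htg2 := (tendsto_gexp_zero (G := G) hG).comp
      htn
  obtain ⟨ρ, hρ, hball⟩ := Metric.eventually_nhds_iff.1 (h1.and ((hmul.eventually (hlog.and hlow)).and
    ((htg1.eventually hinv).and (htg2.eventually hinv))))
  refine ⟨ρ, hρ, fun v w hv hw => ?_⟩
  obtain ⟨h1, ⟨⟨u, hu, hu2⟩, h3⟩, h4, h5⟩ := hball (y := (v, w)) (by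
    rw [Prod.dist_eq]; simpa using ⟨hv, hw⟩)
  simp only [Function.comp_apply] at h1 h3 h4 h5 hu
  have hdist : dist (gexp v : G) (gexp w) = dist (gexp v * gexp (-w) : G) 1 := by
    rw [← dist_mul_right_of_isRightInvariant hG _ _ (gexp (-w)), gexp_neg w, mul_inv_cancel]
  have hch : lieChart E G (gexp v * gexp (-w)) =
      mulChart E G (lieChart E G (gexp v), lieChart E G (gexp (-w))) := by
    rw [mulChart, h4, h5]
  rw [← hch] at h1
  rw [hdist]
  set c := lieChart E G (gexp v * gexp (-w))
  have e1 : ‖v - w‖ ≤ ‖c‖ + ‖c - (v - w)‖ := by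
    have := norm_sub_le c (c - (v - w)); simpa using this
  have e2 : ‖c‖ ≤ ‖c - (v - w)‖ + ‖v - w‖ := by
    have := norm_add_le (c - (v - w)) (v - w); simpa using this
  -- Here ‖c‖ lies between 3/4 and 5/4 of ‖v − w‖. The chart is 5/4-Lipschitz from 1, which gives
  -- the lower constant 3/5. On the other side ‖u‖ ≤ (4/3)‖c‖ and dist(exp u, 1) ≤ ‖u‖, which gives
  -- the upper constant 5/3.
  constructor
  · linarith
  · rw [hu] at hu2
    have e3 : ‖u‖ ≤ ‖c‖ + ‖c - u‖ := by
      have := norm_sub_le c (c - u); simpa using this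
    have e4 := dist_gexp_one_le (G := G) hG u
    rw [hu] at e4
    linarith

end LieMetric

/-! ### Haar measure against Lebesgue measure through a bi-Lipschitz map. -/

section BiLip

variable {V : Type*} [NormedAddCommGroup V] {P : Type*} [MetricSpace P]

/-- `e` is `2`-bi-Lipschitz on the ball of radius `ρ`. -/
def BiLipOnBall (e : V → P) (ρ : ℝ) : Prop :=
  ∀ v w : V, ‖v‖ < ρ → ‖w‖ < ρ → ‖v - w‖ / 2 ≤ dist (e v) (e w) ∧ dist (e v) (e w) ≤ 2 * ‖v - w‖

lemma BiLipOnBall.injOn {e : V → P} {ρ : ℝ} (he : BiLipOnBall e ρ) : InjOn e (Metric.ball 0 ρ) := by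
  intro v hv w hw h
  rw [mem_ball_zero_iff] at hv hw
  have := (he v w hv hw).1
  rw [h, dist_self] at this
  have h2 : ‖v - w‖ ≤ 0 := by linarith
  exact sub_eq_zero.1 (norm_le_zero_iff.1 h2)

lemma BiLipOnBall.lipschitzOnWith {e : V → P} {ρ : ℝ} (he : BiLipOnBall e ρ) :
    LipschitzOnWith 2 e (Metric.ball 0 ρ) := by
  refine LipschitzOnWith.of_dist_le_mul fun v hv w hw => ?_
  rw [mem_ball_zero_iff] at hv hw
  rw [dist_eq_norm]
  exact (he v w hv hw).2

lemma BiLipOnBall.continuousAt {e : V → P} {ρ : ℝ} (he : BiLipOnBall e ρ) {v : V} (hv : ‖v‖ < ρ) :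
    ContinuousAt e v :=
  he.lipschitzOnWith.continuousOn.continuousAt (Metric.isOpen_ball.mem_nhds (by simpa using hv))

end BiLip

section HausdorffHaar

variable {V : Type*} [NormedAddCommGroup V] [InnerProductSpace ℝ V] [FiniteDimensional ℝ V]
  [MeasurableSpace V] [BorelSpace V]
  {P : Type*} [Group P] [MetricSpace P] [IsTopologicalGroup P] [LocallyCompactSpace P]
  [MeasurableSpace P] [BorelSpace P]

lemma hausdorffMeasure_image_le_of_biLip {e : V → P} {ρ : ℝ} (he : BiLipOnBall e ρ) {A : Set V}
    (hA : A ⊆ Metric.ball 0 ρ) {d : ℝ} (hd : 0 ≤ d) :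
    μH[d] (e '' A) ≤ 2 ^ d * μH[d] A :=
  (he.lipschitzOnWith.mono hA).hausdorffMeasure_image_le hd

lemma le_hausdorffMeasure_image_of_biLip {e : V → P} {ρ : ℝ} (he : BiLipOnBall e ρ) {A : Set V}
    (hA : A ⊆ Metric.ball 0 ρ) {d : ℝ} (hd : 0 ≤ d) :
    μH[d] A ≤ 2 ^ d * μH[d] (e '' A) := by
  have hinv : LeftInvOn (Function.invFunOn e (Metric.ball 0 ρ)) e (Metric.ball 0 ρ) :=
    he.injOn.leftInvOn_invFunOn
  have hl : LipschitzOnWith 2 (Function.invFunOn e (Metric.ball 0 ρ)) (e '' A) := by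
    refine LipschitzOnWith.of_dist_le_mul ?_
    rintro _ ⟨v, hv, rfl⟩ _ ⟨w, hw, rfl⟩
    rw [hinv (hA hv), hinv (hA hw), dist_eq_norm]
    have := (he v w (by simpa using hA hv) (by simpa using hA hw)).1
    simp only [NNReal.coe_ofNat]
    linarith
  have := hl.hausdorffMeasure_image_le hd
  rwa [image_image, image_congr (fun v hv => hinv (hA hv)), image_id'] at this

lemma isMulRightInvariant_hausdorffMeasure (hr : ∀ x y h : P, dist (x * h) (y * h) = dist x y)
    {d : ℝ} (hd : 0 ≤ d) : (μH[d] : Measure P).IsMulRightInvariant := by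
  refine ⟨fun g => ?_⟩
  have hi : Isometry (fun x : P => x * g) := Isometry.of_dist_eq fun x y => hr x y g
  rw [hi.map_hausdorffMeasure (Or.inl hd)]
  rw [range_eq_univ.2 (Group.mulRight_bijective g).2, Measure.restrict_univ]

variable {e : V → P} {ρ : ℝ}

lemma exists_const_hausdorffMeasure_eq_volume : ∃ k : ENNReal, k ≠ 0 ∧ k ≠ ⊤ ∧
    (μH[Module.finrank ℝ V] : Measure V) = k • (volume : Measure V) := by
  refine ⟨(Measure.addHaarScalarFactor (μH[Module.finrank ℝ V] : Measure V) volume : NNReal), ?_, by simp, ?_⟩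
  · simpa using (Measure.addHaarScalarFactor_pos_of_isAddHaarMeasure (μH[Module.finrank ℝ V] : Measure V) volume).ne'
  · exact Measure.isAddLeftInvariant_eq_smul _ _

lemma isFiniteMeasureOnCompacts_hausdorffMeasure (hr : ∀ x y h : P, dist (x * h) (y * h) = dist x y)
    (he : BiLipOnBall e ρ) (hn : e '' Metric.ball 0 ρ ∈ 𝓝 1) :
    IsFiniteMeasureOnCompacts (μH[Module.finrank ℝ V] : Measure P) := by
  have : (μH[Module.finrank ℝ V] : Measure P).IsMulRightInvariant :=
    isMulRightInvariant_hausdorffMeasure hr (by positivity)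
  have : IsLocallyFiniteMeasure (μH[Module.finrank ℝ V] : Measure P) := by
    refine ⟨fun x => ⟨(fun y => y * x⁻¹) ⁻¹' (e '' Metric.ball 0 ρ), ?_, ?_⟩⟩
    · refine (continuous_mul_const x⁻¹).continuousAt.preimage_mem_nhds ?_
      simpa using hn
    · rw [measure_preimage_mul_right]
      refine (hausdorffMeasure_image_le_of_biLip he le_rfl (by positivity)).trans_lt ?_
      exact ENNReal.mul_lt_top (by simp) measure_ball_lt_top
  infer_instance

lemma isOpenPosMeasure_hausdorffMeasure (hr : ∀ x y h : P, dist (x * h) (y * h) = dist x y)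
    (he : BiLipOnBall e ρ) (hρ : 0 < ρ) (h0 : e 0 = 1) :
    (μH[Module.finrank ℝ V] : Measure P).IsOpenPosMeasure := by
  have : (μH[Module.finrank ℝ V] : Measure P).IsMulRightInvariant :=
    isMulRightInvariant_hausdorffMeasure hr (by positivity)
  refine ⟨fun U hU ⟨u, hu⟩ hz => ?_⟩
  have h1 : (fun y => y * u) ⁻¹' U ∈ 𝓝 (1 : P) :=
    (continuous_mul_const u).continuousAt.preimage_mem_nhds (by simpa using hU.mem_nhds hu)
  have h2 : Tendsto e (𝓝 0) (𝓝 1) := by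
    have := (he.continuousAt (v := 0) (by simpa using hρ)).tendsto
    rwa [h0] at this
  obtain ⟨ε, hε, hb⟩ := Metric.mem_nhds_iff.1 (h2 h1)
  have h3 : μH[Module.finrank ℝ V] (e '' Metric.ball 0 (min ε ρ)) = 0 := by
    refine measure_mono_null ?_ ((measure_preimage_mul_right (μH[Module.finrank ℝ V] : Measure P) u U).trans hz)
    rintro _ ⟨v, hv, rfl⟩
    exact hb (Metric.ball_subset_ball (min_le_left _ _) hv)
  have h4 := le_hausdorffMeasure_image_of_biLip he (Metric.ball_subset_ball (min_le_right ε ρ) :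
    Metric.ball (0 : V) _ ⊆ _) (d := Module.finrank ℝ V) (by positivity)
  rw [h3, mul_zero] at h4
  exact absurd (le_antisymm h4 zero_le) (Metric.measure_ball_pos (μH[Module.finrank ℝ V] : Measure V) 0
    (by positivity : 0 < min ε ρ)).ne'

/-- A Haar measure on a group with right invariant distance is comparable to the Lebesgue measure
through a bi-Lipschitz exponential map. -/
theorem exists_haar_image_comparison [SecondCountableTopology P] (ν : Measure P) [ν.IsHaarMeasure]
    (hr : ∀ x y h : P, dist (x * h) (y * h) = dist x y) (he : BiLipOnBall e ρ) (hρ : 0 < ρ)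
    (h0 : e 0 = 1) (hneg : ∀ v, e (-v) = (e v)⁻¹) (hn : e '' Metric.ball 0 ρ ∈ 𝓝 1) :
    ∃ c C : ENNReal, c ≠ 0 ∧ c ≠ ⊤ ∧ C ≠ 0 ∧ C ≠ ⊤ ∧ ∀ A : Set V, A ⊆ Metric.ball 0 ρ →
      c * volume A ≤ ν (e '' A) ∧ ν (e '' A) ≤ C * volume A := by
  set m : Measure P := μH[Module.finrank ℝ V] with hm
  have : m.IsMulRightInvariant :=
    isMulRightInvariant_hausdorffMeasure hr (by positivity)
  have : IsFiniteMeasureOnCompacts m := isFiniteMeasureOnCompacts_hausdorffMeasure hr he hn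
  have : m.IsOpenPosMeasure := isOpenPosMeasure_hausdorffMeasure hr he hρ h0
  -- The Hausdorff measure is right invariant while Haar measures are left invariant. Inversion
  -- exchanges the two, and in exponential coordinates it is v ↦ −v, which preserves Lebesgue
  -- measure.
  have : m.inv.IsHaarMeasure := {}
  have hν : ν = (Measure.haarScalarFactor ν m.inv) • m.inv := Measure.isMulLeftInvariant_eq_smul _ _
  set c0 := Measure.haarScalarFactor ν m.inv
  have hc0 : c0 ≠ 0 := (Measure.haarScalarFactor_pos_of_isHaarMeasure ν m.inv).ne'
  obtain ⟨k, hk0, hk1, hk⟩ := exists_const_hausdorffMeasure_eq_volume (V := V)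
  have hν2 : ∀ A : Set V, ν (e '' A) = c0 * m (e '' (-A)) := by
    intro A
    rw [hν, Measure.smul_apply, Measure.inv_apply, ENNReal.smul_def, smul_eq_mul]
    congr 2
    ext x
    constructor
    · rintro ⟨v, hv, h⟩
      exact ⟨-v, by simpa using hv, by rw [hneg, h, inv_inv]⟩
    · rintro ⟨v, hv, rfl⟩
      exact ⟨-v, hv, by rw [hneg]⟩
  have hd : (0 : ℝ) ≤ Module.finrank ℝ V := by positivity
  have h20 : (2 : ENNReal) ^ (Module.finrank ℝ V : ℝ) ≠ 0 := by simp
  have h2t : (2 : ENNReal) ^ (Module.finrank ℝ V : ℝ) ≠ ⊤ := by simp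
  refine ⟨c0 * (2 ^ (Module.finrank ℝ V : ℝ))⁻¹ * k, c0 * 2 ^ (Module.finrank ℝ V : ℝ) * k, ?_, ?_, ?_, ?_, fun A hA => ?_⟩
  · simp [hc0, hk0]
  · exact ENNReal.mul_ne_top (ENNReal.mul_ne_top (by simp) (by simp)) hk1
  · simp [hc0, hk0]
  · exact ENNReal.mul_ne_top (ENNReal.mul_ne_top (by simp) (by simp)) hk1
  have hA' : -A ⊆ Metric.ball 0 ρ := by
    intro v hv
    simpa using hA hv
  have hvol : μH[Module.finrank ℝ V] (-A) = k * volume A := by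
    rw [hk, Measure.smul_apply, smul_eq_mul, Measure.measure_neg]
  rw [hν2]
  constructor
  · have h1 := le_hausdorffMeasure_image_of_biLip he hA' hd
    rw [hvol] at h1
    rw [mul_assoc, mul_assoc]
    gcongr
    rw [mul_comm _ (k * volume A), ← div_eq_mul_inv]
    exact ENNReal.div_le_of_le_mul' h1
  · have h1 := hausdorffMeasure_image_le_of_biLip he hA' hd
    rw [hvol] at h1
    rw [mul_assoc, mul_assoc]
    gcongr

end HausdorffHaar

/-! ### Countability properties of connected locally compact groups. -/

section ConnectedGroup

variable {P : Type*} [Group P] [MetricSpace P] [IsTopologicalGroup P] [ConnectedSpace P]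

/-- A connected group is generated by any neighborhood of the identity. -/
lemma closure_eq_top_of_mem_nhds {U : Set P} (hU : U ∈ 𝓝 (1 : P)) : Subgroup.closure U = ⊤ := by
  have hopen : IsOpen (Subgroup.closure U : Set P) :=
    Subgroup.isOpen_of_mem_nhds _ (g := 1) (mem_of_superset hU Subgroup.subset_closure)
  have hclopen : IsClopen (Subgroup.closure U : Set P) := ⟨Subgroup.isClosed_of_isOpen _ hopen, hopen⟩
  have := hclopen.eq_univ ⟨1, Subgroup.one_mem _⟩
  exact SetLike.ext' (by simpa using this)

-- The powers of a compact symmetric neighbourhood of 1 exhaust the group; a σ-compact metric space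
-- is second countable.
open Pointwise in
lemma secondCountableTopology_of_connected_group [LocallyCompactSpace P] :
    SigmaCompactSpace P ∧ SecondCountableTopology P := by
  obtain ⟨K, hK, hK1⟩ := exists_compact_mem_nhds (1 : P)
  set L := K ∪ K⁻¹ with hL
  have hLc : IsCompact L := hK.union hK.inv
  have hcov : ⋃ n : ℕ, L ^ n = univ := by
    refine eq_univ_of_forall fun x => ?_
    have hx : x ∈ Subgroup.closure K := by rw [closure_eq_top_of_mem_nhds hK1]; trivial
    induction hx using Subgroup.closure_induction'' with
    | one => exact mem_iUnion.2 ⟨0, by simp⟩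
    | mem x hx => exact mem_iUnion.2 ⟨1, by simp [hL, hx]⟩
    | inv_mem x hx => exact mem_iUnion.2 ⟨1, by simp [hL, hx]⟩
    | mul x y _ _ hx hy =>
      obtain ⟨n, hn⟩ := mem_iUnion.1 hx
      obtain ⟨m, hm⟩ := mem_iUnion.1 hy
      exact mem_iUnion.2 ⟨n + m, by rw [pow_add]; exact mul_mem_mul hn hm⟩
  have h1 : SigmaCompactSpace P :=
    ⟨⟨fun n => L ^ n, fun n => by
      show IsCompact (L ^ n)
      induction n with
      | zero => rw [pow_zero]; exact isCompact_singleton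
      | succ n ih => rw [pow_succ]; exact ih.mul hLc, hcov⟩⟩
  exact ⟨h1, EMetric.secondCountable_of_sigmaCompact P⟩

end ConnectedGroup

/-! ### Diagonalizable one-parameter families of linear maps. -/

section Diagonal

variable {V : Type*} [NormedAddCommGroup V] [NormedSpace ℝ V] {n : ℕ}

lemma hasDerivAt_of_diagonal [FiniteDimensional ℝ V] {T : ℝ → V →L[ℝ] V} (B : Module.Basis (Fin n) ℝ V)
    {c : Fin n → ℝ} (h : ∀ t i, T t (B i) = Real.exp (t * c i) • B i) :
    ∃ D : V →L[ℝ] V, HasDerivAt T D 0 ∧ ∀ i, D (B i) = c i • B i := by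
  set pr : Fin n → V →L[ℝ] V := fun i =>
    (LinearMap.toContinuousLinearMap (B.coord i)).smulRight (B i) with hpr
  have hpr2 : ∀ i j, pr i (B j) = if i = j then B j else 0 := by
    intro i j
    simp only [hpr, ContinuousLinearMap.smulRight_apply, LinearMap.coe_toContinuousLinearMap',
      Module.Basis.coord_apply, Module.Basis.repr_self, Finsupp.single_apply]
    split_ifs with h1 h2 h2 <;> simp_all
  have hsum : ∀ (a : Fin n → ℝ) j, (∑ i, a i • pr i) (B j) = a j • B j := by
    intro a j
    rw [_root_.sum_apply]
    simp [hpr2]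
  have hT : T = fun t => ∑ i, Real.exp (t * c i) • pr i := by
    ext1 t
    apply ContinuousLinearMap.coe_injective
    refine B.ext fun j => ?_
    exact (h t j).trans (hsum (fun i => Real.exp (t * c i)) j).symm
  refine ⟨∑ i, c i • pr i, ?_, hsum c⟩
  rw [hT]
  refine HasDerivAt.fun_sum fun i _ => ?_
  have : HasDerivAt (fun t : ℝ => Real.exp (t * c i)) (c i) 0 := by
    have := ((hasDerivAt_id (0 : ℝ)).mul_const (c i)).exp
    simpa using this
  exact this.smul_const (pr i)

/-- Since exp is injective on ℝ, an eigenvector of `T 1` only involves basis vectors with one common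
weight, so it is an eigenvector of the whole flow and of its generator. -/
lemma apply_of_diagonal_of_eigenvector {T : ℝ → V →L[ℝ] V} {D : V →L[ℝ] V}
    (B : Module.Basis (Fin n) ℝ V) {c : Fin n → ℝ} (h : ∀ t i, T t (B i) = Real.exp (t * c i) • B i)
    (hD : ∀ i, D (B i) = c i • B i) {a : ℝ} {v : V} (hv : T 1 v = a • v) (hv0 : v ≠ 0) :
    ∃ w : ℝ, (∀ t, T t v = Real.exp (t * w) • v) ∧ D v = w • v := by
  have hrep : ∀ (S : V →L[ℝ] V) (k : Fin n → ℝ), (∀ i, S (B i) = k i • B i) → ∀ u i,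
      B.repr (S u) i = k i * B.repr u i := by
    intro S k hS u i
    conv_lhs => rw [← B.sum_repr u]
    simp only [map_sum, map_smul, hS, Finsupp.coe_finsetSum, Finset.sum_apply, Finsupp.smul_apply,
      Module.Basis.repr_self, smul_eq_mul, Finsupp.single_apply]
    simp [mul_comm]
  obtain ⟨j, hj⟩ : ∃ j, B.repr v j ≠ 0 := by
    by_contra! hc
    exact hv0 (by rw [← B.sum_repr v]; simp [hc])
  have h1 : ∀ i, Real.exp (c i) * B.repr v i = a * B.repr v i := fun i => by
    have := hrep (T 1) _ (h 1) v i
    rw [hv] at this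
    simpa using this.symm
  have ha : a = Real.exp (c j) := mul_right_cancel₀ hj (h1 j).symm
  have hc : ∀ i, B.repr v i ≠ 0 → c i = c j := fun i hi => by
    have := mul_right_cancel₀ hi (h1 i)
    rw [ha] at this
    exact Real.exp_injective this
  refine ⟨c j, fun t => ?_, ?_⟩
  · refine B.repr.injective (Finsupp.ext fun i => ?_)
    rw [hrep _ _ (h t)]
    by_cases hi : B.repr v i = 0
    · simp [hi]
    · simp [hc i hi]
  · refine B.repr.injective (Finsupp.ext fun i => ?_)
    rw [hrep _ _ hD]
    by_cases hi : B.repr v i = 0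
    · simp [hi]
    · simp [hc i hi]

end Diagonal

/-! ### Regularity of self-maps of P seen through the immersion into G. -/

section ClosedGraph

/-- An endomorphism of a locally compact, `σ`-compact group is continuous if it becomes so after
composition with a continuous injective homomorphism. -/
lemma continuous_of_continuous_comp_injective {P G : Type*} [Group P] [TopologicalSpace P]
    [IsTopologicalGroup P] [T2Space P] [LocallyCompactSpace P] [SigmaCompactSpace P] [Group G]
    [TopologicalSpace G] [T2Space G] {ι : P →* G} (hι : Continuous ι) (hi : Function.Injective ι)
    {f : P →* P} (hf : Continuous (fun h => ι (f h))) : Continuous f := by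
  -- `ι` need not be a homeomorphism onto its image, so continuity cannot simply be pulled back.
  -- Instead the graph is closed, hence a σ-compact group, and the open mapping theorem makes its
  -- bijective projection to `P` a homeomorphism.
  have hcl : IsClosed (f.graph : Set (P × P)) := by
    have : (f.graph : Set (P × P)) = {q | ι (f q.1) = ι q.2} := by
      ext q
      rw [SetLike.mem_coe, MonoidHom.mem_graph]
      exact hi.eq_iff.symm
    rw [this]
    exact isClosed_eq (hf.comp continuous_fst) (hι.comp continuous_snd)
  have : SigmaCompactSpace f.graph := hcl.isClosedEmbedding_subtypeVal.sigmaCompactSpace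
  let pr : f.graph →* P := (MonoidHom.fst P P).comp f.graph.subtype
  have hpr : Continuous pr := continuous_fst.comp continuous_subtype_val
  have hs : Function.Surjective pr := fun h => ⟨⟨(h, f h), rfl⟩, rfl⟩
  have hopen := MonoidHom.isOpenMap_of_sigmaCompact pr hs hpr
  have hinj : Function.Injective pr := by
    rintro ⟨⟨a, b⟩, h⟩ ⟨⟨a', b'⟩, h'⟩ (rfl : a = a')
    rw [MonoidHom.mem_graph] at h h'
    simp_all
  let φ := (Equiv.ofBijective pr ⟨hinj, hs⟩).toHomeomorphOfContinuousOpen hpr hopen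
  have : (f : P → P) = fun h => (φ.symm h : P × P).2 := by
    ext h
    have h1 : ((φ.symm h : P × P)).1 = h := φ.apply_symm_apply h
    have h2 : f (φ.symm h : P × P).1 = (φ.symm h : P × P).2 := (φ.symm h).2
    rw [← h2, h1]
  rw [this]
  exact continuous_snd.comp (continuous_subtype_val.comp φ.symm.continuous)

end ClosedGraph

section LocalDiff

/-- Near a, continuity of f allows writing f as the local inverse of q composed with q ∘ f. -/
lemma hasFDerivAt_of_hasStrictFDerivAt_comp {V W : Type*} [NormedAddCommGroup V] [NormedSpace ℝ V]
    [CompleteSpace V] [NormedAddCommGroup W] [NormedSpace ℝ W] {q : V → V} {f : W → V} {a : W}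
    (hq : HasStrictFDerivAt q (ContinuousLinearEquiv.refl ℝ V : V →L[ℝ] V) (f a)) (hf : ContinuousAt f a)
    {D : W →L[ℝ] V} (hD : HasFDerivAt (q ∘ f) D a) : HasFDerivAt f D a := by
  have h1 : HasFDerivAt (hq.localInverse q _ _ ∘ (q ∘ f)) D a := by
    have := hq.to_localInverse.hasFDerivAt.comp (f := q ∘ f) a hD
    exact this
  refine h1.congr_of_eventuallyEq ?_
  filter_upwards [hf.eventually hq.eventually_left_inverse] with x hx
  exact hx.symm

variable {E : Type*} [NormedAddCommGroup E] [NormedSpace ℝ E] [FiniteDimensional ℝ E]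
  {G : Type*} [Group G] [TopologicalSpace G] [ChartedSpace E G] [LieGroup 𝓘(ℝ, E) ∞ G]
  {E' : Type*} [NormedAddCommGroup E'] [NormedSpace ℝ E'] [FiniteDimensional ℝ E']
  {P : Type*} [Group P] [TopologicalSpace P] [ChartedSpace E' P] [LieGroup 𝓘(ℝ, E') ∞ P]

lemma contDiffAt_chart1_of_contMDiffAt {f : P → G} (hf : f 1 = 1)
    (h : ContMDiffAt 𝓘(ℝ, E') 𝓘(ℝ, E) ∞ f 1) :
    ContDiffAt ℝ ∞ (chart1 E G ∘ f ∘ (chart1 E' P).symm) (chart1 E' P 1) := by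
  have h2 := (contMDiffAt_iff.1 h).2
  rw [hf] at h2
  rw [ModelWithCorners.range_eq_univ] at h2
  exact contDiffWithinAt_univ.1 h2

/-- A continuous self-map of `P` is differentiable at `1` if it becomes so after composition with an
immersion. -/
lemma exists_hasMFDerivAt_one_of_comp {ι : P → G} (h1 : ι 1 = 1) (hι : ContMDiff 𝓘(ℝ, E') 𝓘(ℝ, E) ∞ ι)
    {L : E' →L[ℝ] E} (hL : HasMFDerivAt 𝓘(ℝ, E') 𝓘(ℝ, E) ι 1 L) (hi : Function.Injective L) {f : P → P}
    (hf1 : f 1 = 1) (hf : ContinuousAt f 1) {D : E' →L[ℝ] E}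
    (hD : HasMFDerivAt 𝓘(ℝ, E') 𝓘(ℝ, E) (fun h => ι (f h)) 1 D) :
    ∃ A : E' →L[ℝ] E', HasMFDerivAt 𝓘(ℝ, E') 𝓘(ℝ, E') f 1 A := by
  -- A linear left inverse of the derivative turns the immersion, read in charts, into a map of `E'`
  -- with derivative the identity; no chart adapted to the image is needed.
  obtain ⟨M, hM⟩ := L.toLinearMap.exists_leftInverse_of_injective (LinearMap.ker_eq_bot.2 hi)
  set M' : E →L[ℝ] E' := LinearMap.toContinuousLinearMap M with hM'
  have hML : M' ∘L L = ContinuousLinearMap.id ℝ E' := by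
    ext v; exact congrArg (fun A : E' →ₗ[ℝ] E' => A v) hM
  set a := chart1 E' P 1 with ha
  have hs : HasStrictFDerivAt (chart1 E G ∘ ι ∘ (chart1 E' P).symm) L a := by
    have := (contDiffAt_chart1_of_contMDiffAt h1 (hι 1)).hasStrictFDerivAt (by simp)
    rwa [(hasFDerivAt_of_hasMFDerivAt_one h1 hL).fderiv] at this
  have hq : HasStrictFDerivAt (M' ∘ (chart1 E G ∘ ι ∘ (chart1 E' P).symm))
      (ContinuousLinearEquiv.refl ℝ E' : E' →L[ℝ] E') a := by
    have := M'.hasStrictFDerivAt.comp a hs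
    rw [hML] at this
    exact this
  have hD' := hasFDerivAt_of_hasMFDerivAt_one (by simp [hf1, h1]) hD
  refine ⟨M' ∘L D, hasMFDerivAt_one_of_hasFDerivAt hf1 hf ?_⟩
  have hsymm : (chart1 E' P).symm a = 1 := extChartAt_to_inv (I := 𝓘(ℝ, E')) (1 : P)
  have hfa : (chart1 E' P ∘ f ∘ (chart1 E' P).symm) a = a := by
    simp only [Function.comp_apply, hsymm, hf1]; rfl
  have hsc : ContinuousAt (chart1 E' P).symm a := continuousAt_extChartAt_symm (I := 𝓘(ℝ, E')) (1 : P)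
  have hfs : Tendsto (f ∘ (chart1 E' P).symm) (𝓝 a) (𝓝 1) := by
    have h2 : Tendsto (chart1 E' P).symm (𝓝 a) (𝓝 1) := by
      rw [ContinuousAt, hsymm] at hsc; exact hsc
    have h3 : Tendsto f (𝓝 1) (𝓝 1) := by simpa [ContinuousAt, hf1] using hf
    exact h3.comp h2
  have hcc : ContinuousAt (chart1 E' P ∘ f ∘ (chart1 E' P).symm) a := by
    rw [ContinuousAt, hfa]
    exact ((continuousAt_extChartAt (I := 𝓘(ℝ, E')) (1 : P)).tendsto).comp hfs
  refine hasFDerivAt_of_hasStrictFDerivAt_comp (q := M' ∘ (chart1 E G ∘ ι ∘ (chart1 E' P).symm))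
    (by rw [hfa]; exact hq) hcc ?_
  refine (M'.hasFDerivAt.comp a hD').congr_of_eventuallyEq ?_
  filter_upwards [hfs.eventually (extChartAt_source_mem_nhds (I := 𝓘(ℝ, E')) (1 : P))] with x hx
  simp only [Function.comp_apply] at hx ⊢
  have := (chart1 E' P).left_inv hx
  rw [this]

lemma eq_of_lieExp_smul_eq [T2Space G] {v w : TangentSpace 𝓘(ℝ, E) (1 : G)}
    (h : ∀ s : ℝ, (lieExp E (s • v) : G) = lieExp E (s • w)) : v = w := by
  have h1 := hasDerivAt_chart1_lieExp v
  have h2 := hasDerivAt_chart1_lieExp w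
  simp_rw [h] at h1
  exact h1.unique h2

lemma hasMFDerivAt_conj (k : G) : HasMFDerivAt 𝓘(ℝ, E) 𝓘(ℝ, E) (fun x : G => k * x * k⁻¹) 1
    (show E →L[ℝ] E from Ad E k) := by
  have : MDifferentiableAt 𝓘(ℝ, E) 𝓘(ℝ, E) (fun x : G => k * x * k⁻¹) 1 :=
    MDifferentiableAt.comp (f := fun x : G => k * x) 1 (mdifferentiable_mul_right (E := E) k⁻¹ _) (mdifferentiable_mul_left (E := E) k _)
  exact this.hasMFDerivAt

end LocalDiff

/-! ### Eigenbases of invariant subspaces and the diagonal flow. -/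

section Eigenbasis

variable {V W : Type*} [NormedAddCommGroup V] [NormedSpace ℝ V] [FiniteDimensional ℝ V]
  [AddCommGroup W] [Module ℝ W] [FiniteDimensional ℝ W] {n : ℕ}

/-- The restriction of a diagonalizable flow to an invariant subspace is diagonalizable. -/
lemma exists_eigenbasis_of_diagonal {T : ℝ → V →L[ℝ] V} {D : V →L[ℝ] V}
    (B : Module.Basis (Fin n) ℝ V) {c : Fin n → ℝ} (h : ∀ t i, T t (B i) = Real.exp (t * c i) • B i)
    (hD : ∀ i, D (B i) = c i • B i) {L : W →ₗ[ℝ] V} (hL : Function.Injective L)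
    (hA : ∀ v, ∃ u, T 1 (L v) = L u) :
    ∃ (b : Module.Basis (Fin (Module.finrank ℝ W)) ℝ W) (w : Fin (Module.finrank ℝ W) → ℝ),
      Monotone w ∧ ∀ i, (∀ t, T t (L (b i)) = Real.exp (t * w i) • L (b i)) ∧
        D (L (b i)) = w i • L (b i) := by
  set S : Set W := {u | ∃ a : ℝ, T 1 (L u) = a • L u} with hS
  have hspan : Submodule.span ℝ S = ⊤ := by
    rw [eq_top_iff]
    intro u _
    -- An invariant subspace is the sum of its intersections with the generalized eigenspaces; at
    -- exponent 1 these are the eigenspaces, which span because `T 1` is diagonal.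
    have h1 := Submodule.inf_iSup_genEigenspace (p := LinearMap.range L)
      (f := (T 1 : V →ₗ[ℝ] V)) (by
        rintro _ ⟨v, rfl⟩
        obtain ⟨u, hu⟩ := hA v
        exact ⟨u, hu.symm⟩) 1
    have h2 : ⨆ μ, Module.End.genEigenspace (T 1 : V →ₗ[ℝ] V) μ 1 = ⊤ := by
      rw [eq_top_iff, ← B.span_eq, Submodule.span_le]
      rintro _ ⟨i, rfl⟩
      refine Submodule.mem_iSup_of_mem (Real.exp (1 * c i)) ?_
      exact Module.End.mem_eigenspace_iff.2 (h 1 i)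
    rw [h2, inf_top_eq] at h1
    have h3 : (⨆ μ, LinearMap.range L ⊓ Module.End.genEigenspace (T 1 : V →ₗ[ℝ] V) μ 1) ≤
        Submodule.map L (Submodule.span ℝ S) := by
      refine iSup_le fun a => ?_
      rintro _ ⟨⟨v, rfl⟩, hv⟩
      refine Submodule.mem_map_of_mem (Submodule.subset_span ⟨a, ?_⟩)
      exact Module.End.mem_eigenspace_iff.1 hv
    rw [← h1] at h3
    obtain ⟨u', hu', he⟩ := h3 (LinearMap.mem_range_self L u)
    rwa [← hL he]
  obtain ⟨b, hbS, hbspan, hbli⟩ := exists_linearIndependent ℝ S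
  rw [hspan] at hbspan
  set b0 : Module.Basis b ℝ W := Module.Basis.mk hbli (by simp [hbspan]) with hb0
  have : Fintype b := FiniteDimensional.fintypeBasisIndex b0
  set b1 := b0.reindex (Fintype.equivFinOfCardEq (Module.finrank_eq_card_basis b0).symm) with hb1
  have hmem : ∀ i, b1 i ∈ S := by
    intro i
    rw [hb1, Module.Basis.reindex_apply, hb0, Module.Basis.mk_apply]
    exact hbS (Subtype.mem _)
  have hex : ∀ i, ∃ w : ℝ, (∀ t, T t (L (b1 i)) = Real.exp (t * w) • L (b1 i)) ∧
      D (L (b1 i)) = w • L (b1 i) := by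
    intro i
    obtain ⟨a, ha⟩ := hmem i
    refine apply_of_diagonal_of_eigenvector B h hD ha ?_
    rw [Ne, map_eq_zero_iff L hL]
    exact b1.ne_zero i
  choose w hw using hex
  -- Weights are sorted increasingly because the triangularity of the group law relies on this
  -- order.
  refine ⟨b1.reindex (Tuple.sort w).symm, w ∘ Tuple.sort w, Tuple.monotone_sort w, fun i => ?_⟩
  simp only [Module.Basis.reindex_apply, Equiv.symm_symm, Function.comp_apply]
  exact hw _

end Eigenbasis

section DiagFlow

variable {V : Type*} [NormedAddCommGroup V] [NormedSpace ℝ V] [FiniteDimensional ℝ V] {n : ℕ}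
  (b : Module.Basis (Fin n) ℝ V) (w : Fin n → ℝ)

/-- The flow acting on the `i`-th basis vector by `exp (t * w i)`. -/
noncomputable def diagFlow (t : ℝ) : V →L[ℝ] V :=
  LinearMap.toContinuousLinearMap (b.constr ℝ fun i => Real.exp (t * w i) • b i)

@[simp] lemma diagFlow_basis (t : ℝ) (i : Fin n) : diagFlow b w t (b i) = Real.exp (t * w i) • b i := by
  simp [diagFlow]

lemma eq_diagFlow {A : V →ₗ[ℝ] V} {t : ℝ} (h : ∀ i, A (b i) = Real.exp (t * w i) • b i) (v : V) :
    A v = diagFlow b w t v := by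
  have : A = (diagFlow b w t : V →ₗ[ℝ] V) := b.ext fun i => by simp [h]
  rw [this]; rfl

lemma diagFlow_repr (t : ℝ) (v : V) (i : Fin n) :
    b.repr (diagFlow b w t v) i = Real.exp (t * w i) * b.repr v i := by
  conv_lhs => rw [← b.sum_repr v]
  simp only [map_sum, map_smul, diagFlow_basis, Finsupp.coe_finsetSum, Finset.sum_apply, Finsupp.smul_apply,
      Module.Basis.repr_self, smul_eq_mul, Finsupp.single_apply]
  simp [mul_comm]

lemma diagFlow_add (s t : ℝ) (v : V) : diagFlow b w (s + t) v = diagFlow b w s (diagFlow b w t v) := by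
  refine b.repr.injective (Finsupp.ext fun i => ?_)
  simp only [diagFlow_repr, add_mul, Real.exp_add, mul_assoc]

@[simp] lemma diagFlow_zero (v : V) : diagFlow b w 0 v = v := by
  refine b.repr.injective (Finsupp.ext fun i => ?_)
  simp [diagFlow_repr]

lemma diagFlow_apply_neg (t : ℝ) (v : V) : diagFlow b w t (diagFlow b w (-t) v) = v := by
  rw [← diagFlow_add, add_neg_cancel, diagFlow_zero]

lemma det_diagFlow (t : ℝ) : LinearMap.det (diagFlow b w t : V →ₗ[ℝ] V) = Real.exp (t * ∑ i, w i) := by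
  have : LinearMap.toMatrix b b (diagFlow b w t : V →ₗ[ℝ] V) =
      Matrix.diagonal fun i => Real.exp (t * w i) := by
    ext i j
    rw [LinearMap.toMatrix_apply, Matrix.diagonal_apply]
    simp only [ContinuousLinearMap.coe_coe, diagFlow_basis, map_smul, Module.Basis.repr_self,
      Finsupp.smul_apply, Finsupp.single_apply, smul_eq_mul, mul_ite, mul_one, mul_zero]
    by_cases hij : i = j <;> simp [hij, eq_comm]
  rw [← LinearMap.det_toMatrix b, this, Matrix.det_diagonal, ← Real.exp_sum, Finset.mul_sum]

/-- Uniform contraction in backward time. -/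
lemma exists_norm_diagFlow_neg_le (hw : ∀ i, 0 < w i) : ∃ C > 0, ∃ κ > 0, ∀ t, 0 ≤ t → ∀ v,
    ‖diagFlow b w (-t) v‖ ≤ C * Real.exp (-κ * t) * ‖v‖ := by
  obtain ⟨κ, hκ, hκw⟩ : ∃ κ > 0, ∀ i, κ ≤ w i := by
    obtain h | h := isEmpty_or_nonempty (Fin n)
    · exact ⟨1, one_pos, fun i => h.elim i⟩
    · obtain ⟨i, hi⟩ := Finite.exists_min w
      exact ⟨w i, hw i, hi⟩
  set f := b.equivFunL with hf
  set C := ∑ i, ‖b i‖ with hC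
  refine ⟨C * ‖(f : V →L[ℝ] Fin n → ℝ)‖ + 1, by positivity, κ, hκ, fun t ht v => ?_⟩
  have h1 : diagFlow b w (-t) v = ∑ i, (Real.exp (-t * w i) * b.repr v i) • b i := by
    conv_lhs => rw [← b.sum_repr (diagFlow b w (-t) v)]
    simp_rw [diagFlow_repr]
  have h2 : ∀ i, |b.repr v i| ≤ ‖(f : V →L[ℝ] Fin n → ℝ)‖ * ‖v‖ := fun i => by
    have h3 := (f : V →L[ℝ] Fin n → ℝ).le_opNorm v
    refine le_trans ?_ h3
    exact norm_le_pi_norm (f v) i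
  calc ‖diagFlow b w (-t) v‖ ≤ ∑ i, Real.exp (-κ * t) * (‖(f : V →L[ℝ] Fin n → ℝ)‖ * ‖v‖) * ‖b i‖ := by
        rw [h1]
        refine (norm_sum_le _ _).trans (Finset.sum_le_sum fun i _ => ?_)
        rw [norm_smul, norm_mul, Real.norm_eq_abs, Real.norm_eq_abs, Real.abs_exp]
        have : Real.exp (-t * w i) ≤ Real.exp (-κ * t) :=
          Real.exp_le_exp.2 (by nlinarith [mul_le_mul_of_nonneg_left (hκw i) ht])
        gcongr
        exact h2 i
    _ = (C * ‖(f : V →L[ℝ] Fin n → ℝ)‖) * Real.exp (-κ * t) * ‖v‖ := by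
        rw [← Finset.mul_sum]; ring
    _ ≤ _ := by gcongr; linarith

lemma tendsto_diagFlow_neg (hw : ∀ i, 0 < w i) (v : V) :
    Tendsto (fun t => diagFlow b w (-t) v) atTop (𝓝 0) := by
  obtain ⟨C, hC, κ, hκ, h⟩ := exists_norm_diagFlow_neg_le b w hw
  have h1 : Tendsto (fun t => C * Real.exp (-κ * t) * ‖v‖) atTop (𝓝 0) := by
    have h2 : Tendsto (fun t : ℝ => Real.exp (-κ * t)) atTop (𝓝 0) :=
      Real.tendsto_exp_atBot.comp (tendsto_id.const_mul_atTop_of_neg (by linarith))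
    simpa using (h2.const_mul C).mul_const ‖v‖
  refine squeeze_zero_norm' ?_ h1
  filter_upwards [eventually_ge_atTop 0] with t ht using h t ht v

end DiagFlow

/-! ### Groups expanded by a flow: exp is a global homeomorphism. -/

section Contraction

variable {V : Type*} [NormedAddCommGroup V] [InnerProductSpace ℝ V] [FiniteDimensional ℝ V]
  {P : Type*} [Group P] [MetricSpace P] {n : ℕ}

/-- An exponential map `e` of a group `P` with a right-invariant distance, and a one-parameter group
`c` of automorphisms of `P` which acts on the Lie algebra through a diagonal flow with positive
weights. -/
structure IsExpandingExp (e : V → P) (c : ℝ → P →* P) (b : Module.Basis (Fin n) ℝ V)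
    (w : Fin n → ℝ) : Prop where
  add_smul : ∀ v (s t : ℝ), e ((s + t) • v) = e (s • v) * e (t • v)
  dist_le : ∀ v, dist (e v) 1 ≤ ‖v‖
  dist_mul_right : ∀ x y h : P, dist (x * h) (y * h) = dist x y
  exists_biLip : ∃ ρ > 0, BiLipOnBall e ρ
  map_nhds : map e (𝓝 0) = 𝓝 1
  map_exp : ∀ t v, c t (e v) = e (diagFlow b w t v)
  flow_add : ∀ s t h, c (s + t) h = c s (c t h)
  flow_zero : ∀ h, c 0 h = h
  continuous : ∀ t, Continuous (c t)
  weight_pos : ∀ i, 0 < w i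

namespace IsExpandingExp

variable {e : V → P} {c : ℝ → P →* P} {b : Module.Basis (Fin n) ℝ V} {w : Fin n → ℝ}
  (h : IsExpandingExp e c b w)
include h

lemma exp_zero : e 0 = 1 := by
  have := h.add_smul 0 0 0
  simpa using this

lemma exp_neg (v : V) : e (-v) = (e v)⁻¹ := by
  have := h.add_smul v (-1) 1
  simp only [neg_add_cancel, zero_smul, h.exp_zero, neg_smul, one_smul] at this
  exact eq_inv_of_mul_eq_one_left this.symm

lemma map_neg_map (t : ℝ) (x : P) : c (-t) (c t x) = x := by
  rw [← h.flow_add, neg_add_cancel, h.flow_zero]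

lemma map_map_neg (t : ℝ) (x : P) : c t (c (-t) x) = x := by
  rw [← h.flow_add, add_neg_cancel, h.flow_zero]

variable [IsTopologicalGroup P] [ConnectedSpace P]

lemma image_ball_mem_nhds {ρ : ℝ} (hρ : 0 < ρ) : e '' Metric.ball 0 ρ ∈ 𝓝 1 := by
  rw [← h.map_nhds]
  exact image_mem_map (Metric.ball_mem_nhds 0 hρ)

/-- The contracted points form a subgroup containing a neighbourhood of 1, hence everything by
connectedness. -/
lemma tendsto_map_neg (x : P) : Tendsto (fun t => c (-t) x) atTop (𝓝 1) := by
  have hx : x ∈ Subgroup.closure (e '' Metric.ball 0 1) := by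
    rw [closure_eq_top_of_mem_nhds (h.image_ball_mem_nhds one_pos)]; trivial
  induction hx using Subgroup.closure_induction with
  | mem x hx =>
    obtain ⟨v, -, rfl⟩ := hx
    simp_rw [h.map_exp]
    rw [← h.map_nhds]
    exact tendsto_map.comp (tendsto_diagFlow_neg b w h.weight_pos v)
  | one => simp
  | mul x y _ _ hx hy => simpa using hx.mul hy
  | inv x _ hx => simpa using hx.inv

/-- Contract a point into the range of exp near 1, then expand again: exp intertwines the two flows.
Injectivity is proved in the same way. -/
lemma surjective_exp : Function.Surjective e := by
  intro x
  obtain ⟨t, ht⟩ := ((h.tendsto_map_neg x).eventually (h.image_ball_mem_nhds one_pos)).exists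
  obtain ⟨v, -, hv⟩ := ht
  refine ⟨diagFlow b w t v, ?_⟩
  rw [← h.map_exp, hv, h.map_map_neg]

lemma injective_exp : Function.Injective e := by
  intro v v' hv
  obtain ⟨ρ, hρ, hb⟩ := h.exists_biLip
  have hball := Metric.ball_mem_nhds (0 : V) hρ
  obtain ⟨t, h1, h2⟩ := (((tendsto_diagFlow_neg b w h.weight_pos v).eventually hball).and
    ((tendsto_diagFlow_neg b w h.weight_pos v').eventually hball)).exists
  have : e (diagFlow b w (-t) v) = e (diagFlow b w (-t) v') := by
    rw [← h.map_exp, ← h.map_exp, hv]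
  have := congrArg (diagFlow b w t) (hb.injOn h1 h2 this)
  simpa only [diagFlow_apply_neg] using this

/-- The exponential map, as a homeomorphism. -/
theorem isHomeomorph_exp : IsHomeomorph e := by
  obtain ⟨ρ, hρ, hb⟩ := h.exists_biLip
  have hscale : ∀ t v, e v = c t (e (diagFlow b w (-t) v)) := fun t v => by
    rw [h.map_exp, diagFlow_apply_neg]
  have hcont : Continuous e := by
    refine continuous_iff_continuousAt.2 fun v => ?_
    obtain ⟨t, h1⟩ := ((tendsto_diagFlow_neg b w h.weight_pos v).eventually
    (Metric.ball_mem_nhds (0 : V) hρ)).exists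
    have h2 : e = c t ∘ e ∘ diagFlow b w (-t) := funext (hscale t)
    rw [h2]
    refine (h.continuous t).continuousAt.comp (ContinuousAt.comp ?_ (diagFlow b w (-t)).continuous.continuousAt)
    exact hb.continuousAt (mem_ball_zero_iff.1 h1)
  refine ⟨hcont, ?_, h.injective_exp, h.surjective_exp⟩
  obtain ⟨δ, hδ, hsub⟩ := Metric.mem_nhds_iff.1 (h.image_ball_mem_nhds hρ)
  -- Openness near 0: points of `P` close to `e u` are exponentials of vectors of the bi-Lipschitz
  -- ball, and the lower Lipschitz bound puts those vectors close to u.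
  have hloc : ∀ u : V, ‖u‖ < δ → 𝓝 (e u) ≤ map e (𝓝 u) := by
    intro u hu s hs
    rw [mem_map] at hs
    obtain ⟨ε, hε, hs⟩ := Metric.mem_nhds_iff.1 hs
    have hdu := (h.dist_le u).trans_lt hu
    have huρ : ‖u‖ < ρ := by
      obtain ⟨u', hu', he⟩ := hsub (Metric.mem_ball.2 hdu)
      rw [← h.injective_exp he]
      simpa using hu'
    refine Metric.mem_nhds_iff.2 ⟨min (δ - dist (e u) 1) (ε / 2), by simp [hdu, hε], fun x hx => ?_⟩
    rw [Metric.mem_ball, lt_min_iff] at hx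
    have hx1 : x ∈ Metric.ball (1 : P) δ := by
      rw [Metric.mem_ball]
      linarith [dist_triangle x (e u) 1]
    obtain ⟨u', hu', rfl⟩ := hsub hx1
    refine hs ?_
    have := (hb u' u (by simpa using hu') huρ).1
    rw [Metric.mem_ball, dist_eq_norm]
    linarith
  -- Openness at an arbitrary v is the local statement at its contracted image, conjugated by the
  -- flow.
  rw [isOpenMap_iff_nhds_le]
  intro v
  obtain ⟨t, h1⟩ := ((tendsto_diagFlow_neg b w h.weight_pos v).eventually
    (Metric.ball_mem_nhds (0 : V) hδ)).exists
  rw [dist_zero_right] at h1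
  intro s hs
  have hs2 : (c t) ⁻¹' s ∈ map e (𝓝 (diagFlow b w (-t) v)) := by
    rw [mem_map, ← preimage_comp]
    have h3 : Tendsto (diagFlow b w t) (𝓝 (diagFlow b w (-t) v)) (𝓝 v) := by
      have := (diagFlow b w t).continuous.tendsto (diagFlow b w (-t) v)
      rwa [diagFlow_apply_neg] at this
    have h4 : (c t) ∘ e = e ∘ diagFlow b w t := funext fun u => h.map_exp t u
    rw [h4, preimage_comp]
    exact h3 (mem_map.1 hs)
  have h5 := hloc _ h1 hs2
  have h6 : c (-t) ⁻¹' (c t ⁻¹' s) = s := by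
    ext x; simp [h.map_map_neg]
  rw [← h6]
  have h7 : c (-t) (e v) = e (diagFlow b w (-t) v) := h.map_exp _ _
  exact (h.continuous (-t)).continuousAt.preimage_mem_nhds (by rw [h7]; exact h5)

end IsExpandingExp

end Contraction

/-! ### The group law in logarithmic coordinates. -/

section LogMul

variable {E : Type*} [NormedAddCommGroup E] [NormedSpace ℝ E] [FiniteDimensional ℝ E]
  {G : Type*} [Group G] [MetricSpace G] [ChartedSpace E G] [LieGroup 𝓘(ℝ, E) ∞ G]
  [Bundle.RiemannianBundle (fun x : G => TangentSpace 𝓘(ℝ, E) x)]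
  [IsContMDiffRiemannianBundle 𝓘(ℝ, E) ∞ E (fun x : G => TangentSpace 𝓘(ℝ, E) x)]
  [IsRiemannianManifold 𝓘(ℝ, E) G]

/-- The multiplication in exponential coordinates is tangent to the addition at `0`. -/
lemma hasStrictFDerivAt_log_mul (hG : IsRightInvariant E G) {lg : G → LieAlg E G}
    (hc : Tendsto lg (𝓝 1) (𝓝 0)) (hlg : ∀ᶠ g in 𝓝 1, gexp (lg g) = g) :
    HasStrictFDerivAt (fun q : LieAlg E G × LieAlg E G => lg (gexp q.1 * gexp q.2))
      (ContinuousLinearMap.fst ℝ (LieAlg E G) (LieAlg E G) + ContinuousLinearMap.snd ℝ _ _) 0 := by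
  have hL := hasStrictFDerivAt_lieChart_gexp (E := E) (G := G) hG
  set F : LieAlg E G → LieAlg E G := fun v => lieChart E G (gexp v) with hF
  have hF0 : F 0 = 0 := by simp [hF, gexp_zero]
  have : IsTopologicalGroup G := topologicalGroup_of_lieGroup 𝓘(ℝ, E) ∞
  have hL' : HasStrictFDerivAt F (ContinuousLinearEquiv.refl ℝ (LieAlg E G) : LieAlg E G →L[ℝ] LieAlg E G) 0 := hL
  -- Near the origin the logarithm is the local inverse of F after the chart. The product is
  -- therefore F⁻¹ ∘ `mulChart` ∘ (F × F), and its strict derivative follows from the chain rule.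
  have hinv : ∀ y, y = 0 → HasStrictFDerivAt (hL'.localInverse F _ _)
      ((ContinuousLinearEquiv.refl ℝ (LieAlg E G)).symm : LieAlg E G →L[ℝ] LieAlg E G) y := by
    rintro y rfl
    simpa [hF0] using hL'.to_localInverse
  have h1 : HasStrictFDerivAt (fun q : LieAlg E G × LieAlg E G => F q.1)
      ((ContinuousLinearMap.id ℝ (LieAlg E G)).comp (ContinuousLinearMap.fst ℝ _ _)) 0 :=
    HasStrictFDerivAt.comp (g := F) 0 hL hasStrictFDerivAt_fst
  have h2 : HasStrictFDerivAt (fun q : LieAlg E G × LieAlg E G => F q.2)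
      ((ContinuousLinearMap.id ℝ (LieAlg E G)).comp (ContinuousLinearMap.snd ℝ _ _)) 0 :=
    HasStrictFDerivAt.comp (g := F) 0 hL hasStrictFDerivAt_snd
  have h3 := h1.prodMk h2
  have h5 : ∀ q : LieAlg E G × LieAlg E G, q = 0 → HasStrictFDerivAt (mulChart E G)
      (ContinuousLinearMap.fst ℝ (LieAlg E G) (LieAlg E G) + ContinuousLinearMap.snd ℝ _ _) q := by
    rintro q rfl; exact hasStrictFDerivAt_mulChart
  have h4 := (h5 (F (0 : LieAlg E G × LieAlg E G).1, F (0 : LieAlg E G × LieAlg E G).2)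
    (by simp [hF0])).comp (0 : LieAlg E G × LieAlg E G) h3
  have hm0 : mulChart E G (F (0 : LieAlg E G × LieAlg E G).1, F (0 : LieAlg E G × LieAlg E G).2) = 0 := by
    simp [hF0, mulChart]
  have h6 := HasStrictFDerivAt.comp (0 : LieAlg E G × LieAlg E G) (hinv _ hm0) h4
  have h7 := h6.congr_fderiv (f' := ContinuousLinearMap.fst ℝ (LieAlg E G) (LieAlg E G) +
    ContinuousLinearMap.snd ℝ _ _) (ContinuousLinearMap.ext fun _ => rfl)
  refine h7.congr_of_eventuallyEq ?_
  have ht := tendsto_gexp_zero (E := E) (G := G) hG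
  have t1 : Tendsto (fun q : LieAlg E G × LieAlg E G => (gexp q.1 : G)) (𝓝 0) (𝓝 1) :=
    ht.comp (continuous_fst.tendsto' 0 0 rfl)
  have t2 : Tendsto (fun q : LieAlg E G × LieAlg E G => (gexp q.2 : G)) (𝓝 0) (𝓝 1) :=
    ht.comp (continuous_snd.tendsto' 0 0 rfl)
  have t3 : Tendsto (fun q : LieAlg E G × LieAlg E G => (gexp q.1 * gexp q.2 : G)) (𝓝 0) (𝓝 1) := by
    simpa using t1.mul t2
  have e1 := t1.eventually (eventually_lieChartInv_lieChart (E := E))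
  have e2 := t2.eventually (eventually_lieChartInv_lieChart (E := E))
  have e3 := t3.eventually hlg
  have e4 := (hc.comp t3).eventually hL'.eventually_left_inverse
  filter_upwards [e1, e2, e3, e4] with q hq1 hq2 hq3 hq4
  simp only [hF, mulChart, Function.comp_apply] at hq1 hq2 hq3 hq4 ⊢
  rw [hq1, hq2]
  rw [hq3] at hq4
  exact hq4

end LogMul

section Trace

lemma trace_eq_sum_of_basis {V : Type*} [AddCommGroup V] [Module ℝ V] {n : ℕ}
    (b : Module.Basis (Fin n) ℝ V) {w : Fin n → ℝ} {f : V →ₗ[ℝ] V} (h : ∀ i, f (b i) = w i • b i) :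
    LinearMap.trace ℝ V f = ∑ i, w i := by
  rw [LinearMap.trace_eq_matrix_trace ℝ b, Matrix.trace]
  refine Finset.sum_congr rfl fun i _ => ?_
  simp [LinearMap.toMatrix_apply, h]

end Trace

/-! ### The action of F on P by conjugation. -/

section Subgroup

variable {E : Type*} [NormedAddCommGroup E] [NormedSpace ℝ E] [FiniteDimensional ℝ E]
  {G : Type*} [Group G] [MetricSpace G] [ChartedSpace E G] [LieGroup 𝓘(ℝ, E) ∞ G]
  [Bundle.RiemannianBundle (fun x : G => TangentSpace 𝓘(ℝ, E) x)]
  [IsContMDiffRiemannianBundle 𝓘(ℝ, E) ∞ E (fun x : G => TangentSpace 𝓘(ℝ, E) x)]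
  [IsRiemannianManifold 𝓘(ℝ, E) G]
  {E' : Type*} [NormedAddCommGroup E'] [NormedSpace ℝ E'] [FiniteDimensional ℝ E']
  {P : Type*} [Group P] [MetricSpace P] [ChartedSpace E' P] [LieGroup 𝓘(ℝ, E') ∞ P]
  [ConnectedSpace P]
  [Bundle.RiemannianBundle (fun x : P => TangentSpace 𝓘(ℝ, E') x)]
  [IsContMDiffRiemannianBundle 𝓘(ℝ, E') ∞ E' (fun x : P => TangentSpace 𝓘(ℝ, E') x)]
  [IsRiemannianManifold 𝓘(ℝ, E') P]
  {ι : P →* G} {g : ℝ → G}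

/-- `ι` intertwines right translation by h with right translation by `ι h` and preserves norms of
tangent vectors. -/
lemma IsRiemannianLieSubgroup.isRightInvariant (hι : IsRiemannianLieSubgroup E E' ι)
    (hG : IsRightInvariant E G) : IsRightInvariant E' P := by
  intro x h v
  have hd : MDifferentiable 𝓘(ℝ, E') 𝓘(ℝ, E) ι := hι.contMDiff.mdifferentiable (by simp)
  have h1 := mfderiv_comp x (hd (x * h)) (mdifferentiable_mul_right (E := E') h x)
  have h2 := mfderiv_comp x (mdifferentiable_mul_right (E := E) (ι h) (ι x)) (hd x)
  have h3 : (ι ∘ fun y => y * h) = (fun y => y * ι h) ∘ ι := by ext; simp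
  have key : ∀ f₁ f₂ : P → G, f₁ = f₂ → ‖mfderiv 𝓘(ℝ, E') 𝓘(ℝ, E) f₁ x v‖ =
      ‖mfderiv 𝓘(ℝ, E') 𝓘(ℝ, E) f₂ x v‖ := by rintro _ _ rfl; rfl
  have h4 := key _ _ h3
  rw [h1, h2] at h4
  calc _ = ‖mfderiv 𝓘(ℝ, E') 𝓘(ℝ, E) ι (x * h) (mfderiv 𝓘(ℝ, E') 𝓘(ℝ, E') (fun y => y * h) x v)‖ :=
        (hι.norm_mfderiv _ _).symm
    _ = ‖mfderiv 𝓘(ℝ, E) 𝓘(ℝ, E) (fun y => y * ι h) (ι x) (mfderiv 𝓘(ℝ, E') 𝓘(ℝ, E) ι x v)‖ := h4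
    _ = _ := by rw [hG, hι.norm_mfderiv]

lemma IsRiemannianLieSubgroup.dist_map_le (hι : IsRiemannianLieSubgroup E E' ι) (x y : P) :
    dist (ι x) (ι y) ≤ dist x y := by
  have := edist_map_le_of_norm_mfderiv_le (f := ι) (E := E') (F := E)
    (hι.contMDiff.of_le (by exact_mod_cast le_top)) (fun x v => (hι.norm_mfderiv x v).le) x y
  rw [edist_dist, edist_dist] at this
  exact (ENNReal.ofReal_le_ofReal_iff dist_nonneg).1 this

lemma IsRiemannianLieSubgroup.injective_lieIncl (hι : IsRiemannianLieSubgroup E E' ι) :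
    Function.Injective (lieIncl E E' ι) := by
  rw [injective_iff_map_eq_zero]
  intro v hv
  have h1 := hι.norm_mfderiv 1 v
  have h2 : mfderiv 𝓘(ℝ, E') 𝓘(ℝ, E) ι (1 : P) v = 0 := hv
  rw [h2, norm_zero] at h1
  exact norm_eq_zero.1 h1.symm

lemma hasMFDerivAt_lieIncl (hι : IsRiemannianLieSubgroup E E' ι) :
    HasMFDerivAt 𝓘(ℝ, E') 𝓘(ℝ, E) ι 1 (show E' →L[ℝ] E from lieIncl E E' ι) :=
  (hι.contMDiff.mdifferentiable (by simp) 1).hasMFDerivAt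

lemma IsOneParameter.map_zero (hg : IsOneParameter g) : g 0 = 1 := by
  simpa using hg.map_add 0 0

lemma IsOneParameter.map_neg (hg : IsOneParameter g) (t : ℝ) : g (-t) = (g t)⁻¹ := by
  have := hg.map_add (-t) t
  rw [neg_add_cancel, hg.map_zero] at this
  exact eq_inv_of_mul_eq_one_left this.symm

variable [LocallyCompactSpace P]

/-- The automorphisms of `P` induced by conjugation with the elements of `F`. -/
lemma exists_conj_hom (hg : IsOneParameter g) (hι : IsRiemannianLieSubgroup E E' ι)
    (hPF : ∀ (t : ℝ) (h : P), g t * ι h * (g t)⁻¹ ∈ ι.range) :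
    ∃ c : ℝ → P →* P, (∀ t h, ι (c t h) = g t * ι h * (g t)⁻¹) ∧ (∀ t, Continuous (c t)) ∧
      (∀ s t h, c (s + t) h = c s (c t h)) ∧ (∀ h, c 0 h = h) := by
  choose c hc using hPF
  have : IsTopologicalGroup P := topologicalGroup_of_lieGroup 𝓘(ℝ, E') ∞
  have : IsTopologicalGroup G := topologicalGroup_of_lieGroup 𝓘(ℝ, E) ∞
  have := (secondCountableTopology_of_connected_group (P := P)).1
  refine ⟨fun t => MonoidHom.mk' (c t) fun x y => ?_, hc, fun t => ?_, fun s t h => ?_, fun h => ?_⟩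
  · apply hι.injective
    rw [map_mul, hc, hc, hc, map_mul]; group
  · refine continuous_of_continuous_comp_injective hι.contMDiff.continuous hι.injective ?_
    simp only [MonoidHom.mk'_apply, hc]
    exact (continuous_const.mul hι.contMDiff.continuous).mul continuous_const
  · apply hι.injective
    simp only [MonoidHom.mk'_apply, hc, hg.map_add]; group
  · apply hι.injective
    simp only [MonoidHom.mk'_apply, hc, hg.map_zero]; group

lemma exists_derivative_conj_hom (hι : IsRiemannianLieSubgroup E E' ι) {c : P →* P} (hcc : Continuous c)
    {k : G} (hc : ∀ h, ι (c h) = k * ι h * k⁻¹) :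
    ∃ A : E' →L[ℝ] E', (∀ v : E', c (lieExp E' (show TangentSpace 𝓘(ℝ, E') (1 : P) from v)) =
      lieExp E' (show TangentSpace 𝓘(ℝ, E') (1 : P) from A v)) ∧
      ∀ v : E', (lieIncl E E' ι : E' →L[ℝ] E) (A v) = (Ad E k : E →L[ℝ] E) ((lieIncl E E' ι : E' →L[ℝ] E) v) := by
  have hι' := hasMFDerivAt_lieIncl hι
  have h1 : HasMFDerivAt 𝓘(ℝ, E) 𝓘(ℝ, E) (fun x : G => k * x * k⁻¹) (ι 1)
    (show E →L[ℝ] E from Ad E k) := by rw [map_one]; exact hasMFDerivAt_conj k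
  have h2 : HasMFDerivAt 𝓘(ℝ, E') 𝓘(ℝ, E) (fun h => ι (c h)) 1
      ((Ad E k : E →L[ℝ] E).comp (lieIncl E E' ι : E' →L[ℝ] E)) := by
    have h3 : (fun h => ι (c h)) = (fun x : G => k * x * k⁻¹) ∘ ι := funext hc
    rw [h3]
    exact h1.comp (1 : P) hι'
  obtain ⟨A, hA⟩ := exists_hasMFDerivAt_one_of_comp (map_one ι) hι.contMDiff hι' hι.injective_lieIncl
    (f := c) (map_one c) hcc.continuousAt h2
  refine ⟨A, map_lieExp c hA, fun v => ?_⟩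
  have h3 : HasMFDerivAt 𝓘(ℝ, E') 𝓘(ℝ, E) ι (c 1) (show E' →L[ℝ] E from lieIncl E E' ι) := by
    rw [map_one]; exact hι'
  have h4 := hasMFDerivAt_unique (h3.comp (1 : P) hA) h2
  exact congrArg (fun L : E' →L[ℝ] E => L v) h4

/-- For w = 0 the curve is constant. For w < 0 the factor e^{tw} tends to ∞ as t → −∞, so exp(τv) →
1 as τ → ∞; comparing τ with τ + s forces exp(sv) = 1. -/
lemma lieExp_eq_one_of_tendsto {v : TangentSpace 𝓘(ℝ, E) (1 : G)} {w : ℝ} (hw : w ≤ 0)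
    (h : ∀ s : ℝ, Tendsto (fun t => (lieExp E ((Real.exp (t * w) * s) • v) : G)) atBot (𝓝 1)) (s : ℝ) :
    (lieExp E (s • v) : G) = 1 := by
  rcases hw.eq_or_lt with rfl | hw
  · exact (tendsto_nhds_unique (h s) (by simp : Tendsto _ _ (𝓝 (lieExp E (s • v))))).symm
  · have : IsTopologicalGroup G := topologicalGroup_of_lieGroup 𝓘(ℝ, E) ∞
    have h1 : Tendsto (fun τ : ℝ => (lieExp E (τ • v) : G)) atTop (𝓝 1) := by
      have h2 : Tendsto (fun τ : ℝ => Real.log τ / w) atTop atBot :=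
        Real.tendsto_log_atTop.atTop_div_const_of_neg hw
      have h3 := (h 1).comp h2
      refine h3.congr' ?_
      filter_upwards [eventually_gt_atTop 0] with τ hτ
      simp [div_mul_cancel₀ _ hw.ne, Real.exp_log hτ]
    have h2 : Tendsto (fun τ : ℝ => (lieExp E ((τ + s) • v) : G)) atTop (𝓝 1) :=
      h1.comp (tendsto_atTop_add_const_right _ s tendsto_id)
    have h3 : Tendsto (fun τ : ℝ => (lieExp E ((τ + s) • v) : G)) atTop (𝓝 (1 * lieExp E (s • v))) := by
      simp_rw [lieExp_add_smul]
      exact h1.mul_const _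
    simpa using tendsto_nhds_unique h3 h2

variable (E) in
/-- The inclusion of Lie algebras, on the Lie algebra with its norm. -/
noncomputable def lieInclLin (ι : P →* G) : LieAlg E' P →ₗ[ℝ] E where
  toFun v := (lieIncl E E' ι : E' →L[ℝ] E) v
  map_add' v w := (lieIncl E E' ι : E' →L[ℝ] E).map_add v w
  map_smul' a v := (lieIncl E E' ι : E' →L[ℝ] E).map_smul a v

/-- The exponential map of `P` and the action of `F` on `P` by conjugation. -/
theorem exists_isExpandingExp (hG : IsRightInvariant E G) (hg : IsOneParameter g)
    (hgd : IsAdDiagonalizable E g) (hι : IsRiemannianLieSubgroup E E' ι)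
    (hPH : ∀ h : P, ι h ∈ unstableHorospherical g)
    (hPF : ∀ (t : ℝ) (h : P), g t * ι h * (g t)⁻¹ ∈ ι.range) :
    ∃ (c : ℝ → P →* P) (b : Module.Basis (Fin (Module.finrank ℝ (LieAlg E' P))) ℝ (LieAlg E' P))
      (w : Fin (Module.finrank ℝ (LieAlg E' P)) → ℝ), IsExpandingExp (gexp : LieAlg E' P → P) c b w ∧
        Monotone w ∧ (∀ t h, ι (c t h) = g t * ι h * (g t)⁻¹) ∧ deltaTr E E' ι g = ∑ i, w i := by
  have hP := hι.isRightInvariant hG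
  obtain ⟨c, hc, hcc, hca, hc0⟩ := exists_conj_hom hg hι hPF
  choose A hAe hAL using fun t => exists_derivative_conj_hom hι (hcc t) (hc t)
  obtain ⟨n, B, a, hB⟩ := hgd
  set T : ℝ → E →L[ℝ] E := fun t => Ad E (g t) with hT
  set B' : Module.Basis (Fin n) ℝ E := B with hB'
  have hTB : ∀ t i, T t (B' i) = Real.exp (t * a i) • B' i := hB
  obtain ⟨D, hD, hDB⟩ := hasDerivAt_of_diagonal B' hTB
  have hDa : (adGen E g : E →L[ℝ] E) = D := hD.deriv
  have hLi : Function.Injective (lieInclLin E (E' := E') ι) := hι.injective_lieIncl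
  have hAL' : ∀ t (v : LieAlg E' P), lieInclLin E ι (show LieAlg E' P from A t v) = T t (lieInclLin E ι v) := hAL
  obtain ⟨b, w, hwm, hbw⟩ := exists_eigenbasis_of_diagonal B' hTB hDB hLi
    (fun v => ⟨(show LieAlg E' P from A 1 v), (hAL' 1 v).symm⟩)
  set A' : ℝ → LieAlg E' P →ₗ[ℝ] LieAlg E' P := fun t =>
    { toFun := fun v => A t v
      map_add' := fun v w => (A t).map_add v w
      map_smul' := fun r v => (A t).map_smul r v } with hA'
  have hAd : ∀ t (v : LieAlg E' P), A' t v = diagFlow b w t v := fun t v =>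
    eq_diagFlow b w (A := A' t) (fun i => by
      apply hLi
      rw [map_smul, ← (hbw i).1 t]
      exact hAL' t (b i)) v
  have hexp : ∀ t v, c t (gexp v) = gexp (diagFlow b w t v) := fun t v =>
    (hAe t v).trans (congrArg gexp (hAd t v))
  have hιexp : ∀ v : LieAlg E' P, ι (gexp v) =
      lieExp E (show TangentSpace 𝓘(ℝ, E) (1 : G) from lieInclLin E ι v) := fun v =>
    map_lieExp ι (hasMFDerivAt_lieIncl hι) v
  refine ⟨c, b, w, ⟨gexp_add_smul, dist_gexp_one_le hP, dist_mul_right_of_isRightInvariant hP,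
    exists_gexp_biLipschitz hP, map_gexp_nhds_zero hP, hexp, hca, hc0, hcc, fun i => ?_⟩, hwm, hc, ?_⟩
  -- Containment of `P` in the expanding horospherical subgroup enters here: a nonpositive weight
  -- would make the one-parameter subgroup of `b i` trivial.
  · by_contra! hwi
    set v : TangentSpace 𝓘(ℝ, E) (1 : G) := (show TangentSpace 𝓘(ℝ, E) (1 : G) from lieInclLin E ι (b i)) with hv
    have h1 := lieExp_eq_one_of_tendsto (E := E) (G := G) (v := v) hwi fun s => by
      have h2 := hPH (gexp (s • b i))
      refine Tendsto.congr (fun t => ?_) h2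
      rw [hg.map_neg, ← hc, hexp, hιexp, map_smul, diagFlow_basis, smul_smul, mul_comm, map_smul]
      rfl
    have h3 : v = 0 := by
      refine eq_of_lieExp_smul_eq (G := G) fun s => ?_
      rw [h1, smul_zero, lieExp_zero]
    exact b.ne_zero i (hLi (h3.trans (map_zero (lieInclLin E (E' := E') ι)).symm))
  · refine trace_eq_sum_of_basis (V := LieAlg E' P) b (f := adOn E E' ι g) fun i => ?_
    have h1 : (adGen E g : E →L[ℝ] E) (lieInclLin E ι (b i)) = lieInclLin E ι (w i • b i) := by
      rw [map_smul, hDa]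
      exact (hbw i).2
    have h2 := LinearMap.leftInverse_apply_of_inj (LinearMap.ker_eq_bot.2 hι.injective_lieIncl :
      LinearMap.ker (lieIncl E E' ι : TangentSpace 𝓘(ℝ, E') (1 : P) →ₗ[ℝ] TangentSpace 𝓘(ℝ, E) (1 : G)) = ⊥)
      (show TangentSpace 𝓘(ℝ, E') (1 : P) from w i • b i)
    exact (congrArg (fun u : TangentSpace 𝓘(ℝ, E) (1 : G) =>
      (lieIncl E E' ι : TangentSpace 𝓘(ℝ, E') (1 : P) →ₗ[ℝ] TangentSpace 𝓘(ℝ, E) (1 : G)).leftInverse u) h1).trans h2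

end Subgroup

/-! ### Unimodularity and exact scaling of Haar measure. -/

lemma eq_one_of_pow_bounded {q M : ℝ} (hq : 0 < q) (h1 : ∀ n : ℕ, q ^ n ≤ M) (h2 : ∀ n : ℕ, (q⁻¹) ^ n ≤ M) :
    q = 1 := by
  have key : ∀ x : ℝ, (∀ n : ℕ, x ^ n ≤ M) → x ≤ 1 := by
    intro x hx
    by_contra! hc
    obtain ⟨n, hn⟩ := pow_unbounded_of_one_lt M hc
    exact absurd (hx n) (not_le.2 hn)
  refine le_antisymm (key q h1) ?_
  have := key _ h2
  rwa [inv_le_one₀ hq] at this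

namespace IsExpandingExp

open Measure

variable {V : Type*} [NormedAddCommGroup V] [InnerProductSpace ℝ V] [FiniteDimensional ℝ V]
  {P : Type*} [Group P] [MetricSpace P] [IsTopologicalGroup P] [ConnectedSpace P] [LocallyCompactSpace P]
  {n : ℕ} {e : V → P} {c : ℝ → P →* P} {b : Module.Basis (Fin n) ℝ V} {w : Fin n → ℝ}
  (h : IsExpandingExp e c b w)

/-- The automorphisms `c t` as isomorphisms of topological groups. -/
def continuousMulEquiv (t : ℝ) : P ≃ₜ* P where
  toFun := c t
  invFun := c (-t)
  left_inv := h.map_neg_map t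
  right_inv := h.map_map_neg t
  map_mul' := (c t).map_mul
  continuous_toFun := h.continuous t
  continuous_invFun := h.continuous (-t)

@[simp] lemma continuousMulEquiv_apply (t : ℝ) (x : P) : h.continuousMulEquiv t x = c t x := rfl

include h

lemma image_eq_preimage (t : ℝ) (A : Set P) : c t '' A = c (-t) ⁻¹' A := by
  ext x
  refine ⟨?_, fun hx => ⟨c (-t) x, hx, h.map_map_neg t x⟩⟩
  rintro ⟨y, hy, rfl⟩
  rwa [mem_preimage, h.map_neg_map]

variable [SecondCountableTopology P] [MeasurableSpace P] [BorelSpace P] (ν : Measure P) [ν.IsHaarMeasure]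

/-- The image of a Haar measure under an automorphism is again a Haar measure, and the modular
function does not depend on the choice of Haar measure. -/
lemma modularCharacterFun_map (t : ℝ) (γ : P) : modularCharacterFun (c t γ) = modularCharacterFun γ := by
  set φ := h.continuousMulEquiv t
  let ν : Measure P := haar
  have hφ : Measurable φ := φ.continuous.measurable
  have : (ν.map φ).IsHaarMeasure := φ.isHaarMeasure_map ν
  have h1 := map_right_mul_eq_modularCharacterFun_smul (ν.map φ) (c t γ)
  have h2 := map_right_mul_eq_modularCharacterFun_smul ν γ
  have h3 : (ν.map φ).map (· * c t γ) = (ν.map (· * γ)).map φ := by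
    rw [Measure.map_map (by fun_prop) hφ, Measure.map_map hφ (by fun_prop)]
    congr 1
    ext x
    exact ((c t).map_mul x γ).symm
  rw [h3, h2, Measure.map_smul] at h1
  obtain ⟨K, hK, hK1⟩ := exists_compact_mem_nhds (1 : P)
  have h4 := congrArg (fun m : Measure P => m K) h1
  simp only [Measure.smul_apply] at h4
  have h5 : (ν.map φ) K ≠ 0 := (measure_pos_of_mem_nhds _ hK1).ne'
  have h6 : (ν.map φ) K ≠ ⊤ := hK.measure_lt_top.ne
  have h7 : ((modularCharacterFun γ : NNReal) : ENNReal) * (ν.map φ) K = (modularCharacterFun (c t γ) : NNReal) * (ν.map φ) K := h4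
  have := (ENNReal.mul_left_inj h5 h6).1 h7
  exact_mod_cast this.symm

/-- The modular function is bounded near 1. It is invariant under c_{-t}, which brings every point
near 1, hence bounded on all of `P`; a bounded homomorphism to the positive reals is trivial. -/
lemma modularCharacterFun_eq_one (γ : P) : modularCharacterFun γ = 1 := by
  let ν : Measure P := haar
  obtain ⟨K, hK, hK1⟩ := exists_compact_mem_nhds (1 : P)
  obtain ⟨U, hU, hUK⟩ : ∃ U ∈ 𝓝 (1 : P), ∀ x ∈ U, ∀ y ∈ U, x * y ∈ K := by
    have h1 : Tendsto (fun q : P × P => q.1 * q.2) (𝓝 1 ×ˢ 𝓝 1) (𝓝 1) := by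
      have := (continuous_mul (M := P)).tendsto (1, 1)
      rwa [mul_one, nhds_prod_eq] at this
    obtain ⟨U, hU, U', hU', hs⟩ := Filter.mem_prod_iff.1 (h1 hK1)
    exact ⟨U ∩ U', inter_mem hU hU', fun x hx y hy => hs (⟨hx.1, hy.2⟩ : (x, y) ∈ U ×ˢ U')⟩
  have hU0 : ν U ≠ 0 := (measure_pos_of_mem_nhds _ hU).ne'
  have hUt : ν U ≠ ⊤ := by
    refine ((measure_mono fun x hx => ?_).trans_lt hK.measure_lt_top).ne
    simpa using hUK x hx 1 (mem_of_mem_nhds hU)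
  set M : ℝ := (ν K / ν U).toReal with hM
  have hfin : ν K / ν U ≠ ⊤ := ENNReal.div_ne_top hK.measure_lt_top.ne hU0
  have hb : ∀ γ : P, γ⁻¹ ∈ U → (modularCharacterFun γ : ℝ) ≤ M := by
    intro γ hγ
    have h2 := congrArg (fun m : Measure P => m U) (map_right_mul_eq_modularCharacterFun_smul ν γ)
    have h3 : (ν.map (· * γ)) U ≤ ν K := by
      have : ν.map (· * γ) U = ν ((· * γ) ⁻¹' U) :=
        (Homeomorph.mulRight γ).toMeasurableEquiv.map_apply U
      rw [this]
      refine measure_mono fun x hx => ?_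
      simpa using hUK _ hx _ hγ
    have h4 : (modularCharacterFun γ : NNReal) * ν U ≤ ν K := h2.symm.trans_le h3
    have h5 := ENNReal.toReal_mono hfin ((ENNReal.le_div_iff_mul_le (Or.inl hU0) (Or.inl hUt)).2 h4)
    rw [hM]; simpa using h5
  have hb2 : ∀ γ : P, (modularCharacterFun γ : ℝ) ≤ M := by
    intro γ
    obtain ⟨t, ht⟩ := ((h.tendsto_map_neg γ⁻¹).eventually hU).exists
    rw [← h.modularCharacterFun_map (-t)]
    have ht' : c (-t) γ⁻¹ ∈ U := ht
    exact hb _ (by rwa [map_inv] at ht')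
  have hpow : ∀ (γ : P) (n : ℕ), (modularCharacterFun γ : ℝ) ^ n ≤ M := by
    intro γ n
    have : modularCharacterFun (γ ^ n) = modularCharacterFun γ ^ n := map_pow (modularCharacter (G := P)) γ n
    rw [← NNReal.coe_pow, ← this]
    exact hb2 _
  have := eq_one_of_pow_bounded (q := modularCharacterFun γ) (by exact_mod_cast modularCharacterFun_pos γ)
    (hpow γ) (fun n => by
      have h1 : modularCharacterFun γ⁻¹ = (modularCharacterFun γ)⁻¹ := map_inv (modularCharacter (G := P)) γ
      rw [← NNReal.coe_inv, ← h1]; exact hpow _ n)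
  exact_mod_cast this

/-- A group with a contracting flow of automorphisms is unimodular. -/
theorem isMulRightInvariant : ν.IsMulRightInvariant :=
  ⟨fun γ => by rw [map_right_mul_eq_modularCharacterFun_smul, h.modularCharacterFun_eq_one, one_smul]⟩

lemma measure_image_map_eq (t : ℝ) (A : Set P) :
    ν (c t '' A) = mulEquivHaarChar (h.continuousMulEquiv t) * ν A := by
  have h1 := mulEquivHaarChar_smul_preimage ν (X := c t '' A) (h.continuousMulEquiv t)
  rw [← h1]
  congr 2
  ext x
  have : Function.Injective (c t) := (h.continuousMulEquiv t).injective
  simp [this.eq_iff]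

/-- The automorphisms `c t` multiply the Haar measure by `exp (t * ∑ w i)`. -/
theorem measure_image_map (t : ℝ) (A : Set P) :
    ν (c t '' A) = ENNReal.ofReal (Real.exp (t * ∑ i, w i)) * ν A := by
  borelize V
  set J : ℝ → ℝ := fun t => mulEquivHaarChar (h.continuousMulEquiv t) with hJ
  have hJpos : ∀ t, 0 < J t := fun t => mulEquivHaarChar_pos _
  have hJadd : ∀ s t, J (s + t) = J s * J t := by
    intro s t
    have : h.continuousMulEquiv (s + t) = (h.continuousMulEquiv t).trans (h.continuousMulEquiv s) := by
      ext x; exact h.flow_add s t x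
    simp only [hJ]
    rw [this, mulEquivHaarChar_trans]
    push_cast; ring
  have hJ0 : J 0 = 1 := by
    have := hJadd 0 0
    rw [add_zero] at this
    exact (mul_eq_left₀ (hJpos 0).ne').1 this.symm
  obtain ⟨ρ, hρ, hb⟩ := h.exists_biLip
  obtain ⟨k, K, hk0, hkt, hK0, hKt, hcomp⟩ := exists_haar_image_comparison ν h.dist_mul_right hb hρ
    h.exp_zero h.exp_neg (h.image_ball_mem_nhds hρ)
  obtain ⟨C, hC, κ, hκ, hcon⟩ := exists_norm_diagFlow_neg_le b w h.weight_pos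
  -- The radius is chosen so that all backward images of B stay in the bi-Lipschitz ball.
  set B : Set V := Metric.ball 0 (min ρ (ρ / C)) with hB
  have hBρ : B ⊆ Metric.ball 0 ρ := Metric.ball_subset_ball (min_le_left _ _)
  have hB0 : volume B ≠ 0 := (Metric.measure_ball_pos _ _ (by positivity)).ne'
  have hBt : volume B ≠ ⊤ := measure_ball_lt_top.ne
  -- On B and on its backward images, Haar and Lebesgue measure agree up to fixed factors, and
  -- Lebesgue measure scales by the determinant. So J(−t) e^{t Σ w} is bounded above and below
  -- uniformly in t ≥ 0.
  have hq : ∀ t, 0 ≤ t →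
      J (-t) * Real.exp (t * ∑ i, w i) ≤ (K / k).toReal ∧
      (J (-t) * Real.exp (t * ∑ i, w i))⁻¹ ≤ (K / k).toReal := by
    intro t ht
    have hsub : diagFlow b w (-t) '' B ⊆ Metric.ball 0 ρ := by
      rintro _ ⟨v, hv, rfl⟩
      rw [mem_ball_zero_iff]
      rw [hB, mem_ball_zero_iff, lt_min_iff] at hv
      calc _ ≤ C * Real.exp (-κ * t) * ‖v‖ := hcon t ht v
        _ ≤ C * 1 * ‖v‖ := by
          gcongr
          rw [Real.exp_le_one_iff]; nlinarith
        _ < C * 1 * (ρ / C) := by gcongr; exact hv.2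
        _ = ρ := by field_simp
    have him : c (-t) '' (e '' B) = e '' (diagFlow b w (-t) '' B) := by
      rw [image_image, image_image]
      exact image_congr fun v _ => h.map_exp _ _
    have hvol : volume (diagFlow b w (-t) '' B) = ENNReal.ofReal (Real.exp (-(t * ∑ i, w i))) * volume B := by
      have := Measure.addHaar_image_linearMap (volume : Measure V) (diagFlow b w (-t) : V →ₗ[ℝ] V) B
      rw [det_diagFlow, Real.abs_exp, neg_mul] at this
      exact this
    have h1 := hcomp _ hsub
    have h2 := hcomp _ hBρ
    rw [← him, hvol, h.measure_image_map_eq] at h1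
    have hm : (ν (e '' B)) ≠ ⊤ := (h2.2.trans_lt (ENNReal.mul_lt_top hKt.lt_top hBt.lt_top)).ne
    have r1 := ENNReal.toReal_mono (ENNReal.mul_ne_top (by simp) hm) h1.1
    have r2 := ENNReal.toReal_mono (ENNReal.mul_ne_top hKt (ENNReal.mul_ne_top (by simp) hBt)) h1.2
    have r3 := ENNReal.toReal_mono hm h2.1
    have r4 := ENNReal.toReal_mono (ENNReal.mul_ne_top hKt hBt) h2.2
    simp only [ENNReal.toReal_mul, ENNReal.coe_toReal] at r1 r2 r3 r4
    rw [ENNReal.toReal_ofReal (Real.exp_pos _).le] at r1 r2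
    have e1 : Real.exp (-(t * ∑ i, w i)) * Real.exp (t * ∑ i, w i) = 1 := by
      rw [← Real.exp_add, neg_add_cancel, Real.exp_zero]
    have p1 := ENNReal.toReal_pos hB0 hBt
    have p2 := ENNReal.toReal_pos hk0 hkt
    have p3 := ENNReal.toReal_pos hK0 hKt
    have p4 := hJpos (-t)
    have p5 := Real.exp_pos (t * ∑ i, w i)
    have hJ' : ((mulEquivHaarChar (h.continuousMulEquiv (-t)) : NNReal) : ℝ) = J (-t) := rfl
    rw [hJ'] at r1 r2
    rw [ENNReal.toReal_div]
    generalize Real.exp (-(t * ∑ i, w i)) = E1 at *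
    generalize Real.exp (t * ∑ i, w i) = E2 at *
    generalize (volume B).toReal = vB at *
    generalize (ν (e '' B)).toReal = mB at *
    generalize k.toReal = k' at *
    generalize K.toReal = K' at *
    generalize J (-t) = j at *
    have hE1 : E1 = E2⁻¹ := eq_inv_of_mul_eq_one_left e1
    subst hE1
    constructor
    · rw [le_div_iff₀ p2]
      have : j * (k' * vB) ≤ K' * (E2⁻¹ * vB) := (mul_le_mul_of_nonneg_left r3 p4.le).trans r2
      have h5 : (j * E2 * k') * vB ≤ K' * vB := by
        calc (j * E2 * k') * vB = (j * (k' * vB)) * E2 := by ring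
          _ ≤ (K' * (E2⁻¹ * vB)) * E2 := by gcongr
          _ = K' * vB := by field_simp
      exact le_of_mul_le_mul_right h5 p1
    · rw [inv_le_comm₀ (by positivity) (by positivity), inv_div, div_le_iff₀ p3]
      have : k' * (E2⁻¹ * vB) ≤ j * (K' * vB) := r1.trans (mul_le_mul_of_nonneg_left r4 p4.le)
      have h5 : k' * vB ≤ (j * E2 * K') * vB := by
        calc k' * vB = (k' * (E2⁻¹ * vB)) * E2 := by field_simp
          _ ≤ (j * (K' * vB)) * E2 := by gcongr
          _ = _ := by ring
      exact le_of_mul_le_mul_right h5 p1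
  have hpow : ∀ t (n : ℕ), (J (-t) * Real.exp (t * ∑ i, w i)) ^ n =
      J (-(n * t)) * Real.exp ((n * t) * ∑ i, w i) := by
    intro t n
    induction n with
    | zero => simp [hJ0]
    | succ n ih =>
      rw [pow_succ, ih]
      have h1 : (-(((n + 1 : ℕ) : ℝ) * t)) = -(n * t) + -t := by push_cast; ring
      have h2 : ((n + 1 : ℕ) : ℝ) * t * ∑ i, w i = n * t * ∑ i, w i + t * ∑ i, w i := by push_cast; ring
      rw [h1, h2, hJadd, Real.exp_add]; ring
  -- J is multiplicative, so the uniform bounds hold for all powers of the ratio; a positive number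
  -- whose powers and inverse powers are bounded equals 1.
  have hone : ∀ t, 0 ≤ t → J (-t) * Real.exp (t * ∑ i, w i) = 1 := by
    intro t ht
    refine eq_one_of_pow_bounded (M := (K / k).toReal) (mul_pos (hJpos _) (Real.exp_pos _))
      (fun n => ?_) (fun n => ?_)
    · rw [hpow]; exact (hq _ (by positivity)).1
    · rw [inv_pow, hpow]; exact (hq _ (by positivity)).2
  have hJeq : J t = Real.exp (t * ∑ i, w i) := by
    rcases le_total 0 t with ht | ht
    · have h1 := hone t ht
      have h2 : J (-t) * J t = 1 := by rw [← hJadd, neg_add_cancel, hJ0]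
      exact mul_left_cancel₀ (hJpos (-t)).ne' (h2.trans h1.symm)
    · have h1 := hone (-t) (by linarith)
      rw [neg_neg, neg_mul, Real.exp_neg] at h1
      field_simp at h1
      exact h1
  rw [h.measure_image_map_eq, ← hJeq, ENNReal.ofReal_coe_nnreal]

end IsExpandingExp

/-! ### Orthonormal bases adapted to a flag, and cubes. -/

section Flag

variable {V : Type*} [NormedAddCommGroup V] [InnerProductSpace ℝ V] [FiniteDimensional ℝ V] {n : ℕ}

open InnerProductSpace in
/-- Every flag has an adapted orthonormal basis. -/
lemma exists_orthonormalBasis_adapted (b : Module.Basis (Fin n) ℝ V) :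
    ∃ X : OrthonormalBasis (Fin n) ℝ V, ∀ (k : ℕ) (v : V),
      (∀ j : Fin n, j.val < k → b.repr v j = 0) ↔ ∀ j : Fin n, j.val < k → X.repr v j = 0 := by
  -- The vectors a_j represent the coordinate functionals of b. The conditions on the first k
  -- coordinates say that v is orthogonal to a_0, …, a_{k−1}, and Gram–Schmidt preserves the spans
  -- of initial segments.
  set a : Fin n → V := fun j => (toDual ℝ V).symm (LinearMap.toContinuousLinearMap (b.coord j)) with ha
  have hav : ∀ j v, inner ℝ (a j) v = b.repr v j := by
    intro j v
    simp [ha]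
  have hli : LinearIndependent ℝ a := by
    rw [Fintype.linearIndependent_iff]
    intro c hc i
    have h1 : inner ℝ (∑ j, c j • a j) (b i) = 0 := by rw [hc, inner_zero_left]
    rw [sum_inner] at h1
    simp only [inner_smul_left, hav, Module.Basis.repr_self, Finsupp.single_apply] at h1
    simpa using h1
  have hcard : Module.finrank ℝ V = Fintype.card (Fin n) := Module.finrank_eq_card_basis b
  set X := gramSchmidtOrthonormalBasis hcard a with hX
  have hXa : ∀ j, X j = gramSchmidtNormed ℝ a j := fun j => by
    refine gramSchmidtOrthonormalBasis_apply hcard ?_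
    intro h0
    have := gramSchmidtNormed_unit_length (𝕜 := ℝ) j hli
    rw [h0, norm_zero] at this
    exact zero_ne_one this
  have hperp : ∀ (s : Set (Fin n)) (f : Fin n → V) (v : V),
      (∀ j ∈ s, inner ℝ (f j) v = 0) ↔ ∀ u ∈ Submodule.span ℝ (f '' s), inner ℝ u v = 0 := by
    intro s f v
    refine ⟨fun h u hu => ?_, fun h j hj => h _ (Submodule.subset_span ⟨j, hj, rfl⟩)⟩
    induction hu using Submodule.span_induction with
    | mem u hu => obtain ⟨j, hj, rfl⟩ := hu; exact h j hj
    | zero => exact inner_zero_left _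
    | add x y _ _ hx hy => rw [inner_add_left, hx, hy, add_zero]
    | smul r x _ hx => rw [inner_smul_left, hx, mul_zero]
  refine ⟨X, fun k v => ?_⟩
  have hspan : Submodule.span ℝ (a '' {j | j.val < k}) = Submodule.span ℝ (X '' {j | j.val < k}) := by
    have h1 : (X : Fin n → V) = gramSchmidtNormed ℝ a := funext hXa
    rw [h1, span_gramSchmidtNormed]
    by_cases hk : k < n
    · have : {j : Fin n | j.val < k} = Iio ⟨k, hk⟩ := by ext j; simp [Fin.lt_def]
      rw [this, span_gramSchmidt_Iio]
    · have : {j : Fin n | j.val < k} = univ := by ext j; simp; omega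
      rw [this, image_univ, image_univ, span_gramSchmidt]
  have h1 := hperp {j | j.val < k} a v
  have h2 := hperp {j | j.val < k} X v
  rw [hspan] at h1
  have h3 := h1.trans h2.symm
  simp only [hav, mem_ofPred_eq] at h3
  simpa only [X.repr_apply_apply] using h3

/-- The open cube with side length `s` centered at `0`. -/
def cube (X : OrthonormalBasis (Fin n) ℝ V) (s : ℝ) : Set V := {v | ∀ i, |X.repr v i| < s / 2}

variable (X : OrthonormalBasis (Fin n) ℝ V)

lemma continuous_repr_apply (i : Fin n) : Continuous (fun v => X.repr v i) := by
  simp_rw [X.repr_apply_apply]; fun_prop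

lemma isOpen_cube (s : ℝ) : IsOpen (cube X s) := by
  simp only [cube, ofPred_forall]
  exact isOpen_iInter_of_finite fun i => isOpen_lt (continuous_repr_apply X i).abs continuous_const

lemma convex_cube (s : ℝ) : Convex ℝ (cube X s) := by
  simp only [cube, ofPred_forall]
  refine convex_iInter fun i => ?_
  have : {v : V | |X.repr v i| < s / 2} = (fun v => X.repr v i) ⁻¹' (Metric.ball 0 (s / 2)) := by
    ext v; simp
  rw [this]
  refine Convex.is_linear_preimage (convex_ball _ _) ⟨fun v w => by simp, fun r v => by simp⟩

lemma closure_cube {s : ℝ} (hs : 0 < s) : closure (cube X s) = {v | ∀ i, |X.repr v i| ≤ s / 2} := by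
  refine Subset.antisymm (closure_minimal (fun v hv i => (hv i).le) ?_) fun v hv => ?_
  · simp only [ofPred_forall]
    exact isClosed_iInter fun i => isClosed_le (continuous_repr_apply X i).abs continuous_const
  · have h1 : Tendsto (fun τ : ℝ => τ • v) (𝓝[<] 1) (𝓝 v) := by
      have : Tendsto (fun τ : ℝ => τ • v) (𝓝 1) (𝓝 ((1 : ℝ) • v)) :=
        (continuous_id.smul continuous_const).tendsto 1
      rw [one_smul] at this
      exact this.mono_left nhdsWithin_le_nhds
    refine mem_closure_of_tendsto h1 ?_
    have h2 : Ioo (0 : ℝ) 1 ∈ 𝓝[<] (1 : ℝ) := Ioo_mem_nhdsLT one_pos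
    filter_upwards [h2] with τ hτ i
    rw [map_smul, PiLp.smul_apply, smul_eq_mul, abs_mul, abs_of_pos hτ.1]
    have := hv i
    rcases (abs_nonneg (X.repr v i)).eq_or_lt with h0 | h0
    · rw [← h0]; simp; linarith
    · calc τ * |X.repr v i| < 1 * |X.repr v i| := by gcongr; exact hτ.2
        _ ≤ s / 2 := by rwa [one_mul]

lemma norm_le_of_abs_repr_le {v : V} {a : ℝ} (ha : 0 ≤ a) (h : ∀ i, |X.repr v i| ≤ a) : ‖v‖ ≤ a * √(n : ℝ) := by
  rw [← X.repr.norm_map v, EuclideanSpace.norm_eq]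
  refine Real.sqrt_le_iff.2 ⟨by positivity, ?_⟩
  calc ∑ i, ‖X.repr v i‖ ^ 2 ≤ ∑ _i : Fin n, a ^ 2 := by
        refine Finset.sum_le_sum fun i _ => ?_
        rw [Real.norm_eq_abs]
        gcongr
        exact h i
    _ = (a * √(n : ℝ)) ^ 2 := by
        rw [mul_pow, Real.sq_sqrt (by positivity)]
        simp [mul_comm]

lemma isBounded_cube (s : ℝ) : Bornology.IsBounded (cube X s) := by
  rw [isBounded_iff_forall_norm_le]
  refine ⟨|s / 2| * √(n : ℝ), fun v hv => norm_le_of_abs_repr_le X (abs_nonneg _) fun i => ?_⟩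
  exact (hv i).le.trans (le_abs_self _)

end Flag

/-! ### Triangularity of the group law and the coordinatewise tiling argument. -/

namespace IsExpandingExp

variable {V : Type*} [NormedAddCommGroup V] [InnerProductSpace ℝ V] [FiniteDimensional ℝ V]
  {P : Type*} [Group P] [MetricSpace P] [IsTopologicalGroup P] [ConnectedSpace P]
  {n : ℕ} {e : V → P} {c : ℝ → P →* P} {b : Module.Basis (Fin n) ℝ V} {w : Fin n → ℝ}
  (h : IsExpandingExp e c b w)

/-- The exponential map, as a homeomorphism. -/
noncomputable def expHomeo : V ≃ₜ P := h.isHomeomorph_exp.homeomorph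

@[simp] lemma expHomeo_apply (v : V) : h.expHomeo v = e v := rfl

/-- The group law in exponential coordinates. -/
noncomputable def logMul (x y : V) : V := h.expHomeo.symm (e x * e y)

lemma exp_logMul (x y : V) : e (h.logMul x y) = e x * e y := h.expHomeo.apply_symm_apply _

lemma diagFlow_logMul (t : ℝ) (x y : V) :
    diagFlow b w t (h.logMul x y) = h.logMul (diagFlow b w t x) (diagFlow b w t y) := by
  apply h.injective_exp
  rw [← h.map_exp, h.exp_logMul, h.exp_logMul, map_mul, h.map_exp, h.map_exp]

variable (hM : HasStrictFDerivAt (fun q : V × V => h.logMul q.1 q.2)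
  (ContinuousLinearMap.fst ℝ V V + ContinuousLinearMap.snd ℝ V V) 0) (hw : Monotone w)

include hM hw

/-- The group law is triangular in a basis of eigenvectors with increasing weights. -/
lemma repr_logMul_sub_eq_zero (i : Fin n) (x y ξ η : V) (hξ : ∀ j < i, b.repr ξ j = 0)
    (hη : ∀ j < i, b.repr η j = 0) (j : Fin n) (hj : j ≤ i) :
    b.repr (h.logMul (x + ξ) (y + η) - h.logMul x y - ξ - η) j = 0 := by
  set D := h.logMul (x + ξ) (y + η) - h.logMul x y - ξ - η with hD
  set A := fun t => diagFlow b w (-t) with hA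
  set K : ℝ := (∑ k, |b.repr ξ k| * ‖b k‖) + ∑ k, |b.repr η k| * ‖b k‖ with hK
  have hK0 : 0 ≤ K := by positivity
  have hflow : ∀ ζ : V, (∀ j < i, b.repr ζ j = 0) → ∀ t, 0 ≤ t →
      ‖A t ζ‖ ≤ Real.exp (-t * w i) * ∑ k, |b.repr ζ k| * ‖b k‖ := by
    intro ζ hζ t ht
    have h1 : A t ζ = ∑ k, (Real.exp (-t * w k) * b.repr ζ k) • b k := by
      conv_lhs => rw [← b.sum_repr (A t ζ)]
      simp_rw [hA, diagFlow_repr]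
    rw [h1, Finset.mul_sum]
    refine (norm_sum_le _ _).trans (Finset.sum_le_sum fun k _ => ?_)
    rw [norm_smul, norm_mul, Real.norm_eq_abs, Real.norm_eq_abs, Real.abs_exp, ← mul_assoc]
    rcases lt_or_ge k i with hk | hk
    · rw [hζ k hk]; simp
    · have : Real.exp (-t * w k) ≤ Real.exp (-t * w i) :=
        Real.exp_le_exp.2 (by nlinarith [mul_le_mul_of_nonneg_left (hw hk) ht])
      gcongr
  have htend : ∀ v, Tendsto (fun t => A t v) atTop (𝓝 0) := tendsto_diagFlow_neg b w h.weight_pos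
  set f := b.equivFunL with hf
  set F := ‖(f : V →L[ℝ] Fin n → ℝ)‖ with hF
  -- Under the contraction A_t, ξ and η shrink like e^{-t w_i}, having no component of smaller
  -- index. Strict differentiability at 0 makes A_t D smaller than that by any factor ε. Since w_j ≤
  -- w_i, the j-th component of D shrinks no faster than e^{-t w_i}, so it is bounded by a constant
  -- times ε.
  have hsmall : ∀ ε > 0, |b.repr D j| ≤ F * (ε * K) := by
    intro ε hε
    have h1 := hM.isLittleO.def hε
    have h2 : Tendsto (fun t => ((A t (x + ξ), A t (y + η)), (A t x, A t y))) atTop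
        (𝓝 ((0 : V × V), (0 : V × V))) :=
      ((htend _).prodMk_nhds (htend _)).prodMk_nhds ((htend _).prodMk_nhds (htend _))
    obtain ⟨t, ht, ht0⟩ := ((h2.eventually h1).and (eventually_ge_atTop 0)).exists
    have h3 : A t D = h.logMul (A t (x + ξ)) (A t (y + η)) - h.logMul (A t x) (A t y) - A t ξ - A t η := by
      rw [hD, map_sub, map_sub, map_sub, h.diagFlow_logMul, h.diagFlow_logMul]
    have h4 : ‖A t D‖ ≤ ε * (Real.exp (-t * w i) * K) := by
      rw [h3]
      have e1 : ((A t (x + ξ), A t (y + η)) - (A t x, A t y) : V × V) = (A t ξ, A t η) := by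
        rw [Prod.mk_sub_mk, map_add, map_add, add_sub_cancel_left, add_sub_cancel_left]
      rw [e1] at ht
      simp only [_root_.add_apply, ContinuousLinearMap.coe_fst', ContinuousLinearMap.coe_snd'] at ht
      rw [← sub_sub] at ht
      refine ht.trans ?_
      gcongr
      refine (Prod.norm_mk _ _).trans_le (max_le ?_ ?_)
      · refine (hflow ξ hξ t ht0).trans ?_
        gcongr
        rw [hK]; exact le_add_of_nonneg_right (by positivity)
      · refine (hflow η hη t ht0).trans ?_
        gcongr
        rw [hK]; exact le_add_of_nonneg_left (by positivity)
    have h5 : |b.repr (A t D) j| ≤ F * ‖A t D‖ :=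
      (norm_le_pi_norm (f (A t D)) j).trans ((f : V →L[ℝ] Fin n → ℝ).le_opNorm _)
    rw [hA] at h5
    simp only at h5
    rw [diagFlow_repr, abs_mul, Real.abs_exp] at h5
    have h6 : Real.exp (-t * w i) ≤ Real.exp (-t * w j) :=
      Real.exp_le_exp.2 (by nlinarith [mul_le_mul_of_nonneg_left (hw hj) ht0])
    have h7 : Real.exp (-t * w i) * |b.repr D j| ≤ Real.exp (-t * w i) * (F * (ε * K)) := by
      calc _ ≤ Real.exp (-t * w j) * |b.repr D j| := by gcongr
        _ ≤ F * ‖A t D‖ := h5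
        _ ≤ F * (ε * (Real.exp (-t * w i) * K)) := by gcongr
        _ = _ := by ring
    exact le_of_mul_le_mul_left h7 (Real.exp_pos _)
  have hlim : Tendsto (fun ε : ℝ => F * (ε * K)) (𝓝[>] 0) (𝓝 0) := by
    have : Tendsto (fun ε : ℝ => F * (ε * K)) (𝓝 0) (𝓝 (F * (0 * K))) := by
      apply Continuous.tendsto; fun_prop
    rw [zero_mul, mul_zero] at this
    exact this.mono_left nhdsWithin_le_nhds
  have := ge_of_tendsto hlim (by filter_upwards [self_mem_nhdsWithin] with ε hε using hsmall ε hε)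
  exact abs_eq_zero.1 (le_antisymm this (abs_nonneg _))

variable {X : OrthonormalBasis (Fin n) ℝ V} (hX : ∀ (k : ℕ) (v : V),
      (∀ j : Fin n, j.val < k → b.repr v j = 0) ↔ ∀ j : Fin n, j.val < k → X.repr v j = 0)
include hX

/-- The correction to plain addition in coordinate i depends on the earlier coordinates only. This
makes both covering and disjointness of the tiling an induction on coordinates. -/
lemma repr_logMul_eq {i : Fin n} {x y x' y' : V} (hx : ∀ j < i, X.repr x' j = X.repr x j)
    (hy : ∀ j < i, X.repr y' j = X.repr y j) :
    X.repr (h.logMul x' y') i - X.repr x' i - X.repr y' i =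
      X.repr (h.logMul x y) i - X.repr x i - X.repr y i := by
  have key : ∀ z z' : V, (∀ j < i, X.repr z' j = X.repr z j) → ∀ j < i, b.repr (z' - z) j = 0 := by
    intro z z' hz
    exact (hX i.val (z' - z)).2 fun j hj => by
      rw [map_sub, PiLp.sub_apply, hz j hj, sub_self]
  have h1 := h.repr_logMul_sub_eq_zero hM hw i x y (x' - x) (y' - y) (key _ _ hx) (key _ _ hy)
  -- The two bases share a flag, not individual coordinates, so the vanishing is transferred for all
  -- indices up to i at once.
  have h2 := (hX (i.val + 1) _).1 (fun j hj => h1 j (Nat.lt_succ_iff.1 hj)) i (Nat.lt_succ_self _)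
  rw [add_sub_cancel, add_sub_cancel] at h2
  simp only [map_sub, PiLp.sub_apply] at h2
  linarith

lemma repr_logMul_eq_of_le {k : ℕ} {x y x' y' : V} (hx : ∀ j : Fin n, j.val < k → X.repr x' j = X.repr x j)
    (hy : ∀ j : Fin n, j.val < k → X.repr y' j = X.repr y j) (i : Fin n) (hi : i.val < k) :
    X.repr (h.logMul x' y') i = X.repr (h.logMul x y) i := by
  have := h.repr_logMul_eq hM hw hX (i := i) (fun j hj => hx j (lt_trans hj hi))
    (fun j hj => hy j (lt_trans hj hi))
  rw [hx i hi, hy i hi] at this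
  linarith

/-- Changing only the k-th integer leaves the earlier coordinates of the product unchanged and
shifts the k-th by a multiple of s; rounding then brings it into [−s/2, s/2]. -/
lemma exists_lattice_logMul_mem_closed_cube {s : ℝ} (hs : 0 < s) (y : V) (k : ℕ) :
    ∃ m : Fin n → ℤ, ∀ i : Fin n, i.val < k →
      |X.repr (h.logMul y (X.repr.symm (WithLp.toLp 2 fun i => s * m i))) i| ≤ s / 2 := by
  induction k with
  | zero => exact ⟨0, fun i hi => absurd hi (Nat.not_lt_zero _)⟩
  | succ k ih =>
    obtain ⟨m, hm⟩ := ih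
    by_cases hk : k < n
    · set a := X.repr (h.logMul y (X.repr.symm (WithLp.toLp 2 fun i => s * m i))) ⟨k, hk⟩ with ha
      set m' : Fin n → ℤ := Function.update m ⟨k, hk⟩ (m ⟨k, hk⟩ - round (a / s)) with hm'
      have hlt : ∀ j : Fin n, j.val < k → m' j = m j := fun j hj => by
        rw [hm', Function.update_of_ne]
        rintro rfl; exact lt_irrefl _ hj
      refine ⟨m', fun i hi => ?_⟩
      rcases Nat.lt_succ_iff_lt_or_eq.1 hi with hi | hi
      · rw [h.repr_logMul_eq_of_le hM hw hX (x := y) (y := X.repr.symm (WithLp.toLp 2 fun i => s * m i))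
          (fun _ _ => rfl) (fun j hj => by simp [hlt j hj]) i hi]
        exact hm i hi
      · obtain rfl : i = ⟨k, hk⟩ := Fin.ext hi
        have h1 := h.repr_logMul_eq hM hw hX (i := ⟨k, hk⟩) (x := y) (x' := y)
          (y := X.repr.symm (WithLp.toLp 2 fun i => s * m i))
          (y' := X.repr.symm (WithLp.toLp 2 fun i => s * m' i)) (fun _ _ => rfl)
          (fun j hj => by simp [hlt j hj])
        rw [← ha] at h1
        have h2 : m' ⟨k, hk⟩ = m ⟨k, hk⟩ - round (a / s) := by rw [hm', Function.update_self]
        simp only [LinearIsometryEquiv.apply_symm_apply, h2, Int.cast_sub] at h1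
        have h3 : X.repr (h.logMul y (X.repr.symm (WithLp.toLp 2 fun i => s * m' i))) ⟨k, hk⟩ =
            s * (a / s - round (a / s)) := by
          rw [mul_sub, mul_div_cancel₀ _ hs.ne']; linarith
        rw [h3, abs_mul, abs_of_pos hs]
        have := abs_sub_round (a / s)
        nlinarith
    · exact ⟨m, fun i _ => hm i (by omega)⟩

/-- Translates of a cube by distinct points of the lattice with coordinates in `s ℤ` are disjoint. -/
lemma eq_of_exp_mul_exp_eq {s : ℝ} {v v' : V} (hv : v ∈ cube X s) (hv' : v' ∈ cube X s)
    {m m' : Fin n → ℤ} (heq : h.logMul v (X.repr.symm (WithLp.toLp 2 fun i => s * m i)) =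
      h.logMul v' (X.repr.symm (WithLp.toLp 2 fun i => s * m' i))) : m = m' := by
  have key : ∀ k : ℕ, ∀ i : Fin n, i.val < k → m i = m' i ∧ X.repr v i = X.repr v' i := by
    intro k
    induction k with
    | zero => exact fun i hi => absurd hi (Nat.not_lt_zero _)
    | succ k ih =>
      intro i hi
      rcases Nat.lt_succ_iff_lt_or_eq.1 hi with hi | hi
      · exact ih i hi
      · have h1 := h.repr_logMul_eq hM hw hX (i := i) (x := v') (x' := v)
          (y := X.repr.symm (WithLp.toLp 2 fun i => s * m' i))
          (y' := X.repr.symm (WithLp.toLp 2 fun i => s * m i))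
          (fun j hj => (ih j (hi ▸ hj)).2) (fun j hj => by simp [(ih j (hi ▸ hj)).1])
        rw [heq] at h1
        simp only [LinearIsometryEquiv.apply_symm_apply] at h1
        have h2 := abs_lt.1 (hv i)
        have h3 := abs_lt.1 (hv' i)
        have hs : 0 < s := by linarith [h2.1.trans h2.2]
        have h4 : s * ((m i : ℝ) - m' i) = X.repr v' i - X.repr v i := by linarith
        -- Both i-th coordinates lie in an open interval of length s, so the integers differ by less
        -- than 1.
        have h5 : |((m i - m' i : ℤ) : ℝ)| < 1 := by
          push_cast
          rw [abs_lt]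
          constructor <;> nlinarith
        have h6 : m i - m' i = 0 := Int.abs_lt_one_iff.1 (by exact_mod_cast h5)
        have h7 : m i = m' i := sub_eq_zero.1 h6
        refine ⟨h7, ?_⟩
        rw [h7, sub_self, mul_zero] at h4
        linarith
  exact funext fun i => (key n i i.2).1

end IsExpandingExp

/-! ### Exponential cubes are tessellation domains. -/

namespace IsExpandingExp

variable {V : Type*} [NormedAddCommGroup V] [InnerProductSpace ℝ V] [FiniteDimensional ℝ V]
  {P : Type*} [Group P] [MetricSpace P] [IsTopologicalGroup P] [ConnectedSpace P]
  {n : ℕ} {e : V → P} {c : ℝ → P →* P} {b : Module.Basis (Fin n) ℝ V} {w : Fin n → ℝ}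
  (h : IsExpandingExp e c b w)
  [LocallyCompactSpace P] [SecondCountableTopology P] [MeasurableSpace P] [BorelSpace P]
  (ν : Measure P) [ν.IsHaarMeasure]
include h

/-- The exponential map sends bounded null sets to null sets. -/
lemma measure_image_exp_eq_zero [MeasurableSpace V] [BorelSpace V] {N : Set V} (hN : volume N = 0)
    (hb : Bornology.IsBounded N) : ν (e '' N) = 0 := by
  obtain ⟨ρ, hρ, hbl⟩ := h.exists_biLip
  obtain ⟨k, K, hk0, hkt, hK0, hKt, hcomp⟩ := exists_haar_image_comparison ν h.dist_mul_right hbl hρ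
    h.exp_zero h.exp_neg (h.image_ball_mem_nhds hρ)
  obtain ⟨C, hC, κ, hκ, hcon⟩ := exists_norm_diagFlow_neg_le b w h.weight_pos
  obtain ⟨R, hR⟩ := isBounded_iff_forall_norm_le.1 hb
  -- A bounded set is contracted into the ball where Haar and Lebesgue measure are comparable; the
  -- scaling formula brings the result back.
  obtain ⟨t, ht, ht0⟩ : ∃ t : ℝ, C * Real.exp (-κ * t) * |R| < ρ ∧ 0 ≤ t := by
    have h1 : Tendsto (fun t : ℝ => C * Real.exp (-κ * t) * |R|) atTop (𝓝 0) := by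
      have h2 : Tendsto (fun t : ℝ => Real.exp (-κ * t)) atTop (𝓝 0) :=
        Real.tendsto_exp_atBot.comp (tendsto_id.const_mul_atTop_of_neg (by linarith))
      simpa using (h2.const_mul C).mul_const |R|
    exact ((h1.eventually (gt_mem_nhds hρ)).and (eventually_ge_atTop 0)).exists
  have hsub : diagFlow b w (-t) '' N ⊆ Metric.ball 0 ρ := by
    rintro _ ⟨v, hv, rfl⟩
    rw [mem_ball_zero_iff]
    refine ((hcon t ht0 v).trans ?_).trans_lt ht
    gcongr
    exact (hR v hv).trans (le_abs_self R)
  have h0 : volume (diagFlow b w (-t) '' N) = 0 := by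
    have := Measure.addHaar_image_linearMap (volume : Measure V) (diagFlow b w (-t) : V →ₗ[ℝ] V) N
    rw [hN, mul_zero] at this
    exact this
  have h1 := (hcomp _ hsub).2
  rw [h0, mul_zero] at h1
  have him : c (-t) '' (e '' N) = e '' (diagFlow b w (-t) '' N) := by
    rw [image_image, image_image]
    exact image_congr fun v _ => h.map_exp _ _
  rw [← him, h.measure_image_map] at h1
  refine (mul_eq_zero.1 (le_antisymm h1 zero_le)).resolve_left ?_
  simp [Real.exp_pos]

omit [LocallyCompactSpace P] [SecondCountableTopology P] [MeasurableSpace P] [BorelSpace P] in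
lemma closure_image_cube (X : OrthonormalBasis (Fin n) ℝ V) {s : ℝ} (hs : 0 < s) :
    closure (e '' cube X s) = e '' {v | ∀ i, |X.repr v i| ≤ s / 2} := by
  have : closure (e '' cube X s) = e '' (closure (cube X s)) := (h.expHomeo.image_closure _).symm
  rw [this, closure_cube X hs]

variable (hM : HasStrictFDerivAt (fun q : V × V => h.logMul q.1 q.2)
  (ContinuousLinearMap.fst ℝ V V + ContinuousLinearMap.snd ℝ V V) 0) (hw : Monotone w)
  {X : OrthonormalBasis (Fin n) ℝ V} (hX : ∀ (k : ℕ) (v : V),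
      (∀ j : Fin n, j.val < k → b.repr v j = 0) ↔ ∀ j : Fin n, j.val < k → X.repr v j = 0)
include hM hw hX

theorem isTessellationDomain {s : ℝ} (hs : 0 < s) : IsTessellationDomain ν (e '' cube X s)
    (range fun m : Fin n → ℤ => e (X.repr.symm (WithLp.toLp 2 fun i => s * m i))) := by
  borelize V
  refine ⟨h.expHomeo.isOpenMap _ (isOpen_cube X s), countable_range _, ?_, ?_, ?_⟩
  · have h1 : frontier (e '' cube X s) = e '' frontier (cube X s) := (h.expHomeo.image_frontier _).symm
    rw [h1]
    refine h.measure_image_exp_eq_zero ν ((convex_cube X s).addHaar_frontier volume) ?_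
    exact (isBounded_cube X s).closure.subset frontier_subset_closure
  · rintro _ ⟨m, rfl⟩ _ ⟨m', rfl⟩ hne
    rw [Set.disjoint_left]
    rintro _ ⟨_, ⟨v, hv, rfl⟩, rfl⟩ ⟨_, ⟨v', hv', rfl⟩, heq⟩
    refine hne ?_
    simp only at heq ⊢
    rw [← h.exp_logMul, ← h.exp_logMul] at heq
    rw [h.eq_of_exp_mul_exp_eq hM hw hX hv hv' (h.injective_exp heq).symm]
  · refine eq_univ_of_forall fun x => ?_
    obtain ⟨y, rfl⟩ := h.surjective_exp x
    obtain ⟨m, hm⟩ := h.exists_lattice_logMul_mem_closed_cube hM hw hX hs y n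
    simp only [mem_iUnion]
    -- The translating set need not be a subgroup, but it is closed under inversion: e(−l) = e(l)⁻¹,
    -- so the point with coordinates −sm undoes multiplication by the one with coordinates sm.
    refine ⟨_, ⟨-m, rfl⟩, e (h.logMul y (X.repr.symm (WithLp.toLp 2 fun i => s * m i))), ?_, ?_⟩
    · rw [h.closure_image_cube X hs]
      exact ⟨_, fun i => hm i i.2, rfl⟩
    · simp only
      rw [h.exp_logMul, mul_assoc, mul_eq_left, ← inv_eq_iff_mul_eq_one, ← h.exp_neg, ← map_neg]
      congr 2
      ext i
      simp

end IsExpandingExp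

section Existence

variable {E : Type*} [NormedAddCommGroup E] [NormedSpace ℝ E] [FiniteDimensional ℝ E]
  {G : Type*} [Group G] [MetricSpace G] [ChartedSpace E G] [LieGroup 𝓘(ℝ, E) ∞ G]
  [ConnectedSpace G]
  [Bundle.RiemannianBundle (fun x : G => TangentSpace 𝓘(ℝ, E) x)]
  [IsContMDiffRiemannianBundle 𝓘(ℝ, E) ∞ E (fun x : G => TangentSpace 𝓘(ℝ, E) x)]
  [IsRiemannianManifold 𝓘(ℝ, E) G] [MeasurableSpace G] [BorelSpace G] (ν : Measure G) [ν.IsHaarMeasure]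

lemma exists_isTessellationBasis [LocallyCompactSpace G] (hG : IsRightInvariant E G) {n : ℕ} {c : ℝ → G →* G}
    {b : Module.Basis (Fin n) ℝ (LieAlg E G)} {w : Fin n → ℝ}
    (h : IsExpandingExp (gexp : LieAlg E G → G) c b w) (hw : Monotone w) :
    ∃ B : OrthonormalBasis (Fin n) ℝ (TangentSpace 𝓘(ℝ, E) (1 : G)), IsTessellationBasis E ν B := by
  have : IsTopologicalGroup G := topologicalGroup_of_lieGroup 𝓘(ℝ, E) ∞
  have := (secondCountableTopology_of_connected_group (P := G)).2
  obtain ⟨X, hX⟩ := exists_orthonormalBasis_adapted b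
  have hM := hasStrictFDerivAt_log_mul hG (lg := h.expHomeo.symm) (by
    have := h.expHomeo.symm.continuous.tendsto 1
    have h1 : h.expHomeo.symm 1 = 0 := by
      rw [Homeomorph.symm_apply_eq, h.expHomeo_apply, h.exp_zero]
    rwa [h1] at this) (Eventually.of_forall fun g => h.expHomeo.apply_symm_apply g)
  exact ⟨X, fun s hs => ⟨_, h.isTessellationDomain ν hM hw hX hs⟩⟩

lemma exists_isExpRadius (hG : IsRightInvariant E G) : ∃ rs : ℝ, IsExpRadius E G rs := by
  obtain ⟨ρ, hρ, hb⟩ := exists_gexp_biLipschitz (E := E) (G := G) hG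
  refine ⟨min ρ (1 / 8), by positivity, (min_le_right _ _).trans_lt (by norm_num), fun v w hv hw => ?_⟩
  exact hb v w (hv.trans_le (min_le_left _ _)) (hw.trans_le (min_le_left _ _))

end Existence

/-! ### Derivatives along the Lie algebra and test functions. -/

section PartialDeriv

variable {E : Type*} [NormedAddCommGroup E] [NormedSpace ℝ E]
  {M : Type*} [TopologicalSpace M] [ChartedSpace E M] [IsManifold 𝓘(ℝ, E) ∞ M]

/-- In a chart on M, the partial derivative is the full derivative applied to the fixed vector (1,
0), and the full derivative is smooth. It is used to iterate `lieDeriv`. -/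
lemma contMDiff_deriv_fst {F : ℝ × M → ℝ} (hF : ContMDiff (𝓘(ℝ, ℝ).prod 𝓘(ℝ, E)) 𝓘(ℝ, ℝ) ∞ F) :
    ContMDiff 𝓘(ℝ, E) 𝓘(ℝ, ℝ) ∞ (fun x => deriv (fun s => F (s, x)) 0) := by
  intro x₀
  set φ := extChartAt 𝓘(ℝ, E) x₀ with hφ
  set Fh : ℝ × E → ℝ := fun q => F (q.1, φ.symm q.2) with hFh
  have hopen : IsOpen ((univ : Set ℝ) ×ˢ φ.target) := isOpen_univ.prod (isOpen_extChartAt_target x₀)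
  have h1 : ContDiffOn ℝ ∞ Fh (univ ×ˢ φ.target) := by
    rw [← contMDiffOn_iff_contDiffOn]
    have h2 : ContMDiffOn 𝓘(ℝ, ℝ × E) 𝓘(ℝ, ℝ) ∞ (Prod.fst : ℝ × E → ℝ) (univ ×ˢ φ.target) :=
      contDiff_fst.contMDiff.contMDiffOn
    have h3 : ContMDiffOn 𝓘(ℝ, ℝ × E) 𝓘(ℝ, E) ∞ (fun q : ℝ × E => φ.symm q.2) (univ ×ˢ φ.target) :=
      ContMDiffOn.comp (t := φ.target) (contMDiffOn_extChartAt_symm x₀)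
        (contDiff_snd.contMDiff.contMDiffOn) (fun q hq => hq.2)
    exact hF.comp_contMDiffOn (h2.prodMk h3)
  have h4 : ContDiffOn ℝ ∞ (fderiv ℝ Fh) (univ ×ˢ φ.target) :=
    h1.fderiv_of_isOpen hopen (by simp)
  have h5 : ContDiffOn ℝ ∞ (fun a => fderiv ℝ Fh (0, a) (1, 0)) φ.target := by
    have h6 : ContDiffOn ℝ ∞ (fun a : E => fderiv ℝ Fh ((0 : ℝ), a)) φ.target :=
      h4.comp (contDiff_const.prodMk contDiff_id).contDiffOn (fun a ha => ⟨trivial, ha⟩)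
    exact h6.clm_apply contDiffOn_const
  have h7 : ContMDiffOn 𝓘(ℝ, E) 𝓘(ℝ, ℝ) ∞ (fun x => fderiv ℝ Fh (0, φ x) (1, 0)) φ.source := by
    have h8 : ContMDiffOn 𝓘(ℝ, E) 𝓘(ℝ, E) ∞ φ φ.source := by
      have := contMDiffOn_extChartAt (I := 𝓘(ℝ, E)) (x := x₀) (n := ∞)
      rwa [← extChartAt_source 𝓘(ℝ, E)] at this
    exact (contMDiffOn_iff_contDiffOn.2 h5).comp h8 (fun x hx => φ.map_source hx)
  have hsrc : φ.source ∈ 𝓝 x₀ := extChartAt_source_mem_nhds x₀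
  refine (h7.contMDiffAt hsrc).congr_of_eventuallyEq ?_
  filter_upwards [hsrc] with x hx
  have hd : DifferentiableAt ℝ Fh (0, φ x) :=
    ((h1.contDiffAt (hopen.mem_nhds ⟨trivial, φ.map_source hx⟩)).differentiableAt (by simp))
  have h9 : HasDerivAt (fun s : ℝ => (s, φ x)) ((1 : ℝ), (0 : E)) 0 :=
    (hasDerivAt_id 0).prodMk (hasDerivAt_const _ _)
  have h10 := (hd.hasFDerivAt.comp_hasDerivAt (0 : ℝ) h9).deriv
  rw [← h10]
  congr 1
  ext s
  simp only [hFh, Function.comp_apply]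
  rw [φ.left_inv hx]

end PartialDeriv

section LieDeriv

variable {E : Type*} [NormedAddCommGroup E] [NormedSpace ℝ E] [FiniteDimensional ℝ E]
  {G : Type*} [Group G] [MetricSpace G] [ChartedSpace E G] [LieGroup 𝓘(ℝ, E) ∞ G]
  [Bundle.RiemannianBundle (fun x : G => TangentSpace 𝓘(ℝ, E) x)]
  [IsRiemannianManifold 𝓘(ℝ, E) G]

lemma contMDiff_lieExp_smul (Y : TangentSpace 𝓘(ℝ, E) (1 : G)) :
    ContMDiff 𝓘(ℝ, ℝ) 𝓘(ℝ, E) ∞ (fun s : ℝ => (lieExp E (s • Y) : G)) :=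
  contMDiff_gexp_smul (E := E) (G := G) (show LieAlg E G from Y)

variable {u v : G → ℝ} (hu : ContMDiff 𝓘(ℝ, E) 𝓘(ℝ, ℝ) ∞ u) (hv : ContMDiff 𝓘(ℝ, E) 𝓘(ℝ, ℝ) ∞ v)
  (Y : TangentSpace 𝓘(ℝ, E) (1 : G))

include hu

lemma contMDiff_comp_lieExp_mul : ContMDiff (𝓘(ℝ, ℝ).prod 𝓘(ℝ, E)) 𝓘(ℝ, ℝ) ∞
    (fun q : ℝ × G => u (lieExp E (q.1 • Y) * q.2)) :=
  hu.comp (((contMDiff_lieExp_smul Y).comp contMDiff_fst).mul contMDiff_snd)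

lemma contMDiff_lieDeriv : ContMDiff 𝓘(ℝ, E) 𝓘(ℝ, ℝ) ∞ (lieDeriv E Y u) :=
  contMDiff_deriv_fst (contMDiff_comp_lieExp_mul hu Y)

lemma differentiable_comp_lieExp_mul (g : G) : Differentiable ℝ (fun s : ℝ => u (lieExp E (s • Y) * g)) := by
  have h1 : ContMDiff 𝓘(ℝ, ℝ) 𝓘(ℝ, ℝ) ∞ (fun s : ℝ => u (lieExp E (s • Y) * g)) :=
    hu.comp ((contMDiff_lieExp_smul Y).mul contMDiff_const)
  exact (contMDiff_iff_contDiff.1 h1).differentiable (by simp)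

lemma hasDerivAt_comp_lieExp_mul (g : G) (s : ℝ) : HasDerivAt (fun s : ℝ => u (lieExp E (s • Y) * g))
    (lieDeriv E Y u (lieExp E (s • Y) * g)) s := by
  have h1 := (differentiable_comp_lieExp_mul hu Y (lieExp E (s • Y) * g) 0).hasDerivAt
  have h2 : HasDerivAt (fun τ : ℝ => τ - s) 1 s := (hasDerivAt_id s).sub_const s
  have h3 := HasDerivAt.scomp (h := fun τ : ℝ => τ - s) s (by rw [sub_self]; exact h1) h2
  rw [one_smul] at h3
  refine h3.congr_of_eventuallyEq (Eventually.of_forall fun τ => ?_)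
  simp only [Function.comp_apply]
  rw [← mul_assoc, ← lieExp_add_smul, sub_add_cancel]

lemma hasDerivAt_lieDeriv (g : G) : HasDerivAt (fun s : ℝ => u (lieExp E (s • Y) * g))
    (lieDeriv E Y u g) 0 := by
  simpa [lieExp_zero] using hasDerivAt_comp_lieExp_mul hu Y g 0

lemma lieDeriv_comp {χ : ℝ → ℝ} (hχ : ContDiff ℝ ∞ χ) (g : G) :
    lieDeriv E Y (fun x => χ (u x)) g = deriv χ (u g) * lieDeriv E Y u g := by
  have h1 : HasDerivAt χ (deriv χ (u (lieExp E ((0 : ℝ) • Y) * g))) (u (lieExp E ((0 : ℝ) • Y) * g)) :=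
    (hχ.differentiable (by simp) _).hasDerivAt
  have h2 := (h1.comp (0 : ℝ) (hasDerivAt_lieDeriv hu Y g)).deriv
  simp only [zero_smul, lieExp_zero, one_mul] at h2
  exact h2

include hv

lemma lieDeriv_add (g : G) : lieDeriv E Y (fun x => u x + v x) g = lieDeriv E Y u g + lieDeriv E Y v g :=
  ((hasDerivAt_lieDeriv hu Y g).add (hasDerivAt_lieDeriv hv Y g)).deriv

lemma lieDeriv_mul (g : G) : lieDeriv E Y (fun x => u x * v x) g =
    lieDeriv E Y u g * v g + u g * lieDeriv E Y v g := by
  have := ((hasDerivAt_lieDeriv hu Y g).mul (hasDerivAt_lieDeriv hv Y g)).deriv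
  simp only [zero_smul, lieExp_zero, one_mul] at this
  exact this

omit hu hv

lemma lieDeriv_const_mul {X : Type*} [SMul G X] (a : ℝ) (φ : X → ℝ) (x : X) :
    lieDeriv E Y (fun x => a * φ x) x = a * lieDeriv E Y φ x :=
  deriv_const_mul_field a

lemma lieDeriv_eq_zero_of_notMem_tsupport {g : G} (hg : g ∉ tsupport u) : lieDeriv E Y u g = 0 := by
  have h1 : ∀ᶠ x in 𝓝 g, u x = 0 := by
    filter_upwards [(isClosed_tsupport u).isOpen_compl.mem_nhds hg] with x hx
    exact image_eq_zero_of_notMem_tsupport hx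
  have h2 : Tendsto (fun s : ℝ => lieExp E (s • Y) * g) (𝓝 0) (𝓝 g) := by
    have : IsTopologicalGroup G := topologicalGroup_of_lieGroup 𝓘(ℝ, E) ∞
    have h3 : Continuous (fun s : ℝ => lieExp E (s • Y) * g) :=
      (contMDiff_lieExp_smul Y).continuous.mul continuous_const
    simpa [lieExp_zero] using h3.tendsto 0
  have h3 : (fun s : ℝ => u (lieExp E (s • Y) * g)) =ᶠ[𝓝 0] fun _ => 0 := h2.eventually h1
  have := h3.deriv_eq
  rw [deriv_const] at this
  exact this

lemma tsupport_lieDeriv_subset : tsupport (lieDeriv E Y u) ⊆ tsupport u :=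
  closure_minimal (fun _ hg => by_contra fun h => hg (lieDeriv_eq_zero_of_notMem_tsupport Y h))
    (isClosed_tsupport u)

end LieDeriv

section Word

variable {E : Type*} [NormedAddCommGroup E] [NormedSpace ℝ E]
  {G : Type*} [Group G] [TopologicalSpace G] [ChartedSpace E G] {n : ℕ}

/-- The iterated derivative along a word in vectors of the Lie algebra. -/
noncomputable def wordDeriv {X : Type*} [SMul G X] (Y : Fin n → TangentSpace 𝓘(ℝ, E) (1 : G)) (w : List (Fin n))
    (ψ : X → ℝ) : X → ℝ := w.foldr (fun i φ => lieDeriv E (Y i) φ) ψ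

/-- Words in basis vectors are easier to induct on than ordered monomials; the monomial with
exponents α is the word repeating the letter i exactly α i times. -/
lemma exists_word_multiDeriv (α : Fin n → ℕ) : ∃ w : List (Fin n), w.length = ∑ i, α i ∧
    ∀ (X : Type _) [SMul G X] (Y : Fin n → TangentSpace 𝓘(ℝ, E) (1 : G)) (ψ : X → ℝ),
      multiDeriv E Y α ψ = wordDeriv Y w ψ := by
  refine ⟨(List.finRange n).flatMap fun i => List.replicate (α i) i, ?_, ?_⟩
  · rw [List.length_flatMap]
    simp only [List.length_replicate]
    rw [Fin.sum_univ_def]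
  · intro X _ Y ψ
    rw [multiDeriv, wordDeriv]
    induction List.finRange n with
    | nil => rfl
    | cons i l ih =>
      rw [List.foldr_cons, List.flatMap_cons, List.foldr_append, ih]
      generalize List.foldr _ ψ _ = φ
      induction α i with
      | zero => rfl
      | succ k ihk => rw [Function.iterate_succ_apply', ihk, List.replicate_succ, List.foldr_cons]

end Word

section Test

variable {E : Type*} [NormedAddCommGroup E] [NormedSpace ℝ E] [FiniteDimensional ℝ E]
  {G : Type*} [Group G] [MetricSpace G] [ChartedSpace E G] [LieGroup 𝓘(ℝ, E) ∞ G]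
  [Bundle.RiemannianBundle (fun x : G => TangentSpace 𝓘(ℝ, E) x)]
  [IsRiemannianManifold 𝓘(ℝ, E) G]

variable (E) in
/-- Smooth functions with compact support. -/
structure IsTest (u : G → ℝ) : Prop where
  contMDiff : ContMDiff 𝓘(ℝ, E) 𝓘(ℝ, ℝ) ∞ u
  hasCompactSupport : HasCompactSupport u

variable {u v : G → ℝ} {n : ℕ}

lemma IsTest.lieDeriv (hu : IsTest E u) (Y : TangentSpace 𝓘(ℝ, E) (1 : G)) : IsTest E (lieDeriv E Y u) :=
  ⟨contMDiff_lieDeriv hu.contMDiff Y,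
    hu.hasCompactSupport.of_isClosed_subset (isClosed_tsupport _) (tsupport_lieDeriv_subset Y)⟩

lemma IsTest.wordDeriv (hu : IsTest E u) (Y : Fin n → TangentSpace 𝓘(ℝ, E) (1 : G)) (w : List (Fin n)) :
    IsTest E (wordDeriv Y w u) := by
  induction w with
  | nil => exact hu
  | cons i w ih => exact ih.lieDeriv (Y i)

lemma tsupport_wordDeriv_subset (Y : Fin n → TangentSpace 𝓘(ℝ, E) (1 : G)) (w : List (Fin n)) :
    tsupport (wordDeriv Y w u) ⊆ tsupport u := by
  induction w with
  | nil => exact subset_rfl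
  | cons i w ih => exact (tsupport_lieDeriv_subset (Y i)).trans ih

lemma IsTest.exists_bound (hu : IsTest E u) : ∃ C, 0 ≤ C ∧ ∀ g, |u g| ≤ C := by
  obtain ⟨C, hC⟩ := hu.hasCompactSupport.exists_bound_of_continuous hu.contMDiff.continuous
  exact ⟨C, (norm_nonneg _).trans (hC 1), hC⟩

lemma IsTest.mul_right (hu : IsTest E u) (hv : ContMDiff 𝓘(ℝ, E) 𝓘(ℝ, ℝ) ∞ v) :
    IsTest E (fun x => u x * v x) :=
  ⟨hu.contMDiff.mul hv, hu.hasCompactSupport.mul_right⟩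

lemma wordDeriv_add_const_mul (hu : IsTest E u) (hv : IsTest E v) (a : ℝ)
    (Y : Fin n → TangentSpace 𝓘(ℝ, E) (1 : G)) (w : List (Fin n)) :
    wordDeriv Y w (fun x => u x + a * v x) = fun x => wordDeriv Y w u x + a * wordDeriv Y w v x := by
  induction w with
  | nil => rfl
  | cons i w ih =>
    have h1 := hu.wordDeriv Y w
    have h2 := hv.wordDeriv Y w
    ext g
    have : HomDyn.wordDeriv Y (i :: w) (fun x => u x + a * v x) =
      HomDyn.lieDeriv E (Y i) (HomDyn.wordDeriv Y w (fun x => u x + a * v x)) := rfl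
    rw [this, ih, lieDeriv_add h1.contMDiff
      (v := fun x => a * HomDyn.wordDeriv Y w v x) (contMDiff_const.mul h2.contMDiff), lieDeriv_const_mul]
    rfl

/-- The functions `b * χ (a * ρ)`, as `a → ∞`, have derivatives of polynomial growth in `a`. -/
lemma exists_bound_wordDeriv {ρ : G → ℝ} (hρ : ContMDiff 𝓘(ℝ, E) 𝓘(ℝ, ℝ) ∞ ρ)
    (Y : Fin n → TangentSpace 𝓘(ℝ, E) (1 : G)) (ℓ : ℕ) : ∀ {b : G → ℝ} {χ : ℝ → ℝ}, IsTest E b →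
      ContDiff ℝ ∞ χ → HasCompactSupport χ → ∃ C, 0 ≤ C ∧ ∀ w : List (Fin n), w.length = ℓ →
        ∀ a : ℝ, 1 ≤ a → ∀ g, |wordDeriv Y w (fun x => b x * χ (a * ρ x)) g| ≤ C * a ^ ℓ := by
  induction ℓ with
  | zero =>
    intro b χ hb hχ hχc
    obtain ⟨C₁, h₁, hC₁⟩ := hb.exists_bound
    obtain ⟨C₂, hC₂⟩ := hχc.exists_bound_of_continuous hχ.continuous
    refine ⟨C₁ * C₂, mul_nonneg h₁ ((norm_nonneg _).trans (hC₂ 0)), fun w hw a ha g => ?_⟩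
    rw [List.length_eq_zero_iff.1 hw, pow_zero, mul_one]
    show |b g * χ (a * ρ g)| ≤ _
    rw [abs_mul]
    exact mul_le_mul (hC₁ g) (hC₂ _) (abs_nonneg _) h₁
  | succ ℓ ih =>
    intro b χ hb hχ hχc
    have hχ' : ContDiff ℝ ∞ (deriv χ) := (contDiff_infty_iff_deriv.1 hχ).2
    choose C hC0 hC using fun i => ih (hb.lieDeriv (Y i)) hχ hχc
    choose D hD0 hD using fun i => ih (hb.mul_right (contMDiff_lieDeriv hρ (Y i))) hχ' hχc.deriv
    refine ⟨∑ i, (C i + D i), Finset.sum_nonneg fun i _ => add_nonneg (hC0 i) (hD0 i),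
      fun w hw a ha g => ?_⟩
    -- The last letter of a word acts first. Removing it leaves two functions of the same shape,
    -- with data (Y b, χ) and (b · Yρ, χ'), the second carrying one factor a; hence the growth a^ℓ.
    obtain ⟨w', i, rfl⟩ : ∃ w' i, w = w' ++ [i] :=
      ⟨_, _, (List.dropLast_append_getLast (List.ne_nil_of_length_eq_add_one hw)).symm⟩
    have hw' : w'.length = ℓ := by simpa using hw
    have hχa : ContMDiff 𝓘(ℝ, E) 𝓘(ℝ, ℝ) ∞ (fun x => χ (a * ρ x)) :=
      hχ.contMDiff.comp (contMDiff_const.mul hρ)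
    have hχa' : ContMDiff 𝓘(ℝ, E) 𝓘(ℝ, ℝ) ∞ (fun x => deriv χ (a * ρ x)) :=
      hχ'.contMDiff.comp (contMDiff_const.mul hρ)
    have h1 : HomDyn.lieDeriv E (Y i) (fun x => b x * χ (a * ρ x)) = fun x =>
        HomDyn.lieDeriv E (Y i) b x * χ (a * ρ x) +
          a * ((b x * HomDyn.lieDeriv E (Y i) ρ x) * deriv χ (a * ρ x)) := by
      ext x
      rw [lieDeriv_mul hb.contMDiff hχa, lieDeriv_comp (u := fun x => a * ρ x) (contMDiff_const.mul hρ) _ hχ,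
        lieDeriv_const_mul]
      ring
    have h2 : HomDyn.wordDeriv Y (w' ++ [i]) (fun x => b x * χ (a * ρ x)) = HomDyn.wordDeriv Y w'
        (HomDyn.lieDeriv E (Y i) (fun x => b x * χ (a * ρ x))) := by
      rw [HomDyn.wordDeriv, List.foldr_append]; rfl
    rw [h2, h1, wordDeriv_add_const_mul ((hb.lieDeriv (Y i)).mul_right hχa)
      ((hb.mul_right (contMDiff_lieDeriv hρ (Y i))).mul_right hχa')]
    have h3 := hC i w' hw' a ha g
    have h4 := hD i w' hw' a ha g
    have hsum : C i + D i ≤ ∑ i, (C i + D i) :=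
      Finset.single_le_sum (f := fun i => C i + D i) (fun i _ => add_nonneg (hC0 i) (hD0 i)) (Finset.mem_univ i)
    have ha0 : 0 ≤ a := by linarith
    calc _ ≤ C i * a ^ ℓ + a * (D i * a ^ ℓ) := by
          refine (abs_add_le _ _).trans (add_le_add h3 ?_)
          rw [abs_mul, abs_of_nonneg ha0]
          gcongr
      _ ≤ a * (C i * a ^ ℓ) + a * (D i * a ^ ℓ) := by
          refine add_le_add_left ?_ _
          exact le_mul_of_one_le_left (mul_nonneg (hC0 i) (by positivity)) ha
      _ = (C i + D i) * a ^ (ℓ + 1) := by ring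
      _ ≤ _ := by gcongr

end Test

/-! ### Smoothing indicator functions by convolution over the group. -/

section Smoothing

variable {E : Type*} [NormedAddCommGroup E] [NormedSpace ℝ E] [FiniteDimensional ℝ E]
  {G : Type*} [Group G] [MetricSpace G] [ChartedSpace E G] [LieGroup 𝓘(ℝ, E) ∞ G]
  [Bundle.RiemannianBundle (fun x : G => TangentSpace 𝓘(ℝ, E) x)]
  [IsRiemannianManifold 𝓘(ℝ, E) G] [MeasurableSpace G] [BorelSpace G] (m : Measure G) [m.IsHaarMeasure]
  {X : Type*} [MulAction G X] {u : G → ℝ} {S : Set X} {n : ℕ}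

/-- The convolution of `u` with the indicator function of `S`. -/
noncomputable def smoothing (u : G → ℝ) (S : Set X) (x : X) : ℝ := ∫ k in {k | k⁻¹ • x ∈ S}, u k ∂m

omit [LieGroup 𝓘(ℝ, E) ∞ G] [FiniteDimensional ℝ E]
    [Bundle.RiemannianBundle (fun x : G => TangentSpace 𝓘(ℝ, E) x)] [IsRiemannianManifold 𝓘(ℝ, E) G] in
lemma IsTest.integrable (hu : IsTest E u) : Integrable u m :=
  hu.contMDiff.continuous.integrable_of_hasCompactSupport hu.hasCompactSupport

lemma abs_smoothing_le (hu : Integrable u m) (x : X) : |smoothing m u S x| ≤ ∫ k, |u k| ∂m := by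
  refine (abs_integral_le_integral_abs).trans ?_
  exact setIntegral_le_integral hu.abs (Eventually.of_forall fun k => abs_nonneg _)

lemma smoothing_nonneg (hu : ∀ k, 0 ≤ u k) (x : X) : 0 ≤ smoothing m u S x :=
  integral_nonneg hu

lemma smoothing_le_integral (hui : Integrable u m) (hu : ∀ k, 0 ≤ u k) (x : X) :
    smoothing m u S x ≤ ∫ k, u k ∂m :=
  setIntegral_le_integral hui (Eventually.of_forall hu)

lemma smoothing_eq_integral {x : X} (h : ∀ k, u k ≠ 0 → k⁻¹ • x ∈ S) : smoothing m u S x = ∫ k, u k ∂m :=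
  setIntegral_eq_integral_of_forall_compl_eq_zero fun k hk => by_contra fun h0 => hk (h k h0)

lemma smoothing_eq_zero {x : X} (h : ∀ k, u k ≠ 0 → k⁻¹ • x ∉ S) : smoothing m u S x = 0 := by
  exact setIntegral_eq_zero_of_forall_eq_zero fun k hk => by_contra fun h0 => h k h0 hk

variable (hS : ∀ x : X, MeasurableSet {k : G | k⁻¹ • x ∈ S})
include hS

/-- Left invariance of the measure moves the translation from the set to the kernel, so all
regularity comes from the kernel. -/
lemma smoothing_smul [IsTopologicalGroup G] (g : G) (x : X) :
    smoothing m u S (g • x) = ∫ k in {k | k⁻¹ • x ∈ S}, u (g * k) ∂m := by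
  rw [smoothing, ← integral_indicator (hS _), ← integral_indicator (hS _),
    ← integral_mul_left_eq_self _ g]
  congr 1
  ext k
  have : (g * k)⁻¹ • g • x = k⁻¹ • x := by rw [← mul_smul, mul_inv_rev, inv_mul_cancel_right]
  by_cases hk : k⁻¹ • x ∈ S
  · rw [indicator_of_mem (show g * k ∈ {k | k⁻¹ • g • x ∈ S} by rwa [mem_ofPred_eq, this]),
      indicator_of_mem (show k ∈ {k | k⁻¹ • x ∈ S} from hk)]
  · rw [indicator_of_notMem (show g * k ∉ {k | k⁻¹ • g • x ∈ S} by rwa [mem_ofPred_eq, this]),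
      indicator_of_notMem (show k ∉ {k | k⁻¹ • x ∈ S} from hk)]

/-- Differentiation under the integral sign; for |s| < 1 the integrands are dominated by a constant
on the compact set swept out by the support of u. -/
lemma lieDeriv_smoothing (hu : IsTest E u) (Y : TangentSpace 𝓘(ℝ, E) (1 : G)) :
    lieDeriv E Y (smoothing m u S) = smoothing m (lieDeriv E Y u) S := by
  have : IsTopologicalGroup G := topologicalGroup_of_lieGroup 𝓘(ℝ, E) ∞
  ext x
  set A := {k : G | k⁻¹ • x ∈ S} with hA
  have h1 : (fun s : ℝ => smoothing m u S (lieExp E (s • Y) • x)) =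
      fun s : ℝ => ∫ k in A, u (lieExp E (s • Y) * k) ∂m := by
    ext s; exact smoothing_smul m hS _ _
  have hcont : ∀ v : G → ℝ, IsTest E v → ∀ s : ℝ, Continuous (fun k => v (lieExp E (s • Y) * k)) :=
    fun v hv s => hv.contMDiff.continuous.comp (continuous_const.mul continuous_id)
  have hY := hu.lieDeriv Y
  obtain ⟨C, hC0, hC⟩ := hY.exists_bound
  set K := (fun q : ℝ × G => lieExp E (-(q.1 • Y)) * q.2) '' (Icc (-1) 1 ×ˢ tsupport u) with hK
  have hKc : IsCompact K := by
    refine (isCompact_Icc.prod hu.hasCompactSupport).image ?_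
    have : (fun q : ℝ × G => lieExp E (-(q.1 • Y)) * q.2) =
        fun q : ℝ × G => (lieExp E (q.1 • Y) : G)⁻¹ * q.2 := by
      ext q; rw [lieExp_neg]
    rw [this]
    exact (((contMDiff_lieExp_smul Y).continuous.comp continuous_fst).inv).mul continuous_snd
  have hbd : ∀ s ∈ Ioo (-1 : ℝ) 1, ∀ k, ‖lieDeriv E Y u (lieExp E (s • Y) * k)‖ ≤
      K.indicator (fun _ => C) k := by
    intro s hs k
    by_cases hk : k ∈ K
    · rw [indicator_of_mem hk]; exact hC _
    · rw [indicator_of_notMem hk, norm_le_zero_iff]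
      refine lieDeriv_eq_zero_of_notMem_tsupport Y fun hmem => hk ?_
      refine ⟨(s, lieExp E (s • Y) * k), ⟨⟨hs.1.le, hs.2.le⟩, hmem⟩, ?_⟩
      simp only [lieExp_neg, inv_mul_cancel_left]
  have key := hasDerivAt_integral_of_dominated_loc_of_deriv_le (μ := m.restrict A) (x₀ := (0 : ℝ))
    (F := fun s k => u (lieExp E (s • Y) * k)) (F' := fun s k => lieDeriv E Y u (lieExp E (s • Y) * k))
    (bound := K.indicator fun _ => C) (Ioo_mem_nhds (by norm_num : (-1 : ℝ) < 0) one_pos)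
    (Eventually.of_forall fun s => (hcont u hu s).aestronglyMeasurable) ?_
    (hcont _ hY 0).aestronglyMeasurable (Eventually.of_forall fun k s hs => hbd s hs k) ?_
    (Eventually.of_forall fun k s _ => hasDerivAt_comp_lieExp_mul hu.contMDiff Y k s)
  · have h2 := key.2.deriv
    rw [← h1] at h2
    simp only [zero_smul, lieExp_zero, one_mul] at h2
    exact h2
  · simp only [zero_smul, lieExp_zero, one_mul]
    exact (hu.integrable m).restrict
  · exact ((integrable_indicator_iff hKc.measurableSet).2
      (integrableOn_const hKc.measure_lt_top.ne)).restrict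

lemma wordDeriv_smoothing (hu : IsTest E u) (Y : Fin n → TangentSpace 𝓘(ℝ, E) (1 : G)) (w : List (Fin n)) :
    wordDeriv Y w (smoothing m u S) = smoothing m (wordDeriv Y w u) S := by
  induction w with
  | nil => rfl
  | cons i w ih =>
    have : wordDeriv Y (i :: w) (smoothing m u S) = lieDeriv E (Y i) (wordDeriv Y w (smoothing m u S)) := rfl
    rw [this, ih, lieDeriv_smoothing m hS (hu.wordDeriv Y w)]
    rfl

omit hS

-- A is merely measurable, so smoothness must come from the parameter. In the chart the integral
-- becomes a convolution with parameter, evaluated at 0, of the constant 1 with respect to the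
-- pushed-forward restricted measure. The neighbourhood N forces k into the chart domain whenever xk
-- lies in the support of u and x is near 1.
variable (E G) in
open scoped Convolution in
lemma eventually_contMDiffAt_setIntegral : ∃ N ∈ 𝓝 (1 : G), ∀ u : G → ℝ, ContMDiff 𝓘(ℝ, E) 𝓘(ℝ, ℝ) ∞ u →
    tsupport u ⊆ N → ∀ A : Set G, MeasurableSet A →
      ContMDiffAt 𝓘(ℝ, E) 𝓘(ℝ, ℝ) ∞ (fun g => ∫ k in A, u (g * k) ∂m) 1 := by
  have : IsTopologicalGroup G := topologicalGroup_of_lieGroup 𝓘(ℝ, E) ∞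
  have : LocallyCompactSpace G := Manifold.locallyCompact_of_finiteDimensional 𝓘(ℝ, E)
  borelize (LieAlg E G)
  obtain ⟨R, hR, hRs⟩ := Metric.eventually_nhds_iff_ball.1 (eventually_contMDiffAt_lieChartInv (E := E) (G := G))
  obtain ⟨N₀, hN₀, hN₀o, hN₀1⟩ := eventually_nhds_iff.1 ((eventually_lieChartInv_lieChart (E := E) (G := G)).and
    ((eventually_contMDiffAt_lieChart (E := E) (G := G)).and
      ((contMDiffAt_lieChart_one (E := E) (G := G)).continuousAt.eventually
        (by rw [lieChart_one]; exact Metric.ball_mem_nhds 0 (by positivity : 0 < R / 3)))))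
  obtain ⟨K, hK, hK1⟩ := exists_compact_mem_nhds (1 : G)
  set N₁ := N₀ ∩ interior K with hN₁
  have hN₁o : IsOpen N₁ := hN₀o.inter isOpen_interior
  have hN₁1 : N₁ ∈ 𝓝 (1 : G) := hN₁o.mem_nhds ⟨hN₀1, mem_interior_iff_mem_nhds.2 hK1⟩
  have hdiv : Tendsto (fun q : G × G => q.1⁻¹ * q.2) (𝓝 1 ×ˢ 𝓝 1) (𝓝 1) := by
    have h1 : Continuous (fun q : G × G => q.1⁻¹ * q.2) := by fun_prop
    have := h1.tendsto (1, 1)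
    rwa [nhds_prod_eq, inv_one, mul_one] at this
  obtain ⟨N', hN', N, hN, hsub⟩ := Filter.mem_prod_iff.1 (hdiv hN₁1)
  refine ⟨N, hN, fun u hu hsupp A hA => ?_⟩
  -- The cutoff equals 1 on the chart image of `N₀` and makes g compactly supported in its second
  -- variable inside the region where the inverse chart is smooth.
  let β : ContDiffBump (0 : LieAlg E G) := ⟨R / 3, R / 2, by positivity, by linarith⟩
  set μ' : Measure (LieAlg E G) := (m.restrict (A ∩ N₁)).map (lieChart E G) with hμ'
  have hmeas : AEMeasurable (lieChart E G) (m.restrict (A ∩ N₁)) := by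
    have : ContinuousOn (lieChart E G) N₁ := fun k hk => (hN₀ k hk.1).2.1.continuousAt.continuousWithinAt
    exact (this.aemeasurable hN₁o.measurableSet).mono_measure (Measure.restrict_mono inter_subset_right le_rfl)
  have hfin : IsFiniteMeasure (m.restrict (A ∩ N₁)) := by
    refine ⟨?_⟩
    rw [Measure.restrict_apply_univ]
    exact (measure_mono (inter_subset_right.trans (inter_subset_right.trans interior_subset))).trans_lt
      hK.measure_lt_top
  have hfin' : IsFiniteMeasure μ' := inferInstance
  -- The signs are opposite to the natural ones because the convolution at 0 evaluates `g p` at −t.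
  set g : LieAlg E G → LieAlg E G → ℝ := fun p t => β (-t) * u (lieChartInv p * lieChartInv (-t)) with hg
  set s : Set (LieAlg E G) := Metric.ball 0 R with hs
  have hgs : ContDiffOn ℝ ∞ (fun q : LieAlg E G × LieAlg E G => g q.1 q.2) (s ×ˢ univ) := by
    rintro ⟨p, t⟩ ⟨hp, -⟩
    refine ContDiffAt.contDiffWithinAt ?_
    by_cases ht : ‖t‖ < R
    · refine ContDiffAt.mul ?_ ?_
      · exact β.contDiff.contDiffAt.comp (p, t) contDiffAt_snd.neg
      · rw [← contMDiffAt_iff_contDiffAt]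
        have h1 : ContMDiffAt 𝓘(ℝ, LieAlg E G × LieAlg E G) 𝓘(ℝ, E) ∞
            (fun q : LieAlg E G × LieAlg E G => lieChartInv (G := G) q.1) (p, t) :=
          ContMDiffAt.comp (g := lieChartInv (G := G)) (p, t) (hRs p hp) contDiff_fst.contMDiff.contMDiffAt
        have h2 : ContMDiffAt 𝓘(ℝ, LieAlg E G × LieAlg E G) 𝓘(ℝ, E) ∞
            (fun q : LieAlg E G × LieAlg E G => lieChartInv (G := G) (-q.2)) (p, t) :=
          ContMDiffAt.comp (g := lieChartInv (G := G)) (p, t) (hRs (-t) (by rw [mem_ball_zero_iff, norm_neg]; exact ht))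
            contDiff_snd.neg.contMDiff.contMDiffAt
        exact hu.contMDiffAt.comp (p, t) (h1.mul h2)
    · refine (contDiffAt_const (c := (0 : ℝ))).congr_of_eventuallyEq ?_
      have h1 : ∀ᶠ q : LieAlg E G × LieAlg E G in 𝓝 (p, t), R / 2 < ‖q.2‖ :=
        (continuous_snd.norm.tendsto (p, t)).eventually (lt_mem_nhds (by simp only; linarith))
      filter_upwards [h1] with q hq
      have : β (-q.2) = 0 := by
        refine β.zero_of_le_dist ?_
        rw [dist_zero_right, norm_neg]; exact hq.le
      simp only [hg, this, zero_mul]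
  have hconv := contDiffOn_convolution_right_with_param (𝕜 := ℝ) (μ := μ') (n := (⊤ : ℕ∞))
    (f := fun _ : LieAlg E G => (1 : ℝ)) (ContinuousLinearMap.mul ℝ ℝ) (g := g) (s := s)
    (k := Metric.closedBall 0 (R / 2)) Metric.isOpen_ball (isCompact_closedBall 0 (R / 2))
    (fun p t _ ht => by
      have : β (-t) = 0 := by
        refine β.zero_of_le_dist ?_
        rw [dist_zero_right, norm_neg]
        simp only [Metric.mem_closedBall, dist_zero_right, not_le] at ht
        exact ht.le
      simp only [hg, this, zero_mul]) (integrable_const _).locallyIntegrable hgs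
  have h3 : ContDiffAt ℝ ∞ (fun p => ((fun _ : LieAlg E G => (1 : ℝ)) ⋆[ContinuousLinearMap.mul ℝ ℝ, μ'] g p) 0) 0 := by
    have h4 := hconv.contDiffAt (x := ((0 : LieAlg E G), (0 : LieAlg E G)))
      ((Metric.isOpen_ball.prod isOpen_univ).mem_nhds ⟨Metric.mem_ball_self hR, trivial⟩)
    exact ContDiffAt.comp (f := fun p : LieAlg E G => (p, (0 : LieAlg E G))) 0 h4
      (contDiffAt_id.prodMk contDiffAt_const)
  have h5 := ContMDiffAt.comp_of_eq (g := fun p => ((fun _ : LieAlg E G => (1 : ℝ))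
    ⋆[ContinuousLinearMap.mul ℝ ℝ, μ'] g p) 0) (f := lieChart E G) (x := (1 : G)) h3.contMDiffAt
    contMDiffAt_lieChart_one lieChart_one
  refine h5.congr_of_eventuallyEq ?_
  have hball : ∀ᶠ x in 𝓝 (1 : G), lieChart E G x ∈ s :=
    (contMDiffAt_lieChart_one (E := E) (G := G)).continuousAt.eventually
        (by rw [lieChart_one]; exact Metric.ball_mem_nhds 0 hR)
  filter_upwards [hN', hN₁1, hball] with x hx hx1 hxs
  have h6 : ∫ k in A, u (x * k) ∂m = ∫ k in A ∩ N₁, u (x * k) ∂m := by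
    refine setIntegral_eq_of_subset_of_forall_sdiff_eq_zero hA inter_subset_left fun k hk => ?_
    by_contra h0
    refine hk.2 ⟨hk.1, ?_⟩
    have := hsub (⟨hx, hsupp (subset_tsupport u h0)⟩ : (x, x * k) ∈ N' ×ˢ N)
    simpa using this
  have hcont : Continuous (fun t => g (lieChart E G x) (-t)) := by
    have h7 : ContDiffOn ℝ ∞ (fun t => g (lieChart E G x) (-t)) univ :=
      hgs.comp (f := fun t => (lieChart E G x, -t)) (contDiff_const.prodMk contDiff_neg).contDiffOn
        (fun t _ => ⟨hxs, trivial⟩)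
    exact (contDiffOn_univ.1 h7).continuous
  simp only [Function.comp_apply, convolution_def, ContinuousLinearMap.mul_apply', one_mul, zero_sub]
  rw [hμ', integral_map hmeas hcont.aestronglyMeasurable, h6]
  refine setIntegral_congr_fun (hA.inter hN₁o.measurableSet) fun k hk => ?_
  have hk' := hN₀ k hk.2.1
  simp only [hg, neg_neg]
  rw [(hN₀ x hx1.1).1, hk'.1, β.one_of_mem_closedBall (Metric.ball_subset_closedBall hk'.2.2), one_mul]

end Smoothing

/-! ### Approximate identities with polynomially growing derivatives. -/

section Kernel

variable {E : Type*} [NormedAddCommGroup E] [NormedSpace ℝ E] [FiniteDimensional ℝ E]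
  {G : Type*} [Group G] [MetricSpace G] [ChartedSpace E G] [LieGroup 𝓘(ℝ, E) ∞ G]
  [Bundle.RiemannianBundle (fun x : G => TangentSpace 𝓘(ℝ, E) x)]
  [IsContMDiffRiemannianBundle 𝓘(ℝ, E) ∞ E (fun x : G => TangentSpace 𝓘(ℝ, E) x)]
  [IsRiemannianManifold 𝓘(ℝ, E) G]

variable (E) in
lemma exists_nhds_contMDiff_smoothing [MeasurableSpace G] [BorelSpace G] (m : Measure G) [m.IsHaarMeasure] :
    ∃ N ∈ 𝓝 (1 : G), ∀ u : G → ℝ, IsTest E u → tsupport u ⊆ N → ∀ (X : Type _) [MulAction G X] (S : Set X),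
      (∀ x : X, MeasurableSet {k : G | k⁻¹ • x ∈ S}) → ∀ x : X,
      ContMDiff 𝓘(ℝ, E) 𝓘(ℝ, ℝ) ∞ (fun g : G => smoothing m u S (g • x)) := by
  have : IsTopologicalGroup G := topologicalGroup_of_lieGroup 𝓘(ℝ, E) ∞
  obtain ⟨N, hN, h⟩ := eventually_contMDiffAt_setIntegral E G m
  refine ⟨N, hN, fun u hu hsupp X _ S hS x g₀ => ?_⟩
  have h1 := h u hu.contMDiff hsupp _ (hS (g₀ • x))
  have h2 : ContMDiffAt 𝓘(ℝ, E) 𝓘(ℝ, E) ∞ (fun g : G => g * g₀⁻¹) g₀ := contMDiff_mul_right.contMDiffAt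
  have h3 := ContMDiffAt.comp_of_eq h1 h2 (mul_inv_cancel g₀)
  refine h3.congr_of_eventuallyEq (Eventually.of_forall fun g => ?_)
  have : g • x = (g * g₀⁻¹) • g₀ • x := by rw [← mul_smul, inv_mul_cancel_right]
  simp only [Function.comp_apply]
  rw [this, smoothing_smul m hS]

lemma eventually_dist_one_le (hG : IsRightInvariant E G) :
    ∀ᶠ g in 𝓝 (1 : G), dist g 1 ≤ 2 * ‖lieChart E G g‖ := by
  rw [← map_gexp_nhds_zero (E := E) hG, eventually_map]
  have h := (Asymptotics.isLittleO_iff.1 (hasStrictFDerivAt_lieChart_gexp (E := E) (G := G) hG).hasFDerivAt.isLittleO)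
    (by norm_num : (0 : ℝ) < 1 / 2)
  filter_upwards [h] with v hv
  simp only [gexp_zero, lieChart_one, sub_zero, ContinuousLinearMap.id_apply] at hv
  have h1 : ‖v‖ ≤ ‖lieChart E G (gexp v)‖ + ‖lieChart E G (gexp v) - v‖ := by
    have := norm_sub_le (lieChart E G (gexp v)) (lieChart E G (gexp v) - v)
    rwa [sub_sub_cancel] at this
  have h2 := dist_gexp_one_le hG v
  linarith

lemma exists_smooth_norm_sq : ∃ ρ : G → ℝ, ContMDiff 𝓘(ℝ, E) 𝓘(ℝ, ℝ) ∞ ρ ∧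
    ∀ᶠ g in 𝓝 (1 : G), ρ g = ‖lieChart E G g‖ ^ 2 := by
  obtain ⟨f, -, hf⟩ := (SmoothBumpFunction.nhds_basis_tsupport (I := 𝓘(ℝ, E)) (1 : G)).mem_iff.1
    (eventually_contMDiffAt_lieChart (E := E) (G := G))
  refine ⟨fun g => f g • ‖lieChart E G g‖ ^ 2, ?_, ?_⟩
  · refine contMDiff_of_tsupport fun g hg => ?_
    have h1 : ContMDiffAt 𝓘(ℝ, E) 𝓘(ℝ, LieAlg E G) ∞ (lieChart E G) g := hf (tsupport_smul_subset_left _ _ hg)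
    have h2 : ContMDiffAt 𝓘(ℝ, E) 𝓘(ℝ, ℝ) ∞ (fun g => ‖lieChart E G g‖ ^ 2) g :=
      ContMDiffAt.comp (g := fun v : LieAlg E G => ‖v‖ ^ 2) g (contDiff_norm_sq ℝ).contMDiff.contMDiffAt h1
    exact f.contMDiffAt.smul h2
  · filter_upwards [f.eventuallyEq_one] with g hg
    simp [hg]

/-- The ball contains the exponential of the ball of the same radius, whose Haar measure is at least
a constant times its Lebesgue measure. -/
lemma exists_le_measureReal_ball (hG : IsRightInvariant E G) [MeasurableSpace G] [BorelSpace G]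
    [SecondCountableTopology G] (m : Measure G) [m.IsHaarMeasure] :
    ∃ c > 0, ∃ s₀ > 0, ∀ s, 0 < s → s < s₀ → c * s ^ (Module.finrank ℝ (LieAlg E G)) ≤ m.real (Metric.ball 1 s) := by
  have : IsTopologicalGroup G := topologicalGroup_of_lieGroup 𝓘(ℝ, E) ∞
  have : LocallyCompactSpace G := Manifold.locallyCompact_of_finiteDimensional 𝓘(ℝ, E)
  borelize (LieAlg E G)
  obtain ⟨ρ, hρ, hbl⟩ := exists_gexp_biLipschitz (E := E) (G := G) hG
  have hn : (gexp : LieAlg E G → G) '' Metric.ball 0 ρ ∈ 𝓝 1 := by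
    rw [← map_gexp_nhds_zero (E := E) hG]; exact image_mem_map (Metric.ball_mem_nhds 0 hρ)
  obtain ⟨c, C, hc, hc', -, -, h⟩ := exists_haar_image_comparison (e := (gexp : LieAlg E G → G)) m
    (dist_mul_right_of_isRightInvariant hG) hbl hρ gexp_zero gexp_neg hn
  obtain ⟨K, hK, hK1⟩ := exists_compact_mem_nhds (1 : G)
  obtain ⟨s₁, hs₁, hs₁K⟩ := Metric.mem_nhds_iff.1 hK1
  have hv : 0 < (volume (Metric.ball (0 : LieAlg E G) 1)).toReal :=
    ENNReal.toReal_pos (Metric.measure_ball_pos _ _ one_pos).ne' measure_ball_lt_top.ne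
  refine ⟨c.toReal * (volume (Metric.ball (0 : LieAlg E G) 1)).toReal,
    mul_pos (ENNReal.toReal_pos hc hc') hv, min ρ s₁, lt_min hρ hs₁, fun s hs hs' => ?_⟩
  have h1 := (h (Metric.ball 0 s) (Metric.ball_subset_ball (hs'.le.trans (min_le_left _ _)))).1
  have h2 : (gexp : LieAlg E G → G) '' Metric.ball 0 s ⊆ Metric.ball 1 s := by
    rintro _ ⟨v, hv, rfl⟩
    exact (dist_gexp_one_le hG v).trans_lt (mem_ball_zero_iff.1 hv)
  have h3 : m (Metric.ball 1 s) ≠ ⊤ :=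
    ((measure_mono ((Metric.ball_subset_ball (hs'.le.trans (min_le_right _ _))).trans hs₁K)).trans_lt
      hK.measure_lt_top).ne
  have h4 := ENNReal.toReal_mono h3 (h1.trans (measure_mono h2))
  rw [Measure.addHaar_ball_of_pos _ _ hs, ENNReal.toReal_mul, ENNReal.toReal_mul,
    ENNReal.toReal_ofReal (by positivity)] at h4
  calc _ = _ := by ring
    _ ≤ _ := h4

lemma wordDeriv_const_mul {X : Type*} [SMul G X] {n : ℕ} (Y : Fin n → TangentSpace 𝓘(ℝ, E) (1 : G))
    (w : List (Fin n)) (a : ℝ) (φ : X → ℝ) :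
    wordDeriv Y w (fun x => a * φ x) = fun x => a * wordDeriv Y w φ x := by
  induction w with
  | nil => rfl
  | cons i w ih =>
    have : wordDeriv Y (i :: w) (fun x => a * φ x) = lieDeriv E (Y i) (wordDeriv Y w (fun x => a * φ x)) := rfl
    rw [this, ih]
    ext x
    exact lieDeriv_const_mul _ a _ x

/-- The kernel is the normalization of b · χ(a ρ), where ρ is the squared chart norm near 1 and a =
8/ε². Its mass before normalization is at least a constant times ε^d and every derivative costs a
factor of order ε⁻², whence the exponent 2ℓ + d. -/
theorem exists_smooth_kernel (hG : IsRightInvariant E G) [MeasurableSpace G] [BorelSpace G]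
    [SecondCountableTopology G] (m : Measure G) [m.IsHaarMeasure] {n : ℕ}
    (Y : Fin n → TangentSpace 𝓘(ℝ, E) (1 : G)) (ℓ : ℕ) {N : Set G} (hN : N ∈ 𝓝 1) :
    ∃ C > 0, ∃ M : ℕ, ∃ ε₀ > 0, ∀ ε, 0 < ε → ε < ε₀ → ∃ θ : G → ℝ, IsTest E θ ∧ (∀ k, 0 ≤ θ k) ∧
      tsupport θ ⊆ N ∧ (∀ k, θ k ≠ 0 → dist k 1 < ε) ∧ ∫ k, θ k ∂m = 1 ∧
      ∀ w : List (Fin n), w.length ≤ ℓ → ∫ k, |wordDeriv Y w θ k| ∂m ≤ C * (1 / ε) ^ M := by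
  have : IsTopologicalGroup G := topologicalGroup_of_lieGroup 𝓘(ℝ, E) ∞
  obtain ⟨ρ, hρ, hρe⟩ := exists_smooth_norm_sq (E := E) (G := G)
  obtain ⟨b, -, hbN⟩ := (SmoothBumpFunction.nhds_basis_tsupport (I := 𝓘(ℝ, E)) (1 : G)).mem_iff.1
    (inter_mem hN (hρe.and (eventually_dist_one_le (E := E) hG)))
  have hb : IsTest E b := ⟨b.contMDiff, b.hasCompactSupport⟩
  let χ : ContDiffBump (0 : ℝ) := ⟨1, 2, one_pos, one_lt_two⟩
  have hB := fun j : ℕ => exists_bound_wordDeriv hρ Y j hb χ.contDiff χ.hasCompactSupport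
  choose D hD0 hD using hB
  obtain ⟨c, hc, s₀, hs₀, hball⟩ := exists_le_measureReal_ball (E := E) hG m
  set d := Module.finrank ℝ (LieAlg E G)
  have hnear : ∀ᶠ g in 𝓝 (1 : G), b g = 1 ∧ ρ g = ‖lieChart E G g‖ ^ 2 ∧ ‖lieChart E G g‖ ≤ (1 + 1) * dist g 1 :=
    b.eventuallyEq_one.and (hρe.and (eventually_norm_lieChart_le hG one_pos))
  obtain ⟨s₁, hs₁, hnear⟩ := Metric.eventually_nhds_iff_ball.1 hnear
  set D' : ℝ := ∑ j ∈ Finset.range (ℓ + 1), D j * 8 ^ j with hD'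
  have hD'0 : 0 ≤ D' := Finset.sum_nonneg fun j _ => mul_nonneg (hD0 j) (by positivity)
  set T := m.real (tsupport b) with hT
  refine ⟨D' * T * 6 ^ d / c + 1, by positivity, 2 * ℓ + d, min 1 (min s₀ s₁), by positivity, fun ε hε hε' => ?_⟩
  have hε1 : ε < 1 := hε'.trans_le (min_le_left _ _)
  have hεs₀ : ε < s₀ := hε'.trans_le ((min_le_right _ _).trans (min_le_left _ _))
  have hεs₁ : ε < s₁ := hε'.trans_le ((min_le_right _ _).trans (min_le_right _ _))
  -- If dist(k, 1) < ε/6 then the chart norm is at most ε/3 and aρ ≤ 8/9, so the cutoff is 1. If aρ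
  -- < 2 then the chart norm is below ε/2 and dist(k, 1) < ε.
  set a : ℝ := 8 / ε ^ 2 with ha
  have ha1 : 1 ≤ a := by
    rw [ha, le_div_iff₀ (by positivity)]; nlinarith
  set θ₀ : G → ℝ := fun x => b x * χ (a * ρ x) with hθ₀
  have hχm : ContMDiff 𝓘(ℝ, ℝ) 𝓘(ℝ, ℝ) ∞ χ := χ.contDiff.contMDiff
  have hθm : ContMDiff 𝓘(ℝ, E) 𝓘(ℝ, ℝ) ∞ θ₀ :=
    b.contMDiff.mul (hχm.comp (contMDiff_const.mul hρ))
  have htest : IsTest E θ₀ := ⟨hθm, b.hasCompactSupport.mul_right⟩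
  have hts : tsupport θ₀ ⊆ tsupport b := tsupport_mul_subset_left
  have hθ0 : ∀ k, 0 ≤ θ₀ k := fun k => mul_nonneg b.nonneg χ.nonneg
  have hint := htest.integrable m
  have hTfin : m (tsupport b) ≠ ⊤ := b.hasCompactSupport.measure_lt_top.ne
  have hlow : c * (ε / 6) ^ d ≤ ∫ k, θ₀ k ∂m := by
    refine (hball (ε / 6) (by positivity) (by linarith)).trans ?_
    have hone : ∀ k ∈ Metric.ball (1 : G) (ε / 6), θ₀ k = 1 := by
      intro k hk
      have hk' : dist k 1 < ε / 6 := hk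
      obtain ⟨h1, h2, h3⟩ := hnear k (Metric.ball_subset_ball (by linarith) hk)
      have h4 : ‖lieChart E G k‖ ≤ ε / 3 := by linarith
      have h5 : a * ρ k ≤ 1 := by
        rw [h2, ha, div_mul_eq_mul_div, div_le_one (by positivity)]
        nlinarith [norm_nonneg (lieChart E G k)]
      have h6 : 0 ≤ a * ρ k := by rw [h2]; positivity
      have h7 : χ (a * ρ k) = 1 := by
        refine χ.one_of_mem_closedBall ?_
        rw [mem_closedBall_zero_iff, Real.norm_eq_abs, abs_of_nonneg h6]; exact h5
      simp only [hθ₀, h1, h7, mul_one]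
    have hfin : m (Metric.ball (1 : G) (ε / 6)) ≠ ⊤ := by
      refine ((measure_mono ?_).trans_lt b.hasCompactSupport.measure_lt_top).ne
      intro k hk
      refine hts (subset_tsupport _ ?_)
      rw [Function.mem_support, hone k hk]; exact one_ne_zero
    calc m.real (Metric.ball (1 : G) (ε / 6)) = ∫ k in Metric.ball (1 : G) (ε / 6), (1 : ℝ) ∂m := by simp
      _ = ∫ k in Metric.ball (1 : G) (ε / 6), θ₀ k ∂m :=
        (setIntegral_congr_fun Metric.isOpen_ball.measurableSet hone).symm
      _ ≤ _ := setIntegral_le_integral hint (Eventually.of_forall hθ0)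
  set J := ∫ k, θ₀ k ∂m with hJ
  have hJ0 : 0 < J := lt_of_lt_of_le (by positivity) hlow
  have hup : ∀ w : List (Fin n), w.length ≤ ℓ → ∫ k, |wordDeriv Y w θ₀ k| ∂m ≤ D' * T * (1 / ε) ^ (2 * ℓ) := by
    intro w hw
    have h1 : ∀ k, |wordDeriv Y w θ₀ k| ≤ (tsupport b).indicator (fun _ => D' * (1 / ε) ^ (2 * ℓ)) k := by
      intro k
      by_cases hk : k ∈ tsupport b
      · rw [indicator_of_mem hk]
        refine (hD w.length w rfl a ha1 k).trans ?_
        have h2 : a ^ w.length = 8 ^ w.length * (1 / ε) ^ (2 * w.length) := by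
          rw [pow_mul, ← mul_pow, ha, one_div, inv_pow, div_eq_mul_inv]
        rw [h2, ← mul_assoc]
        refine mul_le_mul ?_ (pow_le_pow_right₀ ((one_le_div hε).2 hε1.le) (by omega)) (by positivity) hD'0
        exact Finset.single_le_sum (f := fun j => D j * 8 ^ j) (fun j _ => mul_nonneg (hD0 j) (by positivity))
          (Finset.mem_range.2 (by omega))
      · rw [indicator_of_notMem hk]
        have : wordDeriv Y w θ₀ k = 0 := by
          by_contra h0
          exact hk (hts (tsupport_wordDeriv_subset Y w (subset_tsupport _ h0)))
        rw [this, abs_zero]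
    have hmt : MeasurableSet (tsupport b) := (isClosed_tsupport _).measurableSet
    calc ∫ k, |wordDeriv Y w θ₀ k| ∂m ≤ ∫ k, (tsupport b).indicator (fun _ => D' * (1 / ε) ^ (2 * ℓ)) k ∂m :=
          integral_mono ((htest.wordDeriv Y w).integrable m).abs
            ((integrable_indicator_iff hmt).2 (integrableOn_const hTfin)) h1
      _ = D' * T * (1 / ε) ^ (2 * ℓ) := by
          rw [integral_indicator hmt, setIntegral_const, smul_eq_mul]; ring
  have hkey : J⁻¹ ≤ 6 ^ d / c * (1 / ε) ^ d := by
    refine (inv_anti₀ (by positivity) hlow).trans (le_of_eq ?_)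
    rw [div_pow, one_div, inv_pow]; field_simp
  refine ⟨fun k => J⁻¹ * θ₀ k, ⟨contMDiff_const.mul hθm, htest.hasCompactSupport.mul_left⟩,
    fun k => mul_nonneg (inv_nonneg.2 hJ0.le) (hθ0 k), ?_, ?_, ?_, ?_⟩
  · exact (tsupport_mul_subset_right (f := fun _ => J⁻¹)).trans (hts.trans fun k hk => (hbN hk).1)
  · intro k hk
    have h1 : b k ≠ 0 := fun h => hk (by simp [hθ₀, h])
    have h2 : χ (a * ρ k) ≠ 0 := fun h => hk (by simp [hθ₀, h])
    obtain ⟨-, h3, h4⟩ := hbN (subset_tsupport _ h1)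
    have h5 : a * ρ k < 2 := by
      by_contra! h
      exact h2 (χ.zero_of_le_dist (by rw [dist_zero_right]; exact h.trans (le_abs_self _)))
    rw [h3, ha, div_mul_eq_mul_div, div_lt_iff₀ (by positivity)] at h5
    have h6 : 2 * ‖lieChart E G k‖ < ε := lt_of_pow_lt_pow_left₀ 2 hε.le (by nlinarith)
    linarith
  · rw [integral_const_mul, inv_mul_cancel₀ hJ0.ne']
  · intro w hw
    have h1 : wordDeriv Y w (fun k => J⁻¹ * θ₀ k) = fun k => J⁻¹ * wordDeriv Y w θ₀ k := by
      have := wordDeriv_const_mul Y w J⁻¹ θ₀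
      exact this
    rw [h1]
    simp only [abs_mul, abs_of_pos (inv_pos.2 hJ0)]
    rw [integral_const_mul]
    have h2 : 0 ≤ ∫ k, |wordDeriv Y w θ₀ k| ∂m := integral_nonneg fun _ => abs_nonneg _
    calc J⁻¹ * ∫ k, |wordDeriv Y w θ₀ k| ∂m ≤ (6 ^ d / c * (1 / ε) ^ d) * (D' * T * (1 / ε) ^ (2 * ℓ)) :=
          mul_le_mul hkey (hup w hw) h2 (by positivity)
      _ = (D' * T * 6 ^ d / c) * (1 / ε) ^ (2 * ℓ + d) := by rw [pow_add]; ring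
      _ ≤ _ := by
        refine mul_le_mul_of_nonneg_right (by linarith) (by positivity)

section Norms

variable {X : Type*} [SMul G X] {ψ : X → ℝ} {ℓ : ℕ} {K : ℝ}

lemma abs_multiDeriv_le (hK : ∀ w : List (Fin (Module.finrank ℝ (TangentSpace 𝓘(ℝ, E) (1 : G)))),
    w.length ≤ ℓ → ∀ x, |wordDeriv (lieBasis E G) w ψ x| ≤ K)
    (α : Fin (Module.finrank ℝ (TangentSpace 𝓘(ℝ, E) (1 : G))) → ℕ) (hα : ∑ i, α i ≤ ℓ) (x : X) :
    ‖multiDeriv E (lieBasis E G) α ψ x‖ ≤ K := by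
  obtain ⟨w, hw, h⟩ := exists_word_multiDeriv (E := E) (G := G) α
  rw [h X, Real.norm_eq_abs]
  exact hK w (hw.le.trans hα) x

lemma cNorm_le (hK : ∀ w : List (Fin (Module.finrank ℝ (TangentSpace 𝓘(ℝ, E) (1 : G)))),
    w.length ≤ ℓ → ∀ x, |wordDeriv (lieBasis E G) w ψ x| ≤ K) : cNorm E G ℓ ψ ≤ ENNReal.ofReal K := by
  refine iSup_le fun x => iSup_le fun α => iSup_le fun hα => ?_
  rw [← ofReal_norm]
  exact ENNReal.ofReal_le_ofReal (abs_multiDeriv_le hK α hα x)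

variable (E G ℓ) in
lemma exists_sobolevNorm_le : ∃ A > 0, ∀ {X : Type _} [SMul G X] [MeasurableSpace X] (μ : Measure X)
    [IsProbabilityMeasure μ] {ψ : X → ℝ} {K : ℝ},
    (∀ w : List (Fin (Module.finrank ℝ (TangentSpace 𝓘(ℝ, E) (1 : G)))),
      w.length ≤ ℓ → ∀ x, |wordDeriv (lieBasis E G) w ψ x| ≤ K) →
    sobolevNorm E G μ ℓ ψ ≤ ENNReal.ofReal (A * K) := by
  have hfin : Finite {α : Fin (Module.finrank ℝ (TangentSpace 𝓘(ℝ, E) (1 : G))) → ℕ // ∑ i, α i ≤ ℓ} := by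
    refine Set.Finite.subset (Set.Finite.pi' fun _ => Set.finite_Iic ℓ) fun α hα i => ?_
    exact (Finset.single_le_sum (f := α) (fun _ _ => Nat.zero_le _) (Finset.mem_univ i)).trans hα
  have := Fintype.ofFinite {α : Fin (Module.finrank ℝ (TangentSpace 𝓘(ℝ, E) (1 : G))) → ℕ // ∑ i, α i ≤ ℓ}
  refine ⟨Fintype.card {α : Fin (Module.finrank ℝ (TangentSpace 𝓘(ℝ, E) (1 : G))) → ℕ // ∑ i, α i ≤ ℓ} + 1,
    by positivity, fun {X} _ _ μ _ ψ K hK => ?_⟩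
  have h1 : ∀ α : {α : Fin (Module.finrank ℝ (TangentSpace 𝓘(ℝ, E) (1 : G))) → ℕ // ∑ i, α i ≤ ℓ},
      eLpNorm (multiDeriv E (lieBasis E G) α.1 ψ) 2 μ ≤ ENNReal.ofReal K := fun α => by
    refine (eLpNorm_le_of_ae_bound (Eventually.of_forall (abs_multiDeriv_le hK α.1 α.2))).trans ?_
    simp
  rw [sobolevNorm, tsum_fintype]
  refine (Finset.sum_le_card_nsmul _ _ _ fun α _ => h1 α).trans ?_
  rw [nsmul_eq_mul, Finset.card_univ, ENNReal.ofReal_mul (by positivity)]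
  gcongr
  rw [← ENNReal.ofReal_natCast]
  exact ENNReal.ofReal_le_ofReal (by linarith)

end Norms

lemma abs_wordDeriv_smoothing_le [MeasurableSpace G] [BorelSpace G] (m : Measure G) [m.IsHaarMeasure]
    {X : Type*} [MulAction G X] {S : Set X} (hS : ∀ x : X, MeasurableSet {k : G | k⁻¹ • x ∈ S}) {u : G → ℝ}
    (hu : IsTest E u) {n : ℕ} (Y : Fin n → TangentSpace 𝓘(ℝ, E) (1 : G)) (w : List (Fin n)) (x : X) :
    |wordDeriv Y w (smoothing m u S) x| ≤ ∫ k, |wordDeriv Y w u k| ∂m := by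
  rw [wordDeriv_smoothing m hS hu]
  exact abs_smoothing_le m ((hu.wordDeriv Y w).integrable m) x

end Kernel

/-! ### Volumes of boxes and of their thickenings, and counting by volume. -/

lemma pow_sub_pow_le {x y M : ℝ} (hy : 0 ≤ y) (hxy : y ≤ x) (hx : x ≤ M) (hM : 1 ≤ M) (n : ℕ) :
    x ^ n - y ^ n ≤ n * M ^ n * (x - y) := by
  induction n with
  | zero => simp
  | succ n ih =>
    have h1 : x ^ (n + 1) - y ^ (n + 1) = x * (x ^ n - y ^ n) + y ^ n * (x - y) := by ring
    have h2 : x * (x ^ n - y ^ n) ≤ M * (n * M ^ n * (x - y)) :=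
      mul_le_mul hx ih (sub_nonneg.2 (pow_le_pow_left₀ hy hxy n)) (by linarith)
    have h3 : y ^ n ≤ M ^ (n + 1) :=
      (pow_le_pow_left₀ hy (hxy.trans hx) n).trans (pow_le_pow_right₀ hM (Nat.le_succ n))
    have h4 : y ^ n * (x - y) ≤ M ^ (n + 1) * (x - y) := mul_le_mul_of_nonneg_right h3 (by linarith)
    rw [h1]
    push_cast
    calc _ ≤ M * (n * M ^ n * (x - y)) + M ^ (n + 1) * (x - y) := add_le_add h2 h4
      _ = _ := by ring

lemma volume_cube {V : Type*} [NormedAddCommGroup V] [InnerProductSpace ℝ V] [FiniteDimensional ℝ V]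
    [MeasurableSpace V] [BorelSpace V] {n : ℕ} (X : OrthonormalBasis (Fin n) ℝ V) (s : ℝ) :
    volume (cube X s) = ENNReal.ofReal s ^ n := by
  have h1 : MeasurePreserving (fun v i => X.repr v i) (volume : Measure V) volume :=
    (PiLp.volume_preserving_ofLp (Fin n)).comp X.measurePreserving_repr
  have h2 : cube X s = (fun v i => X.repr v i) ⁻¹' (Set.pi univ fun _ => Ioo (-(s / 2)) (s / 2)) := by
    ext v; simp [cube, abs_lt]
  rw [h2, h1.measure_preimage (MeasurableSet.univ_pi fun _ => measurableSet_Ioo).nullMeasurableSet,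
    Real.volume_pi_Ioo]
  simp

lemma exists_finset_of_card_mul_le {α : Type*} {Λ : Set α} {a b : ENNReal} (ha : a ≠ 0) (hb : b ≠ ⊤)
    (h : ∀ s : Finset α, (s : Set α) ⊆ Λ → s.card * a ≤ b) : Λ.Finite := by
  by_contra hinf
  obtain ⟨k, hk⟩ := ENNReal.exists_nat_mul_gt ha hb
  obtain ⟨s, hs, hsc⟩ := (show Λ.Infinite from hinf).exists_subset_card_eq k
  have := h s hs
  rw [hsc] at this
  exact absurd this hk.not_ge

namespace IsExpandingExp

variable {V : Type*} [NormedAddCommGroup V] [InnerProductSpace ℝ V] [FiniteDimensional ℝ V]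
  {P : Type*} [Group P] [MetricSpace P] [IsTopologicalGroup P] [ConnectedSpace P]
  {n : ℕ} {e : V → P} {c : ℝ → P →* P} {b : Module.Basis (Fin n) ℝ V} {w : Fin n → ℝ}
  (h : IsExpandingExp e c b w)
  [LocallyCompactSpace P] [SecondCountableTopology P] [MeasurableSpace P] [BorelSpace P]
  (ν : Measure P) [ν.IsHaarMeasure] (X : OrthonormalBasis (Fin n) ℝ V)
include h

/-- In exponential coordinates the thickening stays in the cube of side s + 8ε, whose excess volume
is linear in ε uniformly for s ≤ 1. The error is additive; it becomes relative only after division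
by the measure of the box. -/
lemma exists_measure_thickening_le {rs : ℝ} (hrs : 0 < rs) (hb : BiLipOnBall e rs) :
    ∃ C > 0, ∃ ε₀ > 0, ∀ s, 0 < s → s ≤ 1 → s / 2 * √(n : ℝ) ≤ rs / 2 → ∀ ε, 0 < ε → ε ≤ ε₀ →
      ν (Metric.thickening ε (closure (e '' cube X s))) ≤ ν (e '' cube X s) + ENNReal.ofReal (C * ε) := by
  borelize V
  obtain ⟨k, K, hk0, hkt, hK0, hKt, hcomp⟩ := exists_haar_image_comparison ν h.dist_mul_right hb hrs
    h.exp_zero h.exp_neg (h.image_ball_mem_nhds hrs)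
  have hcpt : IsCompact (e '' Metric.closedBall 0 (rs / 2)) :=
    (isCompact_closedBall 0 (rs / 2)).image h.isHomeomorph_exp.continuous
  -- Compactness gives one threshold, independent of s, below which the thickenings stay in the
  -- image of the bi-Lipschitz ball.
  obtain ⟨δ, hδ, hthick⟩ := hcpt.exists_thickening_subset_open
    (h.isHomeomorph_exp.isOpenMap _ (Metric.isOpen_ball (x := (0 : V)) (ε := rs)))
    (image_mono (Metric.closedBall_subset_ball (by linarith)))
  refine ⟨(K.toReal + 1) * (n * 9 ^ n * 8) + 1, by positivity, min δ 1, by positivity,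
    fun s hs hs1 hsr ε hε hε' => ?_⟩
  have hεδ := hε'.trans (min_le_left _ _)
  have hε1 := hε'.trans (min_le_right _ _)
  rw [h.closure_image_cube X hs]
  set D := (cube X (s + 8 * ε) \ cube X s) ∩ Metric.ball 0 rs with hD
  have hsub : Metric.thickening ε (e '' {v | ∀ i, |X.repr v i| ≤ s / 2}) ⊆ e '' cube X s ∪ e '' D := by
    intro x hx
    obtain ⟨_, ⟨v, hv, rfl⟩, hd⟩ := Metric.mem_thickening_iff.1 hx
    have hvn : ‖v‖ ≤ rs / 2 := (norm_le_of_abs_repr_le X (by positivity) hv).trans hsr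
    have hxU : x ∈ Metric.thickening δ (e '' Metric.closedBall 0 (rs / 2)) :=
      Metric.mem_thickening_iff.2 ⟨e v, ⟨v, by simpa using hvn, rfl⟩, hd.trans_le hεδ⟩
    obtain ⟨v', hv', rfl⟩ := hthick hxU
    rw [← image_union]
    refine ⟨v', ?_, rfl⟩
    by_cases hc : v' ∈ cube X s
    · exact Or.inl hc
    refine Or.inr ⟨⟨fun i => ?_, hc⟩, hv'⟩
    have h1 := (hb v' v (by simpa using hv') (by linarith)).1
    have h2 : |X.repr v' i - X.repr v i| ≤ ‖v' - v‖ := by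
      have := PiLp.norm_apply_le (X.repr (v' - v)) i
      rwa [LinearIsometryEquiv.norm_map, map_sub, PiLp.sub_apply, Real.norm_eq_abs] at this
    have h3 : |X.repr v' i| ≤ |X.repr v i| + |X.repr v' i - X.repr v i| := by
      have := abs_add_le (X.repr v i) (X.repr v' i - X.repr v i)
      rwa [add_sub_cancel] at this
    have h4 := hv i
    linarith
  have hvol : volume D ≤ ENNReal.ofReal (n * 9 ^ n * 8 * ε) := by
    refine (measure_mono inter_subset_left).trans ?_
    have h1 : cube X s ⊆ cube X (s + 8 * ε) := fun v hv i => (hv i).trans (by linarith)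
    rw [measure_sdiff h1 (isOpen_cube X s).measurableSet.nullMeasurableSet
      (by rw [volume_cube]; exact ENNReal.pow_ne_top ENNReal.ofReal_ne_top), volume_cube, volume_cube,
      ← ENNReal.ofReal_pow (by positivity), ← ENNReal.ofReal_pow hs.le, ← ENNReal.ofReal_sub _ (by positivity)]
    refine ENNReal.ofReal_le_ofReal ((pow_sub_pow_le hs.le (by linarith) (show s + 8 * ε ≤ 9 by linarith)
      (by norm_num) n).trans (le_of_eq (by ring)))
  refine (measure_mono hsub).trans ((measure_union_le _ _).trans ?_)
  gcongr
  refine ((hcomp D inter_subset_right).2.trans (mul_le_mul_right hvol K)).trans ?_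
  rw [show K * ENNReal.ofReal (n * 9 ^ n * 8 * ε) = ENNReal.ofReal (K.toReal * (n * 9 ^ n * 8 * ε)) by
    rw [ENNReal.ofReal_mul ENNReal.toReal_nonneg, ENNReal.ofReal_toReal hKt]]
  refine ENNReal.ofReal_le_ofReal ?_
  have h5 : 0 ≤ n * 9 ^ n * 8 * ε := by positivity
  nlinarith

lemma exists_le_measure_image_cube {rs : ℝ} (hrs : 0 < rs) (hb : BiLipOnBall e rs) :
    ∃ k > 0, ∀ s, 0 < s → s / 2 * √(n : ℝ) < rs → ENNReal.ofReal (k * s ^ n) ≤ ν (e '' cube X s) := by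
  borelize V
  obtain ⟨k, K, hk0, hkt, hK0, hKt, hcomp⟩ := exists_haar_image_comparison ν h.dist_mul_right hb hrs
    h.exp_zero h.exp_neg (h.image_ball_mem_nhds hrs)
  refine ⟨k.toReal, ENNReal.toReal_pos hk0 hkt, fun s hs hsr => ?_⟩
  refine le_trans (le_of_eq ?_) (hcomp (cube X s) fun v hv => ?_).1
  · rw [volume_cube, ENNReal.ofReal_mul ENNReal.toReal_nonneg, ENNReal.ofReal_toReal hkt, ENNReal.ofReal_pow hs.le]
  · rw [mem_ball_zero_iff]
    exact (norm_le_of_abs_repr_le X (by positivity) fun i => (hv i).le).trans_lt hsr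

/-- The translates of a tessellation domain which are needed to cover `c t '' A` can be counted by comparing
measures. -/
lemma exists_finset_cover {U Λ : Set P} (hU : IsTessellationDomain ν U Λ) {t : ℝ} {A W : Set P}
    (hW : ν W ≠ ⊤) (hU0 : ν U ≠ 0)
    (hAW : ∀ γ, (∃ x ∈ A, ∃ v ∈ closure U, c t x = v * γ) → ∀ y, (∃ v ∈ U, c t y = v * γ) → y ∈ W) :
    ∃ 𝓖 : Finset P, (∀ x ∈ A, ∃ γ ∈ 𝓖, ∃ v ∈ closure U, c t x = v * γ) ∧
      𝓖.card * (ENNReal.ofReal (Real.exp (-t * ∑ i, w i)) * ν U) ≤ ν W := by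
  have := h.isMulRightInvariant ν
  set Λ' := {γ ∈ Λ | ∃ x ∈ A, ∃ v ∈ closure U, c t x = v * γ} with hΛ'
  set cell : P → Set P := fun γ => c (-t) '' ((fun v => v * γ) '' U) with hcell
  -- All cells have the same measure: the flow scales it and unimodularity removes the right
  -- translation by γ.
  have hmeas : ∀ γ, ν (cell γ) = ENNReal.ofReal (Real.exp (-t * ∑ i, w i)) * ν U := fun γ => by
    rw [hcell, h.measure_image_map, image_mul_right, measure_preimage_mul_right]
  have hopen : ∀ γ, IsOpen (cell γ) := fun γ => by
    simp only [hcell]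
    rw [h.image_eq_preimage]
    exact ((isOpenMap_mul_right γ) _ hU.isOpen).preimage (h.continuous _)
  have hinj : Function.Injective (c (-t)) := Function.LeftInverse.injective (g := c t) (h.map_map_neg t)
  have hcard : ∀ s : Finset P, (s : Set P) ⊆ Λ' →
      s.card * (ENNReal.ofReal (Real.exp (-t * ∑ i, w i)) * ν U) ≤ ν W := by
    intro s hs
    have h1 : ν (⋃ γ ∈ s, cell γ) = ∑ γ ∈ s, ν (cell γ) := by
      refine measure_biUnion_finset (fun γ hγ γ' hγ' hne => ?_) fun γ _ => (hopen γ).measurableSet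
      -- Disjointness is used for the open cells only, while covering uses their closures.
      exact (disjoint_image_iff hinj).2 (hU.disjoint γ (hs hγ).1 γ' (hs hγ').1 hne)
    rw [Finset.sum_congr rfl fun γ _ => hmeas γ, Finset.sum_const, nsmul_eq_mul] at h1
    rw [← h1]
    refine measure_mono (iUnion₂_subset fun γ hγ => ?_)
    rintro _ ⟨_, ⟨v, hv, rfl⟩, rfl⟩
    exact hAW γ (hs hγ).2 _ ⟨v, hv, h.map_map_neg t _⟩
  have hfin : Λ'.Finite := exists_finset_of_card_mul_le
    (mul_ne_zero (by simp [Real.exp_pos]) hU0) hW hcard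
  refine ⟨hfin.toFinset, fun x hx => ?_, hcard _ (by simp)⟩
  have h2 : c t x ∈ ⋃ γ ∈ Λ, (fun v => v * γ) '' closure U := by rw [hU.cover]; trivial
  simp only [mem_iUnion] at h2
  obtain ⟨γ, hγ, v, hv, hvγ⟩ := h2
  exact ⟨γ, hfin.mem_toFinset.2 ⟨hγ, x, hx, v, hv, hvγ.symm⟩, v, hv, hvγ.symm⟩

end IsExpandingExp

/-! ### Neighbourhoods and inner cores in G/Γ through the action of small elements. -/

section Quotient

variable {G : Type*} [Group G] [MetricSpace G] {Γ : Subgroup G}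
  (hr : ∀ x y h : G, dist (x * h) (y * h) = dist x y) {ρ ρ' : ℝ} {x : G ⧸ Γ} {S O : Set (G ⧸ Γ)}
include hr

/-- By right invariance the distance from a to a' is the distance from a' a⁻¹ to 1, so
neighbourhoods in the quotient are described by the left action of small elements. -/
lemma mem_nbhd_iff : x ∈ nbhd Γ ρ S ↔ ∃ k : G, dist k 1 < ρ ∧ k • x ∈ S := by
  simp only [nbhd, mem_ofPred_eq, quotInfEDist, quotEDist, iInf_lt_iff]
  constructor
  · rintro ⟨y, hy, a, a', rfl, rfl, hlt⟩
    refine ⟨a' * a⁻¹, ?_, ?_⟩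
    · rw [edist_dist, ENNReal.ofReal_lt_ofReal_iff'] at hlt
      have := hr (a' * a⁻¹) 1 a
      rw [inv_mul_cancel_right, one_mul] at this
      rw [← this, dist_comm]; exact hlt.1
    · have : (a' * a⁻¹) • (a : G ⧸ Γ) = (a' : G ⧸ Γ) := by
        rw [MulAction.Quotient.smul_coe, smul_eq_mul, inv_mul_cancel_right]
      rwa [this]
  · rintro ⟨k, hk, hkS⟩
    obtain ⟨a, rfl⟩ := QuotientGroup.mk_surjective x
    refine ⟨k • (a : G ⧸ Γ), hkS, a, k * a, rfl, rfl, ?_⟩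
    rw [edist_dist]
    have h1 := hr k 1 a
    rw [one_mul] at h1
    rw [dist_comm, h1]
    exact (ENNReal.ofReal_lt_ofReal_iff_of_nonneg dist_nonneg).2 hk

lemma notMem_innerCore {k : G} (hk : dist k 1 ≤ ρ) (hkO : k • x ∈ Oᶜ) : x ∉ innerCore Γ ρ O := by
  obtain ⟨a, rfl⟩ := QuotientGroup.mk_surjective x
  simp only [innerCore, mem_ofPred_eq, not_lt, quotInfEDist, quotEDist]
  refine (iInf₂_le (k • (a : G ⧸ Γ)) hkO).trans ((iInf₂_le a (k * a)).trans ((iInf_le_of_le rfl (iInf_le_of_le rfl le_rfl)).trans ?_))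
  have h1 := hr k 1 a
  rw [one_mul] at h1
  rw [edist_dist, dist_comm, h1]
  exact ENNReal.ofReal_le_ofReal hk

lemma dist_inv_one (k : G) : dist k⁻¹ 1 = dist k 1 := by
  have := hr k⁻¹ 1 k
  rw [inv_mul_cancel, one_mul] at this
  rw [← this, dist_comm]

lemma dist_mul_one_le (k l : G) : dist (k * l) 1 ≤ dist k 1 + dist l 1 := by
  have h1 := hr k 1 l
  rw [one_mul] at h1
  calc dist (k * l) 1 ≤ dist (k * l) l + dist l 1 := dist_triangle _ _ _
    _ = _ := by rw [h1]

lemma dist_mul_inv_one (k l : G) : dist (k * l⁻¹) 1 = dist k l := by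
  have := hr (k * l⁻¹) 1 l
  rw [inv_mul_cancel_right, one_mul] at this
  exact this.symm

lemma mem_nbhd_of_smul_mem {k : G} (hk : k • x ∈ nbhd Γ ρ S) (h : dist k 1 + ρ ≤ ρ') : x ∈ nbhd Γ ρ' S := by
  obtain ⟨l, hl, hlS⟩ := (mem_nbhd_iff hr).1 hk
  refine (mem_nbhd_iff hr).2 ⟨l * k, ?_, by rwa [mul_smul]⟩
  have := dist_mul_one_le hr l k
  linarith

lemma isOpen_nbhd [IsTopologicalGroup G] : IsOpen (nbhd Γ ρ S) := by
  have h2 : ∀ y : G ⧸ Γ, IsOpen {k : G | k • y ∈ nbhd Γ ρ S} := by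
    intro y
    rw [isOpen_iff_mem_nhds]
    intro k hk
    obtain ⟨l, hl, hlS⟩ := (mem_nbhd_iff hr).1 hk
    have h3 : Tendsto (fun k' : G => dist (l * k * k'⁻¹) 1) (𝓝 k) (𝓝 (dist l 1)) := by
      have : Continuous (fun k' : G => dist (l * k * k'⁻¹) 1) := by fun_prop
      have := this.tendsto k
      rwa [mul_inv_cancel_right] at this
    filter_upwards [h3.eventually (gt_mem_nhds hl)] with k' hk'
    refine (mem_nbhd_iff hr).2 ⟨_, hk', ?_⟩
    rwa [← mul_smul, inv_mul_cancel_right, mul_smul]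
  rw [← (QuotientGroup.isOpenQuotientMap_mk (N := Γ)).isQuotientMap.isOpen_preimage]
  have h4 := h2 ((1 : G) : G ⧸ Γ)
  convert h4 using 1
  ext k
  simp only [mem_preimage, mem_ofPred_eq]
  rw [MulAction.Quotient.smul_coe, smul_eq_mul, mul_one]

end Quotient

/-! ### Smooth majorants of indicator functions. -/

section SmoothIndicators

variable {E : Type*} [NormedAddCommGroup E] [NormedSpace ℝ E] [FiniteDimensional ℝ E]
  {G : Type*} [Group G] [MetricSpace G] [ChartedSpace E G] [LieGroup 𝓘(ℝ, E) ∞ G] [ConnectedSpace G]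
  [Bundle.RiemannianBundle (fun x : G => TangentSpace 𝓘(ℝ, E) x)]
  [IsContMDiffRiemannianBundle 𝓘(ℝ, E) ∞ E (fun x : G => TangentSpace 𝓘(ℝ, E) x)]
  [IsRiemannianManifold 𝓘(ℝ, E) G]

/-- Smooth approximations to the indicator functions of subsets of a space acted upon by a Lie group,
with derivatives of polynomial growth in the inverse of the scale of approximation. -/
theorem exists_smooth_indicator (hG : IsRightInvariant E G) (ℓ : ℕ) :
    ∃ C > 0, ∃ M : ℕ, ∃ ε₀ > 0, ∀ ε, 0 < ε → ε < ε₀ → ∀ (X : Type _) [MulAction G X] (S : Set X),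
      (∀ x : X, IsOpen {k : G | k⁻¹ • x ∈ S}) → ∃ ψ : X → ℝ,
        (∀ x : X, ContMDiff 𝓘(ℝ, E) 𝓘(ℝ, ℝ) ∞ (fun g : G => ψ (g • x))) ∧
        (∀ x, 0 ≤ ψ x) ∧ (∀ x, ψ x ≤ 1) ∧
        (∀ x, (∀ k : G, dist k 1 < ε → k⁻¹ • x ∈ S) → ψ x = 1) ∧
        (∀ x, (∀ k : G, dist k 1 < ε → k⁻¹ • x ∉ S) → ψ x = 0) ∧
        (∀ w : List (Fin (Module.finrank ℝ (TangentSpace 𝓘(ℝ, E) (1 : G)))), w.length ≤ ℓ →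
          ∀ x, |wordDeriv (lieBasis E G) w ψ x| ≤ C * (1 / ε) ^ M) ∧
        ∀ ℓ' : ℕ, ∃ K, ∀ w : List (Fin (Module.finrank ℝ (TangentSpace 𝓘(ℝ, E) (1 : G)))), w.length ≤ ℓ' →
          ∀ x, |wordDeriv (lieBasis E G) w ψ x| ≤ K := by
  have : IsTopologicalGroup G := topologicalGroup_of_lieGroup 𝓘(ℝ, E) ∞
  have : LocallyCompactSpace G := Manifold.locallyCompact_of_finiteDimensional 𝓘(ℝ, E)
  have := (secondCountableTopology_of_connected_group (P := G)).2
  borelize G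
  let m : Measure G := Measure.haar
  obtain ⟨N, hN, hsm⟩ := exists_nhds_contMDiff_smoothing E m
  obtain ⟨C, hC, M, ε₀, hε₀, hker⟩ := exists_smooth_kernel hG m (lieBasis E G) ℓ hN
  refine ⟨C, hC, M, ε₀, hε₀, fun ε hε hε' X _ S hS => ?_⟩
  obtain ⟨θ, hθ, hθ0, hθN, hθε, hθ1, hθw⟩ := hker ε hε hε'
  have hSm : ∀ x : X, MeasurableSet {k : G | k⁻¹ • x ∈ S} := fun x => (hS x).measurableSet
  refine ⟨smoothing m θ S, hsm θ hθ hθN X S hSm, smoothing_nonneg m hθ0, fun x => ?_, fun x hx => ?_,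
    fun x hx => ?_, fun w hw x => ?_, fun ℓ' => ?_⟩
  · rw [← hθ1]; exact smoothing_le_integral m (hθ.integrable m) hθ0 x
  · rw [smoothing_eq_integral m fun k hk => hx k (hθε k hk), hθ1]
  · exact smoothing_eq_zero m fun k hk => hx k (hθε k hk)
  · exact (abs_wordDeriv_smoothing_le m hSm hθ _ w x).trans (hθw w hw)
  · obtain ⟨K, hK⟩ := ((List.finite_length_le _ ℓ').image
      fun w => ∫ k, |wordDeriv (lieBasis E G) w θ k| ∂m).bddAbove
    exact ⟨K, fun w hw x => (abs_wordDeriv_smoothing_le m hSm hθ _ w x).trans (hK ⟨w, hw, rfl⟩)⟩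

/-- The 2ε-thickening is smoothed at scale ε, leaving a margin ε on each side. -/
lemma exists_smooth_indicator_thickening (hG : IsRightInvariant E G) (ℓ : ℕ) :
    ∃ C > 0, ∃ M : ℕ, ∃ ε₀ > 0, ∀ ε, 0 < ε → ε < ε₀ → ∀ S : Set G, ∃ f : G → ℝ,
      ContMDiff 𝓘(ℝ, E) 𝓘(ℝ, ℝ) ∞ f ∧ (∀ x, 0 ≤ f x) ∧ (∀ x, f x ≤ 1) ∧
      (∀ x ∈ Metric.thickening ε S, f x = 1) ∧ (∀ x ∉ Metric.thickening (3 * ε) S, f x = 0) ∧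
      cNorm E G ℓ f ≤ ENNReal.ofReal (C * (1 / ε) ^ M) := by
  have : IsTopologicalGroup G := topologicalGroup_of_lieGroup 𝓘(ℝ, E) ∞
  have hr := dist_mul_right_of_isRightInvariant hG
  obtain ⟨C, hC, M, ε₀, hε₀, H⟩ := exists_smooth_indicator hG ℓ
  refine ⟨C, hC, M, ε₀, hε₀, fun ε hε hε' S => ?_⟩
  have hd : ∀ k x : G, dist (k⁻¹ * x) x = dist k 1 := fun k x => by
    have := hr k⁻¹ 1 x
    rw [one_mul] at this
    rw [this, dist_inv_one hr]
  obtain ⟨f, hf, hf0, hf1, hfS, hfS', hfw, -⟩ := H ε hε hε' G (Metric.thickening (2 * ε) S) fun x =>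
    Metric.isOpen_thickening.preimage (continuous_inv.smul continuous_const)
  refine ⟨f, by simpa using hf 1, hf0, hf1, fun x hx => hfS x fun k hk => ?_, fun x hx => hfS' x fun k hk hkS => hx ?_,
    cNorm_le hfw⟩
  · obtain ⟨z, hz, hxz⟩ := Metric.mem_thickening_iff.1 hx
    refine Metric.mem_thickening_iff.2 ⟨z, hz, ?_⟩
    have := dist_triangle (k⁻¹ * x) x z
    rw [hd] at this
    rw [smul_eq_mul]; linarith
  · obtain ⟨z, hz, hxz⟩ := Metric.mem_thickening_iff.1 hkS
    refine Metric.mem_thickening_iff.2 ⟨z, hz, ?_⟩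
    have := dist_triangle x (k⁻¹ * x) z
    rw [dist_comm x (k⁻¹ * x), hd] at this
    rw [smul_eq_mul] at hxz; linarith

/-- The 3r/4-neighbourhood is smoothed at scale ηr ≤ r/8. Since η does not depend on r, the norms
are bounded by a constant times a fixed power of 1/r. -/
lemma exists_smooth_indicator_nbhd (hG : IsRightInvariant E G) (ℓ : ℕ) (Γ : Subgroup G)
    [MeasurableSpace (G ⧸ Γ)] (μ : Measure (G ⧸ Γ)) [IsProbabilityMeasure μ] :
    ∃ C > 0, ∃ M : ℕ, ∀ r, 0 < r → r < 1 → ∀ S : Set (G ⧸ Γ), ∃ ψ : G ⧸ Γ → ℝ,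
      IsC2Smooth E Γ μ ψ ∧ (∀ y, 0 ≤ ψ y) ∧ (∀ y, ψ y ≤ 1) ∧ (∀ y ∈ nbhd Γ (5 / 8 * r) S, ψ y = 1) ∧
      (∀ y ∉ nbhd Γ (7 / 8 * r) S, ψ y = 0) ∧
      max (cNorm E G 1 ψ) (sobolevNorm E G μ ℓ ψ) ≤ ENNReal.ofReal (C * (1 / r) ^ M) := by
  have : IsTopologicalGroup G := topologicalGroup_of_lieGroup 𝓘(ℝ, E) ∞
  have hr := dist_mul_right_of_isRightInvariant hG
  obtain ⟨C, hC, M, ε₀, hε₀, H⟩ := exists_smooth_indicator hG (max 1 ℓ)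
  obtain ⟨A, hA, hAs⟩ := exists_sobolevNorm_le E G ℓ
  set η := min ε₀ (1 / 8) with hη
  have hη0 : 0 < η := by positivity
  refine ⟨(A + 1) * (C * (1 / η) ^ M), by positivity, M, fun r hr0 hr1 S => ?_⟩
  have hε : 0 < η * r := by positivity
  have hη1 : η * r < ε₀ := by
    have := min_le_left ε₀ (1 / 8)
    nlinarith
  have hη2 : η * r ≤ 1 / 8 * r := mul_le_mul_of_nonneg_right (min_le_right _ _) hr0.le
  obtain ⟨ψ, hψ, hψ0, hψ1, hψS, hψS', hψw, hψK⟩ := H (η * r) hε hη1 (G ⧸ Γ) (nbhd Γ (3 / 4 * r) S) fun x =>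
    (isOpen_nbhd hr).preimage (continuous_inv.smul continuous_const)
  have hpow : C * (1 / (η * r)) ^ M = C * (1 / η) ^ M * (1 / r) ^ M := by
    rw [mul_assoc, ← mul_pow, div_mul_div_comm, one_mul]
  rw [hpow] at hψw
  have hpos : 0 ≤ C * (1 / η) ^ M * (1 / r) ^ M := by positivity
  refine ⟨ψ, ⟨?_, fun ℓ' => ?_⟩, hψ0, hψ1, fun y hy => hψS y fun k hk => ?_,
    fun y hy => hψS' y fun k hk hkS => hy ?_, max_le ?_ ?_⟩
  · refine (hψ ((1 : G) : G ⧸ Γ)).congr fun g => ?_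
    rw [MulAction.Quotient.smul_coe, smul_eq_mul, mul_one]
  · obtain ⟨A', -, hA'⟩ := exists_sobolevNorm_le E G ℓ'
    obtain ⟨K, hK⟩ := hψK ℓ'
    exact (hA' μ hK).trans_lt ENNReal.ofReal_lt_top
  · refine mem_nbhd_of_smul_mem hr (k := k) (ρ := 5 / 8 * r) ?_ (by linarith)
    rwa [smul_inv_smul]
  · refine mem_nbhd_of_smul_mem hr hkS ?_
    rw [dist_inv_one hr]; linarith
  · refine (cNorm_le fun w hw => hψw w (hw.trans (le_max_left _ _))).trans (ENNReal.ofReal_le_ofReal ?_)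
    nlinarith
  · refine (hAs μ fun w hw => hψw w (hw.trans (le_max_right _ _))).trans (ENNReal.ofReal_le_ofReal ?_)
    nlinarith

end SmoothIndicators

lemma integral_le_one_sub_innerCore {G : Type*} [Group G] [MetricSpace G] [IsTopologicalGroup G] {Γ : Subgroup G}
    (hr : ∀ x y h : G, dist (x * h) (y * h) = dist x y) [MeasurableSpace (G ⧸ Γ)] [BorelSpace (G ⧸ Γ)]
    (μ : Measure (G ⧸ Γ)) [IsProbabilityMeasure μ] {ψ : G ⧸ Γ → ℝ} {r ρ : ℝ} {O : Set (G ⧸ Γ)} (hρ : ρ ≤ r)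
    (h0 : ∀ y, 0 ≤ ψ y) (h1 : ∀ y, ψ y ≤ 1) (hz : ∀ y ∉ nbhd Γ ρ Oᶜ, ψ y = 0) :
    ∫ y, ψ y ∂μ ≤ 1 - (μ (innerCore Γ r O)).toReal := by
  have hm : MeasurableSet (nbhd Γ ρ Oᶜ) := (isOpen_nbhd hr).measurableSet
  have h2 : ∫ y, ψ y ∂μ ≤ ∫ y, (nbhd Γ ρ Oᶜ).indicator (fun _ => (1 : ℝ)) y ∂μ := by
    refine integral_mono_of_nonneg (Eventually.of_forall h0)
      ((integrable_indicator_iff hm).2 (integrable_const _).integrableOn) (Eventually.of_forall fun y => ?_)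
    by_cases hy : y ∈ nbhd Γ ρ Oᶜ
    · simp only [indicator_of_mem hy]; exact h1 y
    · simp only [indicator_of_notMem hy]; exact (hz y hy).le
  have h3 : innerCore Γ r O ⊆ (nbhd Γ ρ Oᶜ)ᶜ := by
    intro y hy hy'
    obtain ⟨k, hk, hkS⟩ := (mem_nbhd_iff hr).1 hy'
    exact notMem_innerCore hr (hk.le.trans hρ) hkS hy
  have h4 : (μ (innerCore Γ r O)).toReal ≤ μ.real (nbhd Γ ρ Oᶜ)ᶜ :=
    ENNReal.toReal_mono (measure_ne_top _ _) (measure_mono h3)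
  rw [probReal_compl_eq_one_sub hm] at h4
  rw [integral_indicator hm, setIntegral_const, smul_eq_mul, mul_one] at h2
  linarith

/-- This includes the default value 0 of `sSup`, so that infima of injectivity radii are bounded
below. -/
lemma injRadius_nonneg {G : Type*} [Group G] [MetricSpace G] (Γ : Subgroup G) (x : G ⧸ Γ) : 0 ≤ injRadius Γ x :=
  Real.sSup_nonneg fun _ hr => hr.1.le

lemma injRadiusOn_le {G : Type*} [Group G] [MetricSpace G] {Γ : Subgroup G} {K : Set (G ⧸ Γ)} {x : G ⧸ Γ}
    (hx : x ∈ K) : injRadiusOn Γ K ≤ injRadius Γ x :=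
  csInf_le ⟨0, by rintro _ ⟨y, -, rfl⟩; exact injRadius_nonneg Γ y⟩ ⟨x, hx, rfl⟩

lemma continuous_of_isC2Smooth {E : Type*} [NormedAddCommGroup E] [NormedSpace ℝ E] [FiniteDimensional ℝ E]
    {G : Type*} [Group G] [MetricSpace G] [ChartedSpace E G] {Γ : Subgroup G} [MeasurableSpace (G ⧸ Γ)]
    {μ : Measure (G ⧸ Γ)} {ψ : G ⧸ Γ → ℝ} (h : IsC2Smooth E Γ μ ψ) : Continuous ψ :=
  (QuotientGroup.isQuotientMap_mk Γ).continuous_iff.2 h.1.continuous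

/-- The choice of the scale in the smoothing argument. -/
lemma exists_scale {κ lam₀ D e₀ : ℝ} (hκ : 0 < κ) (hl : 0 < lam₀) (hD : 1 ≤ D) (he₀ : 0 < e₀) (M₁ M₂ : ℕ) :
    ∃ κ' > 0, κ' ≤ κ ∧ ∃ a > 0, ∃ b > 0, ∀ r, 0 < r → r < 1 → ∀ t, a + b * Real.log (1 / r) ≤ t →
      D * Real.exp (-κ' * t) < e₀ ∧
      (1 / r) ^ M₁ * (1 / (D * Real.exp (-κ' * t))) ^ M₂ * Real.exp (-lam₀ * t) ≤ Real.exp (-(lam₀ / 2) * t) := by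
  -- With this rate the factor (1/scale)^{M₂} costs at most e^{λ₀t/4}. The coefficient 4M₁/λ₀ below
  -- bounds (1/r)^{M₁} by e^{λ₀t/4} as well, which leaves half of the decay.
  set κ' := min κ (lam₀ / (4 * (M₂ + 1))) with hκ'
  have hκ'0 : 0 < κ' := by positivity
  have h1 : Tendsto (fun t : ℝ => D * Real.exp (-κ' * t)) atTop (𝓝 0) := by
    have h2 : Tendsto (fun t : ℝ => Real.exp (-κ' * t)) atTop (𝓝 0) :=
      Real.tendsto_exp_atBot.comp (tendsto_id.const_mul_atTop_of_neg (by linarith))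
    simpa using h2.const_mul D
  obtain ⟨a, ha⟩ := eventually_atTop.1 (h1.eventually (gt_mem_nhds he₀))
  refine ⟨κ', hκ'0, min_le_left _ _, max a 1, by positivity, 4 * M₁ / lam₀ + 1, by positivity,
    fun r hr0 hr1 t ht => ?_⟩
  have hlog : 0 < Real.log (1 / r) := Real.log_pos ((one_lt_div hr0).2 hr1)
  have hb : 0 ≤ 4 * M₁ / lam₀ := by positivity
  have ht0 : max a 1 ≤ t := by nlinarith
  have ht1 : 0 < t := one_pos.trans_le ((le_max_right _ _).trans ht0)
  refine ⟨ha t ((le_max_left _ _).trans ht0), ?_⟩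
  have h2 : (1 / r) ^ M₁ = Real.exp (M₁ * Real.log (1 / r)) := by
    rw [Real.exp_nat_mul, Real.exp_log (by positivity)]
  have h3 : (1 / (D * Real.exp (-κ' * t))) ^ M₂ ≤ Real.exp (M₂ * (κ' * t)) := by
    rw [Real.exp_nat_mul]
    refine pow_le_pow_left₀ (by positivity) ?_ _
    rw [div_le_iff₀ (by positivity)]
    have : Real.exp (κ' * t) * Real.exp (-κ' * t) = 1 := by rw [← Real.exp_add]; simp
    calc (1 : ℝ) ≤ D * 1 := by linarith
      _ = _ := by rw [← this]; ring
  have h4 : M₁ * Real.log (1 / r) ≤ lam₀ / 4 * t := by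
    have h5 : 4 * M₁ / lam₀ * Real.log (1 / r) ≤ t := by nlinarith [le_max_right a 1]
    have h6 := mul_le_mul_of_nonneg_left h5 (by positivity : 0 ≤ lam₀ / 4)
    calc M₁ * Real.log (1 / r) = lam₀ / 4 * (4 * M₁ / lam₀ * Real.log (1 / r)) := by field_simp
      _ ≤ _ := h6
  have h7 : M₂ * (κ' * t) ≤ lam₀ / 4 * t := by
    have h8 : κ' * (4 * (M₂ + 1)) ≤ lam₀ := (le_div_iff₀ (by positivity)).1 (min_le_right _ _)
    have h9 : M₂ * κ' ≤ lam₀ / 4 := by nlinarith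
    nlinarith
  calc _ ≤ Real.exp (M₁ * Real.log (1 / r)) * Real.exp (M₂ * (κ' * t)) * Real.exp (-lam₀ * t) := by
        rw [h2]; gcongr
    _ = Real.exp (M₁ * Real.log (1 / r) + M₂ * (κ' * t) + -lam₀ * t) := by rw [Real.exp_add, Real.exp_add]
    _ ≤ _ := Real.exp_le_exp.2 (by linarith)

/-! ### The covering estimate for one step. -/

section OneStep

variable {E : Type*} [NormedAddCommGroup E] [NormedSpace ℝ E] [FiniteDimensional ℝ E]
  {G : Type*} [Group G] [MetricSpace G] [ChartedSpace E G] [LieGroup 𝓘(ℝ, E) ∞ G] [ConnectedSpace G]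
  [Bundle.RiemannianBundle (fun x : G => TangentSpace 𝓘(ℝ, E) x)]
  [IsContMDiffRiemannianBundle 𝓘(ℝ, E) ∞ E (fun x : G => TangentSpace 𝓘(ℝ, E) x)]
  [IsRiemannianManifold 𝓘(ℝ, E) G]
  {Γ : Subgroup G} [MeasurableSpace (G ⧸ Γ)] [BorelSpace (G ⧸ Γ)] {μ : Measure (G ⧸ Γ)} [IsProbabilityMeasure μ]
  {g : ℝ → G}
  {E' : Type*} [NormedAddCommGroup E'] [NormedSpace ℝ E'] [FiniteDimensional ℝ E']
  {P : Type*} [Group P] [MetricSpace P] [ChartedSpace E' P] [LieGroup 𝓘(ℝ, E') ∞ P] [ConnectedSpace P]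
  [Bundle.RiemannianBundle (fun x : P => TangentSpace 𝓘(ℝ, E') x)]
  [IsContMDiffRiemannianBundle 𝓘(ℝ, E') ∞ E' (fun x : P => TangentSpace 𝓘(ℝ, E') x)]
  [IsRiemannianManifold 𝓘(ℝ, E') P] [MeasurableSpace P] [BorelSpace P] {ν : Measure P} [ν.IsHaarMeasure]
  {ι : P →* G}

/-- The boxes which meet a set of points mapped to `S` consist of points mapped to a neighborhood of `S`. -/
lemma mem_thickening_and_mem_nbhd (hrG : ∀ x y h : G, dist (x * h) (y * h) = dist x y)
    (hιd : ∀ x y : P, dist (ι x) (ι y) ≤ dist x y) {n : ℕ} {c : ℝ → P →* P}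
    {b : Module.Basis (Fin n) ℝ (LieAlg E' P)} {w : Fin n → ℝ}
    (h : IsExpandingExp (gexp : LieAlg E' P → P) c b w) (hc : ∀ t h, ι (c t h) = g t * ι h * (g t)⁻¹)
    {rs r q ε t : ℝ} (hrs : BiLipOnBall (gexp : LieAlg E' P → P) rs) (hr : 0 < r) (hrr : r ≤ rs)
    (hcon : ∀ v, ‖diagFlow b w (-t) v‖ ≤ q * ‖v‖) (hq : 0 ≤ q) (hqε : q * r < ε)
    {U : Set P} (hU : closure U ⊆ gexp '' {v : LieAlg E' P | ‖v‖ ≤ r / 8}) {S : Set (G ⧸ Γ)} {x : G ⧸ Γ} {γ k y : P}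
    (hk : k ∈ closure U) (hkS : g t • ι k • x ∈ S) (hkγ : ∃ v ∈ closure U, c t k = v * γ)
    (hyγ : ∃ v ∈ U, c t y = v * γ) :
    y ∈ Metric.thickening ε (closure U) ∧ g t • ι y • x ∈ nbhd Γ (5 / 8 * r) S := by
  obtain ⟨v, hv, hkv⟩ := hkγ
  obtain ⟨v', hv', hyv⟩ := hyγ
  obtain ⟨u, hu, rfl⟩ := hU hv
  obtain ⟨u', hu', rfl⟩ := hU (subset_closure hv')
  simp only [mem_ofPred_eq] at hu hu'
  have hd : ∀ z : LieAlg E' P, ‖z‖ ≤ r / 8 → dist (c (-t) (gexp z)) 1 ≤ q * (r / 8) := fun z hz => by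
    rw [h.map_exp]
    exact (h.dist_le _).trans ((hcon z).trans (mul_le_mul_of_nonneg_left hz hq))
  refine ⟨Metric.mem_thickening_iff.2 ⟨k, hk, ?_⟩, (mem_nbhd_iff hrG).2 ⟨ι (gexp u * (gexp u')⁻¹), ?_, ?_⟩⟩
  · have h1 : y = c (-t) (gexp u') * c (-t) γ := by rw [← map_mul, ← hyv, h.map_neg_map]
    have h2 : k = c (-t) (gexp u) * c (-t) γ := by rw [← map_mul, ← hkv, h.map_neg_map]
    rw [h1, h2, h.dist_mul_right]
    have h3 := dist_triangle_right (c (-t) (gexp u')) (c (-t) (gexp u)) 1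
    have h4 := hd u hu
    have h5 := hd u' hu'
    have h6 : 0 ≤ q * r := by positivity
    linarith
  -- The images of y and k differ by the element exp(u) exp(u')⁻¹, of size at most 2‖u − u'‖ ≤ r/2,
  -- which is below 5r/8.
  · have h1 := hιd (gexp u * (gexp u')⁻¹) 1
    rw [map_one, dist_mul_inv_one h.dist_mul_right] at h1
    have h2 := (hrs u u' (by linarith) (by linarith)).2
    have h3 := norm_sub_le u u'
    linarith
  · have h1 : c t k = gexp u * (gexp u')⁻¹ * c t y := by rw [hkv, hyv]; group
    have h2 := congrArg ι h1
    rw [map_mul, hc, hc] at h2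
    have h3 : g t * ι k = ι (gexp u * (gexp u')⁻¹) * (g t * ι y) := by
      have h4 := congrArg (· * g t) h2
      simp only [mul_assoc, inv_mul_cancel, mul_one] at h4
      exact h4
    rw [smul_smul, h3, mul_smul, mul_smul] at hkS
    exact hkS

end OneStep

lemma integral_le_measureReal {P : Type*} [TopologicalSpace P] [MeasurableSpace P] [OpensMeasurableSpace P]
    {ν : Measure P} {f : P → ℝ} {T : Set P} (hT : ν T ≠ ⊤) (hTo : IsOpen T)
    (h1 : ∀ x, f x ≤ 1) (h0 : ∀ x, 0 ≤ f x) (hz : ∀ x ∉ T, f x = 0) :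
    ∫ x, f x ∂ν ≤ ν.real T := by
  have hm := hTo.measurableSet
  calc ∫ x, f x ∂ν ≤ ∫ x, T.indicator (fun _ => (1 : ℝ)) x ∂ν := by
        refine integral_mono_of_nonneg (Eventually.of_forall h0)
          ((integrable_indicator_iff hm).2 (integrableOn_const hT)) (Eventually.of_forall fun x => ?_)
        by_cases hx : x ∈ T
        · simp only [indicator_of_mem hx]; exact h1 x
        · simp only [indicator_of_notMem hx]; exact (hz x hx).le
    _ = ν.real T := by rw [integral_indicator hm, setIntegral_const, smul_eq_mul, mul_one]

lemma measureReal_le_integral {P : Type*} [TopologicalSpace P] [MeasurableSpace P] [OpensMeasurableSpace P]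
    {ν : Measure P} {f : P → ℝ} {T W : Set P} (hT : ν T ≠ ⊤) (hTo : IsOpen T) (hf : Continuous f)
    (h1 : ∀ x, f x ≤ 1) (h0 : ∀ x, 0 ≤ f x) (hz : ∀ x ∉ T, f x = 0) (hW : ∀ x ∈ W, f x = 1) :
    ν.real W ≤ ∫ x, f x ∂ν := by
  have hm := hTo.measurableSet
  have hint : Integrable f ν := by
    have : Integrable (T.indicator fun _ => (1 : ℝ)) ν := (integrable_indicator_iff hm).2 (integrableOn_const hT)
    refine this.mono' hf.aestronglyMeasurable (Eventually.of_forall fun x => ?_)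
    rw [Real.norm_eq_abs, abs_of_nonneg (h0 x)]
    by_cases hx : x ∈ T
    · simp only [indicator_of_mem hx]; exact h1 x
    · simp only [indicator_of_notMem hx]; exact (hz x hx).le
  have hsub : W ⊆ {x | 1 ≤ f x} := fun x hx => (hW x hx).ge
  have hsub' : {x | 1 ≤ f x} ⊆ T := fun x hx => by
    by_contra hxT
    have := hz x hxT
    simp only [mem_ofPred_eq] at hx
    linarith
  have := mul_meas_ge_le_integral_of_nonneg (Eventually.of_forall h0) hint 1
  rw [one_mul] at this
  exact (measureReal_mono hsub ((measure_mono hsub').trans_lt hT.lt_top).ne).trans this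

lemma le_exp_mul_of_mul_le {K σ t v m y d : ℝ} (hd : 0 < d) (hdv : d ≤ v) (hy : 0 ≤ y)
    (h : K * (Real.exp (-t * σ) * v) ≤ v * m + y) : K ≤ Real.exp (σ * t) * (m + y / d) := by
  have hv := hd.trans_le hdv
  have hexp : Real.exp (σ * t) * Real.exp (-t * σ) = 1 := by
    rw [← Real.exp_add, show σ * t + -t * σ = 0 by ring, Real.exp_zero]
  have h1 : K * Real.exp (-t * σ) ≤ (v * m + y) / v := by
    rw [le_div_iff₀ hv, mul_assoc]; exact h
  rw [add_div, mul_div_cancel_left₀ _ hv.ne'] at h1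
  have h2 : y / v ≤ y / d := by gcongr
  calc K = Real.exp (σ * t) * (K * Real.exp (-t * σ)) := by rw [mul_left_comm, hexp, mul_one]
    _ ≤ _ := mul_le_mul_of_nonneg_left (h1.trans (by linarith)) (Real.exp_pos _).le

section OneStep

variable {E : Type*} [NormedAddCommGroup E] [NormedSpace ℝ E] [FiniteDimensional ℝ E]
  {G : Type*} [Group G] [MetricSpace G] [ChartedSpace E G] [LieGroup 𝓘(ℝ, E) ∞ G] [ConnectedSpace G]
  [Bundle.RiemannianBundle (fun x : G => TangentSpace 𝓘(ℝ, E) x)]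
  [IsContMDiffRiemannianBundle 𝓘(ℝ, E) ∞ E (fun x : G => TangentSpace 𝓘(ℝ, E) x)]
  [IsRiemannianManifold 𝓘(ℝ, E) G]
  {Γ : Subgroup G} [MeasurableSpace (G ⧸ Γ)] [BorelSpace (G ⧸ Γ)] {μ : Measure (G ⧸ Γ)} [IsProbabilityMeasure μ]
  {g : ℝ → G}
  {E' : Type*} [NormedAddCommGroup E'] [NormedSpace ℝ E'] [FiniteDimensional ℝ E']
  {P : Type*} [Group P] [MetricSpace P] [ChartedSpace E' P] [LieGroup 𝓘(ℝ, E') ∞ P] [ConnectedSpace P]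
  [Bundle.RiemannianBundle (fun x : P => TangentSpace 𝓘(ℝ, E') x)]
  [IsContMDiffRiemannianBundle 𝓘(ℝ, E') ∞ E' (fun x : P => TangentSpace 𝓘(ℝ, E') x)]
  [IsRiemannianManifold 𝓘(ℝ, E') P] [MeasurableSpace P] [BorelSpace P] {ν : Measure P} [ν.IsHaarMeasure]
  {ι : P →* G}

/-- The half-side is r/(8√n), and the Euclidean norm costs a factor √n. The dimension must be
nonzero, since otherwise the side is a division by zero. -/
lemma closure_boxV_subset {n : ℕ} (hn : n ≠ 0) {c : ℝ → P →* P} {b : Module.Basis (Fin n) ℝ (LieAlg E' P)}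
    {w : Fin n → ℝ} (h : IsExpandingExp (gexp : LieAlg E' P → P) c b w)
    (B : OrthonormalBasis (Fin n) ℝ (TangentSpace 𝓘(ℝ, E') (1 : P))) {r : ℝ} (hr : 0 < r) :
    closure (boxV E' B r) ⊆ gexp '' {v : LieAlg E' P | ‖v‖ ≤ r / 8} := by
  have : IsTopologicalGroup P := topologicalGroup_of_lieGroup 𝓘(ℝ, E') ∞
  have hn0 : 0 < √(n : ℝ) := Real.sqrt_pos.2 (by exact_mod_cast Nat.pos_of_ne_zero hn)
  let X : OrthonormalBasis (Fin n) ℝ (LieAlg E' P) := B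
  have hs0 : 0 < r / (4 * √(n : ℝ)) := by positivity
  have hsr : r / (4 * √(n : ℝ)) / 2 * √(n : ℝ) = r / 8 := by field_simp; norm_num
  have h1 : boxV E' B r = gexp '' cube X (r / (4 * √(n : ℝ))) := rfl
  rw [h1, h.closure_image_cube X hs0]
  refine image_mono fun v hv => ?_
  rw [mem_ofPred_eq, ← hsr]
  exact norm_le_of_abs_repr_le X (by positivity) hv

set_option maxHeartbeats 1000000 in
/-- The number of boxes needed to cover the points of a box which are mapped outside of `O` by `g t`. -/
theorem exists_cover_one_step (hG : IsRightInvariant E G) (hι : IsRiemannianLieSubgroup E E' ι)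
    (hEEP : EEP E E' Γ μ ν ι g) {n : ℕ} (hn : n ≠ 0) {c : ℝ → P →* P}
    {b : Module.Basis (Fin n) ℝ (LieAlg E' P)} {w : Fin n → ℝ}
    (h : IsExpandingExp (gexp : LieAlg E' P → P) c b w) (hc : ∀ t h, ι (c t h) = g t * ι h * (g t)⁻¹)
    {B : OrthonormalBasis (Fin n) ℝ (TangentSpace 𝓘(ℝ, E') (1 : P))} (hB : IsTessellationBasis E' ν B)
    {rs : ℝ} (hrs : IsExpRadius E' P rs) :
    ∃ a₁ > 0, ∃ b₁ > 0, ∃ C > 0, ∃ lam > 0, ∀ (O : Set (G ⧸ Γ)) (r : ℝ), 0 < r → r < rs / 2 →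
      ∀ x : G ⧸ Γ, r ≤ injRadius Γ x → ∀ t, a₁ + b₁ * Real.log (1 / r) ≤ t →
      ∃ 𝓖 : Finset P, (∀ k ∈ closure (boxV E' B r), g t • ι k • x ∈ Oᶜ →
          ∃ γ ∈ 𝓖, ∃ v ∈ closure (boxV E' B r), c t k = v * γ) ∧
        (𝓖.card : ℝ) ≤ Real.exp ((∑ i, w i) * t) *
          (1 - (μ (innerCore Γ r O)).toReal + C / r ^ n * Real.exp (-lam * t)) := by
  have : IsTopologicalGroup G := topologicalGroup_of_lieGroup 𝓘(ℝ, E) ∞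
  have : IsTopologicalGroup P := topologicalGroup_of_lieGroup 𝓘(ℝ, E') ∞
  have : LocallyCompactSpace P := Manifold.locallyCompact_of_finiteDimensional 𝓘(ℝ, E')
  have := (secondCountableTopology_of_connected_group (P := P)).2
  have hrG := dist_mul_right_of_isRightInvariant hG
  have hP := hι.isRightInvariant hG
  obtain ⟨hrs0, hrs4, hbl⟩ := hrs
  have hbl : BiLipOnBall (gexp : LieAlg E' P → P) rs := hbl
  have hn1 : 1 ≤ √(n : ℝ) := Real.one_le_sqrt.2 (by exact_mod_cast Nat.one_le_iff_ne_zero.2 hn)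
  have hn0 : 0 < √(n : ℝ) := by linarith
  let X : OrthonormalBasis (Fin n) ℝ (LieAlg E' P) := B
  obtain ⟨a₀, b₀, lam₀, C₀, ℓ, ha₀, hb₀, hlam₀, hC₀, hEE⟩ := hEEP
  obtain ⟨CP, hCP, MP, εP, hεP, hf⟩ := exists_smooth_indicator_thickening hP ℓ
  obtain ⟨CG, hCG, MG, hψ⟩ := exists_smooth_indicator_nbhd hG ℓ Γ μ
  obtain ⟨C₃, hC₃, ε₃, hε₃, hthick⟩ := h.exists_measure_thickening_le ν X hrs0 hbl
  obtain ⟨k₅, hk₅, hlow⟩ := h.exists_le_measure_image_cube ν X hrs0 hbl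
  obtain ⟨Cd, hCd, κ, hκ, hcon⟩ := exists_norm_diagFlow_neg_le b w h.weight_pos
  -- The scale (Cd + 1)e^{-κ't} dominates the size of the contracted boxes. The thresholds serve the
  -- smoothing in `P`, the volume bound for the 3ε-thickening, and 3ε < 1/4, which keeps the support
  -- of f in the unit ball.
  obtain ⟨κ', hκ', hκκ, a₁, ha₁, b₁, hb₁, hscale⟩ := exists_scale hκ hlam₀ (show 1 ≤ Cd + 1 by linarith)
    (show 0 < min εP (min (ε₃ / 3) (1 / 12)) by positivity) MG MP
  set lam := min κ' (lam₀ / 2) with hlam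
  have hlam0 : 0 < lam := by positivity
  set C₇ := C₃ * 3 * (Cd + 1) + C₀ * CG * CP with hC₇
  have hC₇0 : 0 < C₇ := by positivity
  -- The lower bound k₅ sⁿ for the measure of the box, with s = r/(4√n), accounts for the factor
  -- (4√n)ⁿ/k₅ in the constant.
  refine ⟨a₁ + a₀, by positivity, b₁ + b₀, by positivity, C₇ * (4 * √(n : ℝ)) ^ n / k₅, by positivity, lam, hlam0,
    fun O r hr hrr x hx t ht => ?_⟩
  have hr1 : r < 1 := by linarith
  have hlog : 0 < Real.log (1 / r) := Real.log_pos ((one_lt_div hr).2 hr1)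
  have hlogb₀ : 0 < b₀ * Real.log (1 / r) := by positivity
  have hlogb₁ : 0 < b₁ * Real.log (1 / r) := by positivity
  rw [add_mul] at ht
  have ht0 : 0 < t := by linarith
  obtain ⟨hsm, herr⟩ := hscale r hr hr1 t (by linarith)
  set ε := (Cd + 1) * Real.exp (-κ' * t) with hε
  have hε0 : 0 < ε := by positivity
  have hεP' : ε < εP := hsm.trans_le (min_le_left _ _)
  have hε3 : 3 * ε ≤ ε₃ := by
    have := hsm.trans_le ((min_le_right _ _).trans (min_le_left _ _)); linarith
  have hε12 : ε < 1 / 12 := hsm.trans_le ((min_le_right _ _).trans (min_le_right _ _))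
  -- the box and its neighborhood
  set s := r / (4 * √(n : ℝ)) with hs
  have hs0 : 0 < s := by positivity
  have hsr : s / 2 * √(n : ℝ) = r / 8 := by rw [hs]; field_simp; norm_num
  have hs1 : s ≤ 1 := (div_le_one (by positivity)).2 (by linarith)
  set U := boxV E' B r with hU
  have hUcube : U = gexp '' cube X s := rfl
  have hUn : closure U ⊆ gexp '' {v : LieAlg E' P | ‖v‖ ≤ r / 8} := closure_boxV_subset hn h B hr
  obtain ⟨Λ, hΛ⟩ := hB s hs0
  have hνlow : ENNReal.ofReal (k₅ * s ^ n) ≤ ν U := hlow s hs0 (by linarith)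
  have hνU : ν U ≠ ⊤ := by
    have hcpt : IsCompact (closure U) := by
      rw [hUcube, h.closure_image_cube X hs0, ← closure_cube X hs0]
      exact (isBounded_cube X s).isCompact_closure.image h.isHomeomorph_exp.continuous
    exact ((measure_mono subset_closure).trans_lt hcpt.measure_lt_top).ne
  have hνU0 : ν U ≠ 0 := (lt_of_lt_of_le (ENNReal.ofReal_pos.2 (by positivity)) hνlow).ne'
  set T := Metric.thickening (3 * ε) (closure U) with hT
  have hνT : ν T ≤ ν U + ENNReal.ofReal (C₃ * (3 * ε)) := hthick s hs0 hs1 (by linarith) (3 * ε) (by positivity) hε3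
  have hνT' : ν T ≠ ⊤ := (hνT.trans_lt (ENNReal.add_lt_top.2 ⟨hνU.lt_top, ENNReal.ofReal_lt_top⟩)).ne
  have hνTr : ν.real T ≤ ν.real U + C₃ * (3 * ε) := by
    have := ENNReal.toReal_mono (ENNReal.add_ne_top.2 ⟨hνU, ENNReal.ofReal_ne_top⟩) hνT
    rwa [ENNReal.toReal_add hνU ENNReal.ofReal_ne_top, ENNReal.toReal_ofReal (by positivity)] at this
  -- the test functions
  obtain ⟨f, hfs, hf0, hf1, hfT, hfz, hfn⟩ := hf ε hε0 hεP' (closure U)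
  obtain ⟨ψ, hψs, hψ0, hψ1, hψS, hψz, hψn⟩ := hψ r hr hr1 Oᶜ
  have hψc : Continuous ψ := continuous_of_isC2Smooth hψs
  have hfc : Continuous f := hfs.continuous
  have hφ : Continuous (fun k : P => g t • ι k • x) :=
    have h1 : Continuous (fun k : P => ι k) := hι.contMDiff.continuous
    (h1.smul continuous_const).const_smul (g t)
  have hfsupp : tsupport f ⊆ Metric.ball 1 1 := by
    have h1 : tsupport f ⊆ Metric.closedBall 1 (1 / 2) := by
      refine closure_minimal (fun k hk => ?_) Metric.isClosed_closedBall
      have hkT : k ∈ T := by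
        by_contra hkT; exact hk (hfz k hkT)
      obtain ⟨_, hz, hkz⟩ := Metric.mem_thickening_iff.1 hkT
      obtain ⟨u, hu, rfl⟩ := hUn hz
      have h2 := dist_triangle k (gexp u) 1
      have h3 := h.dist_le u
      simp only [mem_ofPred_eq] at hu
      rw [Metric.mem_closedBall]
      linarith
    exact h1.trans (Metric.closedBall_subset_ball (by norm_num))
  set W := {y : P | y ∈ Metric.thickening ε (closure U) ∧ g t • ι y • x ∈ nbhd Γ (5 / 8 * r) Oᶜ} with hW
  have hTε : Metric.thickening ε (closure U) ⊆ T := Metric.thickening_mono (by linarith) _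
  have hWT : W ⊆ T := fun y hy => hTε hy.1
  have hνW : ν W ≠ ⊤ := ((measure_mono hWT).trans_lt hνT'.lt_top).ne
  have hWint : ν.real W ≤ ∫ k, f k * ψ (g t • ι k • x) ∂ν := by
    refine measureReal_le_integral hνT' Metric.isOpen_thickening (hfc.mul (hψc.comp hφ))
      (fun k => mul_le_one₀ (hf1 k) (hψ0 _) (hψ1 _)) (fun k => mul_nonneg (hf0 k) (hψ0 _))
      (fun k hk => by rw [hfz k hk, zero_mul]) fun k hk => by rw [hfT k hk.1, hψS _ hk.2, one_mul]
  have hfint : ∫ k, f k ∂ν ≤ ν.real U + C₃ * (3 * ε) :=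
    (integral_le_measureReal hνT' Metric.isOpen_thickening hf1 hf0 hfz).trans hνTr
  have hψint : ∫ y, ψ y ∂μ ≤ 1 - (μ (innerCore Γ r O)).toReal :=
    integral_le_one_sub_innerCore hrG μ (by linarith) hψ0 hψ1 hψz
  -- equidistribution
  have hEEx : |(∫ k, f k * ψ (g t • ι k • x) ∂ν) - (∫ k, f k ∂ν) * ∫ y, ψ y ∂μ| ≤
      C₀ * CG * CP * Real.exp (-lam * t) := by
    -- The hypothesis r ≤ r₀(x) excludes the default value 0 of the injectivity radius and replaces
    -- it by r in the waiting time.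
    have hlogx : a₀ + b₀ * Real.log (1 / injRadius Γ x) ≤ t := by
      have h1 : Real.log (1 / injRadius Γ x) ≤ Real.log (1 / r) :=
        Real.log_le_log (by have := hr.trans_le hx; positivity) (one_div_le_one_div_of_le hr hx)
      have h2 := mul_le_mul_of_nonneg_left h1 hb₀.le
      linarith
    have h1 := hEE x t ht0 hlogx f hfs hfsupp ψ hψs
    have h2 := h1.trans (mul_le_mul' (mul_le_mul' (mul_le_mul' le_rfl hψn) hfn) le_rfl)
    rw [← ENNReal.ofReal_mul hC₀.le, ← ENNReal.ofReal_mul (by positivity), ← ENNReal.ofReal_mul (by positivity),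
      ENNReal.ofReal_le_ofReal_iff (by positivity)] at h2
    have h3 : Real.exp (-(lam₀ / 2) * t) ≤ Real.exp (-lam * t) := by
      refine Real.exp_le_exp.2 ?_
      exact mul_le_mul_of_nonneg_right (neg_le_neg (min_le_right _ _)) ht0.le
    calc _ ≤ _ := h2
      _ = C₀ * CG * CP * ((1 / r) ^ MG * (1 / ε) ^ MP * Real.exp (-lam₀ * t)) := by ring
      _ ≤ _ := mul_le_mul_of_nonneg_left (herr.trans h3) (by positivity)
  -- counting
  obtain ⟨𝓖, hcov, hcard⟩ := h.exists_finset_cover ν hΛ (t := t) (A := {k ∈ closure U | g t • ι k • x ∈ Oᶜ}) hνW hνU0 (by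
    rintro γ ⟨k, ⟨hk, hkO⟩, hkγ⟩ y hy
    refine mem_thickening_and_mem_nbhd hrG (hι.dist_map_le) h hc hbl hr (by linarith)
      (fun v => hcon t ht0.le v) (by positivity) ?_ hUn hk hkO hkγ hy
    have h1 : Real.exp (-κ * t) ≤ Real.exp (-κ' * t) :=
      Real.exp_le_exp.2 (mul_le_mul_of_nonneg_right (neg_le_neg hκκ) ht0.le)
    calc Cd * Real.exp (-κ * t) * r ≤ Cd * Real.exp (-κ * t) * 1 := by gcongr
      _ ≤ Cd * Real.exp (-κ' * t) := by rw [mul_one]; gcongr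
      _ < ε := by rw [hε]; have := Real.exp_pos (-κ' * t); linarith)
  refine ⟨𝓖, fun k hk hkO => hcov k ⟨hk, hkO⟩, ?_⟩
  set m := 1 - (μ (innerCore Γ r O)).toReal with hm
  have hm0 : 0 ≤ m := sub_nonneg.2 measureReal_le_one
  have hm1 : m ≤ 1 := by rw [hm]; linarith [ENNReal.toReal_nonneg (a := μ (innerCore Γ r O))]
  have hcard' : 𝓖.card * (Real.exp (-t * ∑ i, w i) * ν.real U) ≤ ν.real W := by
    have := ENNReal.toReal_mono hνW hcard
    rwa [ENNReal.toReal_mul, ENNReal.toReal_mul, ENNReal.toReal_natCast, ENNReal.toReal_ofReal (Real.exp_pos _).le] at this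
  have hψint0 : 0 ≤ ∫ y, ψ y ∂μ := integral_nonneg hψ0
  have hv0 : 0 ≤ ν.real U := measureReal_nonneg
  have hvlow : k₅ * s ^ n ≤ ν.real U := (ENNReal.ofReal_le_iff_le_toReal hνU).1 hνlow
  have hεlam : ε ≤ (Cd + 1) * Real.exp (-lam * t) := by
    rw [hε]
    have h1 : Real.exp (-κ' * t) ≤ Real.exp (-lam * t) :=
      Real.exp_le_exp.2 (mul_le_mul_of_nonneg_right (neg_le_neg (min_le_left _ _)) ht0.le)
    gcongr
  -- Two errors are added: the shell of the thickened box, linear in ε, and the equidistribution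
  -- error; both decay at least like e^{-λt}.
  have htotal : ν.real W ≤ ν.real U * m + C₇ * Real.exp (-lam * t) := by
    have h1 := (abs_le.1 hEEx).2
    have h2 : (∫ k, f k ∂ν) * ∫ y, ψ y ∂μ ≤ (ν.real U + C₃ * (3 * ε)) * m :=
      mul_le_mul hfint hψint hψint0 (by positivity)
    have h3 : C₃ * (3 * ε) * m ≤ C₃ * 3 * (Cd + 1) * Real.exp (-lam * t) := by
      calc C₃ * (3 * ε) * m ≤ C₃ * (3 * ε) * 1 := by gcongr
        _ = C₃ * 3 * ε := by ring
        _ ≤ C₃ * 3 * ((Cd + 1) * Real.exp (-lam * t)) := by gcongr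
        _ = _ := by ring
    rw [hC₇]
    linarith
  refine (le_exp_mul_of_mul_le (by positivity) hvlow (by positivity) (hcard'.trans htotal)).trans (le_of_eq ?_)
  rw [hs, div_pow]
  field_simp

end OneStep

/-! ### Iteration over the N steps. -/

section Iteration

variable {G : Type*} [Group G] [MetricSpace G] {Γ : Subgroup G} {g : ℝ → G} {P : Type*} [Group P] {ι : P →* G}
  {c : ℝ → P →* P} {D : Set P} {S Q : Set (G ⧸ Γ)} {t M : ℝ}

/-- Iteration of a covering estimate. -/
lemma exists_cover_iterate (hg : IsOneParameter g) (hc : ∀ t h, ι (c t h) = g t * ι h * (g t)⁻¹)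
    (hcadd : ∀ s t h, c (s + t) h = c s (c t h)) (hc0 : ∀ h, c 0 h = h) (hM : 0 ≤ M)
    (hQ : ∀ y : G ⧸ Γ, ∀ v ∈ D, ι v • y ∈ S → y ∈ Q)
    (hstep : ∀ y ∈ Q, ∃ 𝓖 : Finset P, (∀ k ∈ D, g t • ι k • y ∈ S → ∃ γ ∈ 𝓖, ∃ v ∈ D, c t k = v * γ) ∧
      (𝓖.card : ℝ) ≤ M) {x : G ⧸ Γ} (hx : x ∈ Q) (N : ℕ) :
    ∃ 𝓖 : Finset P, (∀ k ∈ D, (∀ ℓ ∈ Finset.Icc 1 N, g ((ℓ : ℝ) * t) • ι k • x ∈ S) →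
      ∃ γ ∈ 𝓖, ι γ • g (N * t) • x ∈ Q ∧ ∃ v ∈ D, c (N * t) k = v * γ) ∧ (𝓖.card : ℝ) ≤ M ^ N := by
  classical
  have hg0 : g 0 = 1 := hg.map_zero
  -- Within one box the orbit point is a fixed base point moved by an element of D, so the next step
  -- starts from a single point for each box.
  have horbit : ∀ (s : ℝ) (k v γ : P), c s k = v * γ → g s • ι k • x = ι v • ι γ • g s • x := by
    intro s k v γ hkv
    have h2 := hc s k
    rw [hkv, map_mul] at h2
    rw [smul_smul, smul_smul, smul_smul, h2, inv_mul_cancel_right]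
  induction N with
  | zero => exact ⟨{1}, fun k hk _ => ⟨1, by simp, by simpa [hg0] using hx, k, hk, by simp [hc0]⟩, by simp⟩
  | succ N ih =>
    obtain ⟨𝓖, hcov, hcard⟩ := ih
    -- Boxes whose base point is outside Q contain no relevant point and receive the empty family,
    -- so a bound valid on Q suffices.
    have h1 : ∀ γ : P, ∃ 𝓗 : Finset P, (𝓗.card : ℝ) ≤ M ∧ (ι γ • g (N * t) • x ∈ Q →
        ∀ k ∈ D, g t • ι k • ι γ • g (N * t) • x ∈ S → ∃ γ' ∈ 𝓗, ∃ v ∈ D, c t k = v * γ') := by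
      intro γ
      by_cases hγ : ι γ • g (N * t) • x ∈ Q
      · obtain ⟨𝓗, h2, h3⟩ := hstep _ hγ
        exact ⟨𝓗, h3, fun _ => h2⟩
      · exact ⟨∅, by simpa using hM, fun h => absurd h hγ⟩
    choose 𝓗 h𝓗 h𝓗c using h1
    refine ⟨𝓖.biUnion fun γ => (𝓗 γ).image (· * c t γ), fun k hk hkS => ?_, ?_⟩
    · obtain ⟨γ, hγ, hγQ, v, hv, hkv⟩ := hcov k hk fun ℓ hℓ =>
        hkS ℓ (Finset.mem_Icc.2 ⟨(Finset.mem_Icc.1 hℓ).1, (Finset.mem_Icc.1 hℓ).2.trans (Nat.le_succ N)⟩)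
      have horb : g (N * t) • ι k • x = ι v • ι γ • g (N * t) • x := horbit _ _ _ _ hkv
      have h3 : g t • ι v • ι γ • g (N * t) • x ∈ S := by
        rw [← horb, smul_smul, ← hg.map_add]
        have := hkS (N + 1) (Finset.mem_Icc.2 ⟨Nat.succ_pos N, le_rfl⟩)
        have h4 : t + N * t = ((N + 1 : ℕ) : ℝ) * t := by push_cast; ring
        rwa [h4]
      obtain ⟨γ', hγ', v', hv', hvv'⟩ := h𝓗c γ hγQ v hv h3
      have h4 : ((N + 1 : ℕ) : ℝ) * t = t + N * t := by push_cast; ring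
      -- Boxes compose by c_t(vγ) = v'γ' c_t(γ); the new translation is γ' c_t(γ).
      have h5 : c (((N + 1 : ℕ) : ℝ) * t) k = v' * (γ' * c t γ) := by
        rw [h4, hcadd, hkv, map_mul, hvv', mul_assoc]
      refine ⟨γ' * c t γ, Finset.mem_biUnion.2 ⟨γ, hγ, Finset.mem_image.2 ⟨γ', hγ', rfl⟩⟩,
        hQ _ v' hv' ?_, v', hv', h5⟩
      rw [← horbit _ _ _ _ h5]
      exact hkS (N + 1) (Finset.mem_Icc.2 ⟨Nat.succ_pos N, le_rfl⟩)
    · have h2 : ((𝓖.biUnion fun γ => (𝓗 γ).image (· * c t γ)).card : ℝ) ≤ ∑ γ ∈ 𝓖, M := by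
        refine (Nat.cast_le.2 Finset.card_biUnion_le).trans ?_
        push_cast
        exact Finset.sum_le_sum fun γ _ => (Nat.cast_le.2 Finset.card_image_le).trans (h𝓗 γ)
      rw [Finset.sum_const, nsmul_eq_mul] at h2
      rw [pow_succ]
      exact h2.trans (mul_le_mul_of_nonneg_right hcard hM)

end Iteration

end HomDyn

/-! ### Assembly of the theorem. -/

open MeasureTheory HomDyn in
theorem theorem5p1
    {E : Type*} [NormedAddCommGroup E] [NormedSpace ℝ E] [FiniteDimensional ℝ E]
    {G : Type*} [Group G] [MetricSpace G] [ChartedSpace E G] [LieGroup 𝓘(ℝ, E) ∞ G]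
    [ConnectedSpace G]
    [Bundle.RiemannianBundle (fun x : G => TangentSpace 𝓘(ℝ, E) x)]
    [IsContMDiffRiemannianBundle 𝓘(ℝ, E) ∞ E (fun x : G => TangentSpace 𝓘(ℝ, E) x)]
    [IsRiemannianManifold 𝓘(ℝ, E) G] (hG : IsRightInvariant E G)
    (Γ : Subgroup G) [DiscreteTopology Γ] [MeasurableSpace (G ⧸ Γ)] [BorelSpace (G ⧸ Γ)]
    (μ : Measure (G ⧸ Γ)) [IsProbabilityMeasure μ] [SMulInvariantMeasure G (G ⧸ Γ) μ]
    (g : ℝ → G) (hg : IsOneParameter g) (hgd : IsAdDiagonalizable E g)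
    {E' : Type*} [NormedAddCommGroup E'] [NormedSpace ℝ E'] [FiniteDimensional ℝ E']
    {P : Type*} [Group P] [MetricSpace P] [ChartedSpace E' P] [LieGroup 𝓘(ℝ, E') ∞ P]
    [ConnectedSpace P] [Nontrivial P]
    [Bundle.RiemannianBundle (fun x : P => TangentSpace 𝓘(ℝ, E') x)]
    [IsContMDiffRiemannianBundle 𝓘(ℝ, E') ∞ E' (fun x : P => TangentSpace 𝓘(ℝ, E') x)]
    [IsRiemannianManifold 𝓘(ℝ, E') P]
    [MeasurableSpace P] [BorelSpace P] (ν : Measure P) [ν.IsHaarMeasure]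
    (ι : P →* G) (hι : IsRiemannianLieSubgroup E E' ι)
    (hPH : ∀ h : P, ι h ∈ unstableHorospherical g)
    (hPF : ∀ (t : ℝ) (h : P), g t * ι h * (g t)⁻¹ ∈ ι.range)
    (hEEP : EEP E E' Γ μ ν ι g) :
    (∃ B : OrthonormalBasis (Fin (Module.finrank ℝ E')) ℝ (TangentSpace 𝓘(ℝ, E') (1 : P)),
      IsTessellationBasis E' ν B) ∧
    (∃ rs : ℝ, IsExpRadius E' P rs) ∧
    ∀ (p : ℕ) (B : OrthonormalBasis (Fin p) ℝ (TangentSpace 𝓘(ℝ, E') (1 : P))) (rs : ℝ),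
      IsTessellationBasis E' ν B → IsExpRadius E' P rs →
      ∃ a' b' C₂ lam : ℝ, 0 < a' ∧ 0 < b' ∧ 0 < C₂ ∧ 0 < lam ∧
        Real.log (8 * √(p : ℝ)) / lambdaMin E E' ι g ≤ a' ∧
        Real.log (8 * √(p : ℝ)) / lambdaMin E E' ι g ≤ b' ∧
        ∀ O : Set (G ⧸ Γ), IsOpen O →
        ∀ r : ℝ, 0 < r → r < 1 / 2 * min (injRadiusOn Γ (nbhd Γ (1 / 2) Oᶜ)) rs →
        ∀ x ∈ nbhd Γ r Oᶜ, ∀ t : ℝ, a' + b' * Real.log (1 / r) ≤ t → ∀ N : ℕ,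
          ∃ 𝓕 : Finset (Set P),
            (∀ R ∈ 𝓕, IsBowenBox E' ι g B ((N : ℝ) * t) r R) ∧
            escapeSet E' Γ ι g B x N t r Oᶜ ⊆ ⋃ R ∈ 𝓕, R ∧
            (𝓕.card : ℝ) ≤ Real.exp (deltaTr E E' ι g * N * t) *
              (1 - (μ (innerCore Γ r O)).toReal + C₂ / r ^ p * Real.exp (-lam * t)) ^ N := by
  have : IsTopologicalGroup P := topologicalGroup_of_lieGroup 𝓘(ℝ, E') ∞
  have : LocallyCompactSpace P := Manifold.locallyCompact_of_finiteDimensional 𝓘(ℝ, E')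
  have hP := hι.isRightInvariant hG
  have hrG := dist_mul_right_of_isRightInvariant hG
  have hιd := hι.dist_map_le
  obtain ⟨c, b, w, h, hw, hc, hδ⟩ := exists_isExpandingExp hG hg hgd hι hPH hPF
  refine ⟨exists_isTessellationBasis ν hP h hw, exists_isExpRadius hP, fun p B rs hB hrs => ?_⟩
  obtain rfl : p = Module.finrank ℝ (LieAlg E' P) := by
    have := Module.finrank_eq_card_basis B.toBasis
    rw [Fintype.card_fin] at this
    exact this.symm
  -- Exp is onto, so a zero-dimensional Lie algebra would make `P` trivial.
  have hp0 : Module.finrank ℝ (LieAlg E' P) ≠ 0 := by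
    intro h0
    have : Subsingleton (LieAlg E' P) := Module.finrank_zero_iff.1 h0
    exact not_subsingleton P (h.surjective_exp.subsingleton)
  obtain ⟨a₁, ha₁, b₁, hb₁, C, hC, lam, hlam, hstep⟩ := exists_cover_one_step hG hι hEEP hp0 h hc hB hrs
  set q := Real.log (8 * √(Module.finrank ℝ (LieAlg E' P) : ℝ)) / lambdaMin E E' ι g with hq
  -- Enlarging both constants only strengthens the condition on t, since log(1/r) ≥ 0.
  refine ⟨max a₁ q, max b₁ q, C, lam, lt_max_of_lt_left ha₁, lt_max_of_lt_left hb₁, hC, hlam, 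
    le_max_right _ _, le_max_right _ _, fun O _ r hr hrr x hx t ht N => ?_⟩
  have hrs4 := hrs.2.1
  have hrrs : r < rs / 2 := by have := min_le_right (injRadiusOn Γ (nbhd Γ (1 / 2) Oᶜ)) rs; linarith
  have hrinj : 2 * r < injRadiusOn Γ (nbhd Γ (1 / 2) Oᶜ) := by
    have := min_le_left (injRadiusOn Γ (nbhd Γ (1 / 2) Oᶜ)) rs; linarith
  have hlog : 0 ≤ Real.log (1 / r) := Real.log_nonneg ((one_le_div hr).2 (by linarith))
  have ht' : a₁ + b₁ * Real.log (1 / r) ≤ t := 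
    (add_le_add (le_max_left _ _) (mul_le_mul_of_nonneg_right (le_max_left _ _) hlog)).trans ht
  have ht0 : 0 ≤ t := le_trans (by positivity) ht'
  -- As r < 1/2, all base points of the iteration lie in the 1/2-neighbourhood of Oᶜ on which the
  -- injectivity radius is controlled.
  have hinj : ∀ y ∈ nbhd Γ r Oᶜ, r ≤ injRadius Γ y := by
    intro y hy
    obtain ⟨k, hk, hkO⟩ := (mem_nbhd_iff hrG).1 hy
    have := injRadiusOn_le (x := y) ((mem_nbhd_iff hrG).2 ⟨k, (by linarith : dist k 1 < 1 / 2), hkO⟩)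
    linarith
  set M := Real.exp ((∑ i, w i) * t) * 
    (1 - (μ (innerCore Γ r O)).toReal + C / r ^ Module.finrank ℝ (LieAlg E' P) * Real.exp (-lam * t)) with hM
  have hM0 : 0 ≤ M := by
    have h1 : 0 ≤ 1 - (μ (innerCore Γ r O)).toReal := sub_nonneg.2 measureReal_le_one
    positivity
  obtain ⟨𝓖, hcov, hcard⟩ := exists_cover_iterate (D := closure (boxV E' B r)) (S := Oᶜ) (Q := nbhd Γ r Oᶜ) 
    hg hc h.flow_add h.flow_zero hM0 (fun y v hv hvy => by
      obtain ⟨u, hu, rfl⟩ := closure_boxV_subset hp0 h B hr hv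
      refine (mem_nbhd_iff hrG).2 ⟨_, ?_, hvy⟩
      have h1 := hιd (gexp u) 1
      rw [map_one] at h1
      have h2 := h.dist_le u
      simp only [Set.mem_ofPred_eq] at hu
      linarith) (fun y hy => hstep O r hr hrrs y (hinj y hy) t ht') hx N
  classical
  refine ⟨𝓖.image fun γ => {k : P | ∃ v ∈ closure (boxV E' B r), ι k = g (-(N * t)) * ι (v * γ) * g (N * t)}, 
    fun R hR => ?_, fun k hk => ?_, ?_⟩
  · obtain ⟨γ, -, rfl⟩ := Finset.mem_image.1 hR
    exact ⟨by positivity, γ, rfl⟩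
  · obtain ⟨γ, hγ, -, v, hv, hkv⟩ := hcov k hk.1 hk.2
    refine Set.mem_biUnion (Finset.mem_coe.2 (Finset.mem_image_of_mem _ hγ)) ⟨v, hv, ?_⟩
    rw [← hkv, hc, hg.map_neg]
    group
  · refine (Nat.cast_le.2 Finset.card_image_le).trans (hcard.trans (le_of_eq ?_))
    rw [hM, mul_pow, ← Real.exp_nat_mul, hδ]
    congr 2
    ring
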